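/- Let $n\ge 1$, $\alpha\in(0,n)$, $\beta\in(0,2]$, $p>1$, $q\ge 1$, and consider on $\mathbb R^n$ the Cauchy problem $$u_t+(-\Delta)^{\beta/2}u=I_\alpha(|u|^p)\,|u|^q,\quad t>0,\qquad u(0,\cdot)=u_0, \tag{P}$$ where $I_\alpha g(x)=A_\alpha\int_{\mathbb R^n}|x-y|^{-(n-\alpha)}g(y)\,dy$ is the Riesz potential, $A_\alpha=\dfrac{\Gamma((n-\alpha)/2)}{\Gamma(\alpha/2)\,\pi^{n/2}2^\alpha}$. Let $S_\beta(t)$ be convolution with the kernel $S_\beta(x,t)=(2\pi)^{-n}\int_{\mathbb R^n}e^{ix\cdot\xi-t|\xi|^\beta}\,d\xi$, $t>0$. For $0<T\le\infty$, a mild solution of (P) on $[0,T)$ is a measurable real function $u$ such that, for every $t\in(0,T)$ and almost every $x\in\mathbb R^n$, $$u(t)=S_\beta(t)u_0+\int_0^tS_\beta(t-\tau)\big[I_\alpha(|u(\tau)|^p)\,|u(\tau)|^q\big]\,d\tau,$$ both terms on the right being absolutely convergent integrals. It is global if $T=\infty$. For $1\le s<\infty$, a mild solution on $[0,T)$ is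 said to be in $L^s\cap L^\infty$ if $u\in C([0,T),L^s(\mathbb R^n))$, $u(0)=u_0$, and $u\in L^\infty((0,T'),L^\infty(\mathbb R^n))$ for every finite $T'<T$; it is maximal if it is not the restriction of a mild solution in $L^s\cap L^\infty$ on a longer interval $[0,T')$, $T'>T$. **Theorem (Blow-up).** Assume one of the following. (i) $\alpha+\beta>n$, $u_0\in L^1(\mathbb R^n)$, $\displaystyle\int_{\mathbb R^n}u_0(x)\,dx>0$ and $2<p+q<1+\dfrac{\alpha+\beta}{n}$. (ii) $u_0\in L^1_{\rm loc}(\mathbb R^n)$, $u_0(x)\ge\varepsilon(1+|x|^2)^{-\gamma/2}$ for a.e. $x$, and $2<p+q<1+\dfrac{\alpha+\beta}{\gamma}$, for some $\varepsilon>0$ and some $\gamma\in(0,\alpha+\beta)$. Then the local mild solutions of (P) blow up in finite time, that is: (a) there is a finite $T^*$, depending on the data, such that every mild solution of (P) on an interval $[0,T)$ satisfies $T\le T^*$; in particular (P) has no global mild solution; (b) for every $s$ with $1\le s<np/\alpha$, every mild solution $u$ in $L^s\cap L^\infty$ on an interval $[0,T)$ is the restriction of a maximal mild solution $v$ in $L^s\cap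 L^\infty$, on an interval $[0,T_{\max})$ with $T\le T_{\max}<\infty$, and $$\lim_{t\to T_{\max}^-}\big(\|v(t)\|_{L^\infty(\mathbb R^n)}+\|v(t)\|_{L^s(\mathbb R^n)}\big)=+\infty .$$ -/

import Mathlib

open MeasureTheory Filter Topology Set
open scoped ENNReal

noncomputable section

/-- The fundamental solution of `u_t + (-Δ)^{β/2} u = 0` on `ℝⁿ`,
`S_β(x,t) = (2π)^{-n} ∫ exp(i x·ξ - t |ξ|^β) dξ`, for `t > 0`.  It is real, nonnegative, and has
integral one in `x`. -/
def fracHeatKernel (n : ℕ) (β t : ℝ) (x : EuclideanSpace ℝ (Fin n)) : ℝ :=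
  ((2 * Real.pi) ^ n)⁻¹ *
    (∫ ξ : EuclideanSpace ℝ (Fin n),
      Complex.exp (Complex.I * ((inner ℝ x ξ : ℝ) : ℂ) - ((t * ‖ξ‖ ^ β : ℝ) : ℂ))).re

/-- The constant `A_α = Γ((n-α)/2) / (Γ(α/2) π^{n/2} 2^α)`. -/
def rieszConst (n : ℕ) (α : ℝ) : ℝ :=
  Real.Gamma ((n - α) / 2) / (Real.Gamma (α / 2) * Real.pi ^ ((n : ℝ) / 2) * 2 ^ α)

/-- The Riesz potential `I_α(g)(x) = A_α ∫ |x-y|^{-(n-α)} g(y) dy` of a nonnegative function,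
with values in `[0,∞]`. -/
def rieszPotential (n : ℕ) (α : ℝ) (g : EuclideanSpace ℝ (Fin n) → ℝ≥0∞)
    (x : EuclideanSpace ℝ (Fin n)) : ℝ≥0∞ :=
  ∫⁻ y, ENNReal.ofReal (rieszConst n α * ‖x - y‖ ^ (-((n : ℝ) - α))) * g y

/-- The nonlinearity `I_α(|v|^p) |v|^q`, with values in `[0,∞]`. -/
def hartree (n : ℕ) (α p q : ℝ) (v : EuclideanSpace ℝ (Fin n) → ℝ)
    (x : EuclideanSpace ℝ (Fin n)) : ℝ≥0∞ :=
  rieszPotential n α (fun y => ENNReal.ofReal (|v y| ^ p)) x * ENNReal.ofReal (|v x| ^ q)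

/-- The Duhamel term `∫_0^t (S_β(t-τ) * [I_α(|u(τ)|^p)|u(τ)|^q])(x) dτ`; all factors being
nonnegative, it is a Lebesgue integral with values in `[0,∞]`. -/
def duhamel (n : ℕ) (α β p q : ℝ) (u : ℝ → EuclideanSpace ℝ (Fin n) → ℝ) (t : ℝ)
    (x : EuclideanSpace ℝ (Fin n)) : ℝ≥0∞ :=
  ∫⁻ τ in Ioo 0 t, ∫⁻ y,
    ENNReal.ofReal (fracHeatKernel n β (t - τ) (x - y)) * hartree n α p q (u τ) y

/-- `u` is a mild solution on `(0,T)`, `0 < T ≤ ∞`, with initial datum `u0`: the integral equation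
`u(t) = S_β(t) u0 + ∫_0^t S_β(t-τ) I_α(|u|^p)|u|^q dτ` holds almost everywhere in space at every
time `t ∈ (0,T)`, both terms on the right being absolutely convergent.  No function space is
imposed on `u`. -/
structure IsMildSolution (n : ℕ) (α β p q : ℝ) (u0 : EuclideanSpace ℝ (Fin n) → ℝ) (T : EReal)
    (u : ℝ → EuclideanSpace ℝ (Fin n) → ℝ) : Prop where
  pos : 0 < T
  aemeasurable : AEMeasurable (Function.uncurry u)
    ((volume.restrict {t : ℝ | 0 < t ∧ (t : EReal) < T}).prod volume)
  linear_integrable : ∀ t : ℝ, 0 < t → (t : EReal) < T → ∀ᵐ x,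
    Integrable (fun y => fracHeatKernel n β t (x - y) * u0 y)
  duhamel_finite : ∀ t : ℝ, 0 < t → (t : EReal) < T → ∀ᵐ x, duhamel n α β p q u t x < ∞
  equation : ∀ t : ℝ, 0 < t → (t : EReal) < T → ∀ᵐ x,
    u t x = (∫ y, fracHeatKernel n β t (x - y) * u0 y) + (duhamel n α β p q u t x).toReal

/-- A mild solution of class `C([0,T), L^s(ℝⁿ)) ∩ L^∞_loc([0,T), L^∞(ℝⁿ))` with `u(0) = u0`. -/
structure IsMildSolutionIn (n : ℕ) (α β p q s : ℝ) (u0 : EuclideanSpace ℝ (Fin n) → ℝ)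
    (T : EReal) (u : ℝ → EuclideanSpace ℝ (Fin n) → ℝ) : Prop
    extends IsMildSolution n α β p q u0 T u where
  initial : u 0 =ᵐ[volume] u0
  memLp : ∀ t : ℝ, 0 ≤ t → (t : EReal) < T → MemLp (u t) (ENNReal.ofReal s) volume
  continuous : ∀ t₀ : ℝ, 0 ≤ t₀ → (t₀ : EReal) < T →
    Tendsto (fun t : ℝ => eLpNorm (u t - u t₀) (ENNReal.ofReal s) volume)
      (𝓝[{t : ℝ | 0 ≤ t ∧ (t : EReal) < T}] t₀) (𝓝 0)
  bounded : ∀ T' : ℝ, (T' : EReal) < T →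
    ∃ M : ℝ, ∀ t : ℝ, 0 ≤ t → t ≤ T' → eLpNorm (u t) ∞ volume ≤ ENNReal.ofReal M

/-- A maximal mild solution: one which has no extension of the same class to a longer time
interval.  `T` is its maximal existence time `T_max ∈ (0,∞]`. -/
def IsMaximalMildSolution (n : ℕ) (α β p q s : ℝ) (u0 : EuclideanSpace ℝ (Fin n) → ℝ)
    (T : EReal) (u : ℝ → EuclideanSpace ℝ (Fin n) → ℝ) : Prop :=
  IsMildSolutionIn n α β p q s u0 T u ∧
    ∀ (T' : EReal) (v : ℝ → EuclideanSpace ℝ (Fin n) → ℝ), T < T' →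
      IsMildSolutionIn n α β p q s u0 T' v →
        ¬ ∀ t : ℝ, 0 ≤ t → (t : EReal) < T → v t =ᵐ[volume] u t

/-- The local mild solutions with initial datum `u0` blow up in finite time: the existence times of
all mild solutions, in whatever function space, are bounded by one finite time (so none is global),
and for every exponent `1 ≤ s < np/α` every local mild solution in the space `L^s ∩ L^∞` is the
restriction of a maximal one, whose maximal existence time `Tmax` is finite and for which
`‖v(t)‖_∞ + ‖v(t)‖_s → ∞` as `t → Tmax⁻`. -/
def MildSolutionsBlowUp (n : ℕ) (α β p q : ℝ) (u0 : EuclideanSpace ℝ (Fin n) → ℝ) : Prop :=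
  (∃ Tstar : ℝ, ∀ (T : EReal) (u : ℝ → EuclideanSpace ℝ (Fin n) → ℝ),
      IsMildSolution n α β p q u0 T u → T ≤ (Tstar : EReal)) ∧
  ∀ s : ℝ, 1 ≤ s → s < n * p / α →
    ∀ (T : EReal) (u : ℝ → EuclideanSpace ℝ (Fin n) → ℝ),
      IsMildSolutionIn n α β p q s u0 T u →
        ∃ (Tmax : ℝ) (v : ℝ → EuclideanSpace ℝ (Fin n) → ℝ),
          T ≤ (Tmax : EReal) ∧
          (∀ t : ℝ, 0 ≤ t → (t : EReal) < T → v t =ᵐ[volume] u t) ∧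
          IsMaximalMildSolution n α β p q s u0 (Tmax : EReal) v ∧
          Tendsto (fun t : ℝ => eLpNorm (v t) ∞ volume + eLpNorm (v t) (ENNReal.ofReal s) volume)
            (𝓝[<] Tmax) (𝓝 ∞)

end

/-! ### Positivity of Gaussian-weighted cosine transforms: the symbols `exp (-t * l ^ a)` for `0 < a
≤ 1`. -/

section GaussianPositivity

variable {V : Type*} [NormedAddCommGroup V] [InnerProductSpace ℝ V] [FiniteDimensional ℝ V]
  [MeasurableSpace V] [BorelSpace V]

/-! The finite lifespan comes from pointwise lower bounds propagated by the integral equation, not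
from test functions. Near the origin the kernel `fracHeatKernel n β (σ ^ β)` is at least of order `σ
^ (-n)`, so the heat flow keeps a fixed fraction of the mass of a ball of radius of order `ρ` during
times up to `ρ ^ β`. If `u ≥ M` on such a ball, the Riesz potential makes the nonlinearity at least
of order `ρ ^ α * M ^ (p + q)` there, and the Duhamel term adds this quantity times the elapsed
time.

Suppose the linear evolution is at least of order `ρ ^ (-g)` on the ball for times in `[ρ ^ β / 2, ρ
^ β]`. Feeding this bound back over time gaps that halve at each step multiplies it by a fixed
factor `A > 1` every time, as soon as `ρ ^ (α + β - g * (p + q - 1))` is large. For `g * (p + q - 1)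
< α + β` a large `ρ` achieves this, and `u` would exceed every bound on a ball at the finite time `ρ
^ β` (`exists_lifespan_bound_of_linear_lower_bound`). Positive total mass gives `g = n`, because the
kernel flattens at large scales (`exists_lifespan_bound_of_integral_pos`); slow decay gives `g = γ`
(`exists_lifespan_bound_of_slow_decay`). The two subcritical conditions are exactly the inequality
on `g`.

The norm blow-up is the continuation principle. For `s < n * p / α` the nonlinearity is bounded and
locally Lipschitz on `L^s ∩ L^∞` (`exists_hartree_bounds`), so bounded solutions are unique
(`BddSol.ae_eq`) and exist for a time depending only on the size of the datum (`exists_bddSol`).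
Patching over all lifespans produces a solution on the longest interval, whose length is finite by
the lifespan bound. If its norms failed to tend to infinity, restarting close enough to the end
would prolong it (`IsMildSolutionIn.exists_maximal`).

All of this needs the kernel to be a nonnegative semigroup of mass one. Nonnegativity is proved by
writing `exp (-t * ‖ξ‖ ^ β)` as a limit of positive superpositions of Gaussians; integrability, mass
and the semigroup law then follow from Fourier inversion. -/

lemma integrable_exp_neg_mul_sq_norm {δ : ℝ} (hδ : 0 < δ) :
    Integrable (fun ξ : V => Real.exp (-δ * ‖ξ‖ ^ 2)) := by
  have h := GaussianFourier.integrable_cexp_neg_mul_sq_norm_add (V := V) (b := (δ : ℂ))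
    (by simpa using hδ) 0 0
  refine h.norm.congr (Eventually.of_forall fun ξ => ?_)
  simp only [zero_mul, add_zero, Complex.norm_exp]
  congr 1
  have : (-(δ : ℂ) * (‖ξ‖ : ℂ) ^ 2) = ((-δ * ‖ξ‖ ^ 2 : ℝ) : ℂ) := by push_cast; ring
  rw [this, Complex.ofReal_re]

/-- A radial symbol `ξ ↦ f (‖ξ‖²)`, bounded on `[0, ∞)`, all of whose products with Gaussians have
a nonnegative cosine transform on `V`. -/
structure GaussPositive (V : Type*) [NormedAddCommGroup V] [InnerProductSpace ℝ V]
    [MeasurableSpace V] [BorelSpace V] [FiniteDimensional ℝ V] (f : ℝ → ℝ) : Prop where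
  measurable : Measurable f
  bounded : ∃ C, ∀ l, 0 ≤ l → |f l| ≤ C
  nonneg : ∀ δ, 0 < δ → ∀ x : V,
    0 ≤ ∫ ξ : V, Real.cos (inner ℝ x ξ) * (f (‖ξ‖ ^ 2) * Real.exp (-δ * ‖ξ‖ ^ 2))

lemma integrable_bounded_gauss {f : ℝ → ℝ} (hf : Measurable f) {C : ℝ}
    (hC : ∀ l, 0 ≤ l → |f l| ≤ C) {δ : ℝ} (hδ : 0 < δ) (x : V) :
    Integrable (fun ξ : V =>
      Real.cos (inner ℝ x ξ) * (f (‖ξ‖ ^ 2) * Real.exp (-δ * ‖ξ‖ ^ 2))) := by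
  refine ((integrable_exp_neg_mul_sq_norm (V := V) hδ).const_mul C).mono' ?_
    (Eventually.of_forall fun ξ => ?_)
  · exact (Measurable.mul (by fun_prop) (Measurable.mul (hf.comp (by fun_prop))
      (by fun_prop))).aestronglyMeasurable
  · rw [norm_mul, norm_mul, Real.norm_eq_abs, Real.norm_eq_abs, Real.norm_eq_abs, Real.abs_exp]
    have h1 := Real.abs_cos_le_one (inner ℝ x ξ)
    have h2 := hC (‖ξ‖ ^ 2) (by positivity)
    have h3 := (Real.exp_pos (-δ * ‖ξ‖ ^ 2)).le
    calc _ ≤ 1 * (C * Real.exp (-δ * ‖ξ‖ ^ 2)) := by gcongr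
      _ = _ := by ring

/-- The Fourier transform of a Gaussian is again a Gaussian, hence positive. -/
lemma GaussPositive.one : GaussPositive V (fun _ => 1) := by
  refine ⟨measurable_const, ⟨1, by simp⟩, fun δ hδ x => ?_⟩
  have hb : 0 < ((δ : ℂ)).re := by simpa using hδ
  have h := GaussianFourier.integral_cexp_neg_mul_sq_norm_add (V := V) (b := (δ : ℂ)) hb Complex.I x
  have hi := GaussianFourier.integrable_cexp_neg_mul_sq_norm_add (V := V) (b := (δ : ℂ)) hb
    Complex.I x
  have h2 : ∫ ξ : V, Real.cos (inner ℝ x ξ) * (1 * Real.exp (-δ * ‖ξ‖ ^ 2))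
      = (∫ v : V, Complex.exp (-(δ : ℂ) * (‖v‖ : ℂ) ^ 2 + Complex.I * (inner ℝ x v : ℝ))).re := by
    rw [← Complex.reCLM_apply, ← ContinuousLinearMap.integral_comp_comm _ hi]
    refine integral_congr_ae (Eventually.of_forall fun ξ => ?_)
    simp only [Complex.reCLM_apply]
    have : (-(δ : ℂ) * (‖ξ‖ : ℂ) ^ 2 + Complex.I * (inner ℝ x ξ : ℝ))
        = ((-δ * ‖ξ‖ ^ 2 : ℝ) : ℂ) + (inner ℝ x ξ : ℝ) * Complex.I := by push_cast; ring
    rw [this, Complex.exp_re, Complex.add_re, Complex.add_im, Complex.ofReal_re, Complex.ofReal_im,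
      Complex.re_ofReal_mul, Complex.im_ofReal_mul, Complex.I_re, Complex.I_im]
    simp only [mul_zero, add_zero, mul_one, zero_add]
    ring
  rw [h2, h]
  have e1 : ((Real.pi : ℂ) / δ) ^ ((Module.finrank ℝ V : ℂ) / 2)
      = (((Real.pi / δ) ^ ((Module.finrank ℝ V : ℝ) / 2) : ℝ) : ℂ) := by
    rw [Complex.ofReal_cpow (by positivity)]; push_cast; rfl
  have e2 : Complex.exp (Complex.I ^ 2 * (‖x‖ : ℂ) ^ 2 / (4 * δ))
      = ((Real.exp (-‖x‖ ^ 2 / (4 * δ)) : ℝ) : ℂ) := by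
    rw [Complex.I_sq]; push_cast; congr 1; ring
  rw [e1, e2, ← Complex.ofReal_mul, Complex.ofReal_re]
  positivity

lemma GaussPositive.const_mul {f : ℝ → ℝ} (hf : GaussPositive V f) {c : ℝ} (hc : 0 ≤ c) :
    GaussPositive V (fun l => c * f l) := by
  obtain ⟨C, hC⟩ := hf.bounded
  refine ⟨hf.measurable.const_mul c, ⟨c * C, fun l hl => ?_⟩, fun δ hδ x => ?_⟩
  · rw [abs_mul, abs_of_nonneg hc]; exact mul_le_mul_of_nonneg_left (hC l hl) hc
  · have : ∀ ξ : V, Real.cos (inner ℝ x ξ) * (c * f (‖ξ‖ ^ 2) * Real.exp (-δ * ‖ξ‖ ^ 2))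
        = c * (Real.cos (inner ℝ x ξ) * (f (‖ξ‖ ^ 2) * Real.exp (-δ * ‖ξ‖ ^ 2))) := by
      intro ξ; ring
    simp_rw [this, integral_const_mul]
    exact mul_nonneg hc (hf.nonneg δ hδ x)

lemma GaussPositive.add {f g : ℝ → ℝ} (hf : GaussPositive V f) (hg : GaussPositive V g) :
    GaussPositive V (fun l => f l + g l) := by
  obtain ⟨C, hC⟩ := hf.bounded
  obtain ⟨D, hD⟩ := hg.bounded
  refine ⟨hf.measurable.add hg.measurable, ⟨C + D, fun l hl => ?_⟩, fun δ hδ x => ?_⟩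
  · exact (abs_add_le _ _).trans (add_le_add (hC l hl) (hD l hl))
  · simp_rw [add_mul, mul_add]
    rw [integral_add (integrable_bounded_gauss hf.measurable hC hδ x)
      (integrable_bounded_gauss hg.measurable hD hδ x)]
    exact add_nonneg (hf.nonneg δ hδ x) (hg.nonneg δ hδ x)

lemma GaussPositive.zero : GaussPositive V (fun _ => 0) := by
  simpa using (GaussPositive.one (V := V)).const_mul le_rfl

lemma GaussPositive.sum {f : ℕ → ℝ → ℝ} (hf : ∀ j, GaussPositive V (f j)) (N : ℕ) :
    GaussPositive V (fun l => ∑ j ∈ Finset.range N, f j l) := by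
  induction N with
  | zero => simpa using GaussPositive.zero
  | succ N ih => simpa [Finset.sum_range_succ] using ih.add (hf N)

/-- The Gaussian factor in `GaussPositive` supplies the integrable majorant `C * exp (-δ * ‖ξ‖ ^
2)`, so a uniform bound on the symbols is enough for dominated convergence. -/
lemma GaussPositive.of_tendsto {f : ℕ → ℝ → ℝ} {g : ℝ → ℝ} (hf : ∀ j, GaussPositive V (f j))
    (hg : Measurable g) {C : ℝ} (hC : ∀ j l, 0 ≤ l → |f j l| ≤ C)
    (h : ∀ l, 0 ≤ l → Tendsto (fun j => f j l) atTop (𝓝 (g l))) : GaussPositive V g := by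
  refine ⟨hg, ⟨C, fun l hl => ?_⟩, fun δ hδ x => ?_⟩
  · exact le_of_tendsto (h l hl).abs (Eventually.of_forall fun j => hC j l hl)
  · refine ge_of_tendsto (tendsto_integral_of_dominated_convergence
      (F := fun j ξ => Real.cos (inner ℝ x ξ) * (f j (‖ξ‖ ^ 2) * Real.exp (-δ * ‖ξ‖ ^ 2)))
      (fun ξ => C * Real.exp (-δ * ‖ξ‖ ^ 2)) (fun j => ?_)
      ((integrable_exp_neg_mul_sq_norm (V := V) hδ).const_mul C) (fun j => ?_) ?_)
      (Eventually.of_forall fun j => (hf j).nonneg δ hδ x)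
    · exact (integrable_bounded_gauss (hf j).measurable (hC j) hδ x).aestronglyMeasurable
    · refine Eventually.of_forall fun ξ => ?_
      rw [norm_mul, norm_mul, Real.norm_eq_abs, Real.norm_eq_abs, Real.norm_eq_abs, Real.abs_exp]
      have h1 := Real.abs_cos_le_one (inner ℝ x ξ)
      have h2 := hC j (‖ξ‖ ^ 2) (by positivity)
      have h3 := (Real.exp_pos (-δ * ‖ξ‖ ^ 2)).le
      calc _ ≤ 1 * (C * Real.exp (-δ * ‖ξ‖ ^ 2)) := by gcongr
        _ = _ := by ring
    · exact Eventually.of_forall fun ξ =>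
        ((h (‖ξ‖ ^ 2) (by positivity)).mul_const _).const_mul _

lemma integrable_exp_mul_weight {w : ℝ → ℝ} {ε : ℝ} (hε : 0 ≤ ε)
    (hw : IntegrableOn w (Ioi ε)) {l : ℝ} (hl : 0 ≤ l) :
    IntegrableOn (fun s => Real.exp (-l * s) * w s) (Ioi ε) := by
  refine hw.norm.mono' (Measurable.aestronglyMeasurable (by fun_prop) |>.mul
    hw.aestronglyMeasurable) ((ae_restrict_mem measurableSet_Ioi).mono fun s hs => ?_)
  have : (0 : ℝ) ≤ s := hε.trans (le_of_lt hs)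
  rw [norm_mul, Real.norm_eq_abs, Real.abs_exp]
  refine mul_le_of_le_one_left (norm_nonneg _) (Real.exp_le_one_iff.2 ?_)
  nlinarith

/-- At `l = ‖ξ‖ ^ 2` the factor `exp (-l * s)` is itself a Gaussian, so it only turns `δ` into `δ +
s`. By Fubini the transform is an average of nonnegative transforms with the weight `w`. This is why
positivity is required for every `δ`. -/
lemma GaussPositive.mul_laplace {f w : ℝ → ℝ} (hf : GaussPositive V f) {ε : ℝ} (hε : 0 ≤ ε)
    (hwm : Measurable w) (hw : IntegrableOn w (Ioi ε)) (hw0 : ∀ s ∈ Ioi ε, 0 ≤ w s) :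
    GaussPositive V (fun l => f l * ∫ s in Ioi ε, Real.exp (-l * s) * w s) := by
  obtain ⟨C, hC⟩ := hf.bounded
  have hC0 : 0 ≤ C := (abs_nonneg _).trans (hC 0 le_rfl)
  refine ⟨?_, ⟨C * ∫ s in Ioi ε, w s, fun l hl => ?_⟩, fun δ hδ x => ?_⟩
  · refine hf.measurable.mul ?_
    have : StronglyMeasurable (Function.uncurry fun l s : ℝ => Real.exp (-l * s) * w s) := by
      apply Measurable.stronglyMeasurable
      exact Measurable.mul (by fun_prop) (hwm.comp measurable_snd)
    exact this.integral_prod_right.measurable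
  · rw [abs_mul]
    refine mul_le_mul (hC l hl) ?_ (abs_nonneg _) hC0
    rw [abs_of_nonneg]
    · refine setIntegral_mono_on (integrable_exp_mul_weight hε hw hl) hw measurableSet_Ioi ?_
      intro s hs
      refine mul_le_of_le_one_left (hw0 s hs) (Real.exp_le_one_iff.2 ?_)
      have : (0 : ℝ) ≤ s := hε.trans (le_of_lt hs)
      nlinarith
    · exact setIntegral_nonneg measurableSet_Ioi fun s hs =>
        mul_nonneg (Real.exp_pos _).le (hw0 s hs)
  · have key : ∫ ξ : V, Real.cos (inner ℝ x ξ) *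
        ((f (‖ξ‖ ^ 2) * ∫ s in Ioi ε, Real.exp (-(‖ξ‖ ^ 2) * s) * w s) *
          Real.exp (-δ * ‖ξ‖ ^ 2))
        = ∫ s in Ioi ε, (∫ ξ : V, Real.cos (inner ℝ x ξ) * (f (‖ξ‖ ^ 2) *
          Real.exp (-(δ + s) * ‖ξ‖ ^ 2))) * w s := by
      simp_rw [← integral_mul_const]
      rw [← integral_integral_swap]
      · refine integral_congr_ae (Eventually.of_forall fun ξ => ?_)
        simp only
        rw [show ∀ A B D F : ℝ, A * ((B * D) * F) = (A * B * F) * D by intros; ring,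
          ← integral_const_mul]
        refine integral_congr_ae (Eventually.of_forall fun s => ?_)
        simp only
        rw [show -(δ + s) * ‖ξ‖ ^ 2 = -δ * ‖ξ‖ ^ 2 + -(‖ξ‖ ^ 2) * s by ring, Real.exp_add]
        ring
      · have hint : Integrable (fun z : V × ℝ => (C * Real.exp (-δ * ‖z.1‖ ^ 2)) * w z.2)
            (volume.prod (volume.restrict (Ioi ε))) :=
          ((integrable_exp_neg_mul_sq_norm (V := V) hδ).const_mul C).mul_prod hw
        refine hint.mono' ?_ ?_
        · apply Measurable.aestronglyMeasurable
          refine Measurable.mul (Measurable.mul (by fun_prop) (Measurable.mul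
            (hf.measurable.comp (by fun_prop)) (by fun_prop))) (hwm.comp measurable_snd)
        · have : ∀ᵐ z : V × ℝ ∂(volume.prod (volume.restrict (Ioi ε))), z.2 ∈ Ioi ε := by
            have h := ae_restrict_mem (μ := (volume : Measure ℝ)) (s := Ioi ε) measurableSet_Ioi
            exact Measure.quasiMeasurePreserving_snd.ae h
          filter_upwards [this] with z hz
          have hz0 : (0 : ℝ) ≤ z.2 := hε.trans (le_of_lt hz)
          simp only [Function.uncurry]
          rw [norm_mul, norm_mul, norm_mul, Real.norm_eq_abs, Real.norm_eq_abs, Real.norm_eq_abs,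
            Real.norm_eq_abs, Real.abs_exp, abs_of_nonneg (hw0 _ hz)]
          have h1 := Real.abs_cos_le_one (inner ℝ x z.1)
          have h2 := hC (‖z.1‖ ^ 2) (by positivity)
          have h3 : Real.exp (-(δ + z.2) * ‖z.1‖ ^ 2) ≤ Real.exp (-δ * ‖z.1‖ ^ 2) := by
            apply Real.exp_le_exp.2; nlinarith [mul_nonneg hz0 (sq_nonneg ‖z.1‖)]
          refine mul_le_mul_of_nonneg_right ?_ (hw0 _ hz)
          calc _ ≤ 1 * (C * Real.exp (-δ * ‖z.1‖ ^ 2)) := by gcongr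
            _ = _ := by ring
    rw [key]
    refine setIntegral_nonneg measurableSet_Ioi fun s hs => mul_nonneg ?_ (hw0 s hs)
    exact hf.nonneg _ (by have := hε.trans_lt hs; linarith) x

/-- The powers of a Laplace transform are in the class by `GaussPositive.mul_laplace`, hence so are
the partial sums of the exponential series, all bounded by `exp (∫ w)`. -/
lemma GaussPositive.exp_laplace {w : ℝ → ℝ} {ε : ℝ} (hε : 0 ≤ ε)
    (hwm : Measurable w) (hw : IntegrableOn w (Ioi ε)) (hw0 : ∀ s ∈ Ioi ε, 0 ≤ w s) :
    GaussPositive V (fun l => Real.exp (∫ s in Ioi ε, Real.exp (-l * s) * w s)) := by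
  set h : ℝ → ℝ := fun l => ∫ s in Ioi ε, Real.exp (-l * s) * w s with hh
  have hpow : ∀ j : ℕ, GaussPositive V (fun l => h l ^ j) := by
    intro j
    induction j with
    | zero => simpa using GaussPositive.one
    | succ j ih => simpa only [pow_succ] using ih.mul_laplace hε hwm hw hw0
  have h0 : ∀ l, 0 ≤ h l := fun l => setIntegral_nonneg measurableSet_Ioi fun s hs =>
        mul_nonneg (Real.exp_pos _).le (hw0 s hs)
  have hbd : ∀ l, 0 ≤ l → h l ≤ ∫ s in Ioi ε, w s := by
    intro l hl
    refine setIntegral_mono_on (integrable_exp_mul_weight hε hw hl) hw measurableSet_Ioi ?_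
    intro s hs
    refine mul_le_of_le_one_left (hw0 s hs) (Real.exp_le_one_iff.2 ?_)
    have : (0 : ℝ) ≤ s := hε.trans (le_of_lt hs)
    nlinarith
  have hs : ∀ l, HasSum (fun j : ℕ => ((j.factorial : ℝ))⁻¹ * h l ^ j) (Real.exp (h l)) := by
    intro l
    have := NormedSpace.expSeries_div_hasSum_exp (𝔸 := ℝ) (h l)
    rw [← Real.exp_eq_exp_ℝ] at this
    simpa [div_eq_inv_mul] using this
  refine GaussPositive.of_tendsto (C := Real.exp (∫ s in Ioi ε, w s))
    (f := fun N l => ∑ j ∈ Finset.range N, ((j.factorial : ℝ))⁻¹ * h l ^ j)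
    (fun N => GaussPositive.sum (fun j => (hpow j).const_mul (by positivity)) N) ?_ ?_ ?_
  · have := (hpow 1).measurable
    simp only [pow_one] at this
    exact Real.measurable_exp.comp this
  · intro N l hl
    have hnn : ∀ j : ℕ, 0 ≤ ((j.factorial : ℝ))⁻¹ * h l ^ j := fun j =>
      mul_nonneg (by positivity) (pow_nonneg (h0 l) j)
    rw [abs_of_nonneg (Finset.sum_nonneg fun j _ => hnn j)]
    exact (sum_le_hasSum _ (fun j _ => hnn j) (hs l)).trans (Real.exp_le_exp.2 (hbd l hl))
  · intro l _
    exact (hs l).tendsto_sum_nat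

/-- The Lévy measure of the one-sided stable law of index `a` integrates `1 - e^{-s}`. -/
lemma integrableOn_one_sub_exp_mul_rpow {a : ℝ} (ha : 0 < a) (ha1 : a < 1) :
    IntegrableOn (fun s : ℝ => (1 - Real.exp (-s)) * s ^ (-1 - a)) (Ioi 0) := by
  have hm : ∀ S : Set ℝ, AEStronglyMeasurable
      (fun s : ℝ => (1 - Real.exp (-s)) * s ^ (-1 - a)) (volume.restrict S) := fun S =>
    Measurable.aestronglyMeasurable (by fun_prop)
  rw [← Ioc_union_Ioi_eq_Ioi (zero_le_one : (0 : ℝ) ≤ 1)]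
  refine IntegrableOn.union ?_ ?_
  · have h := (intervalIntegral.intervalIntegrable_rpow' (a := 0) (b := 1) (r := -a)
      (by linarith)).1
    refine h.mono' (hm _) ((ae_restrict_mem measurableSet_Ioc).mono fun s hs => ?_)
    have hs0 : 0 < s := hs.1
    have e : Real.exp (-s) ≤ 1 := Real.exp_le_one_iff.2 (by linarith)
    have e2 := Real.add_one_le_exp (-s)
    rw [Real.norm_of_nonneg (mul_nonneg (by linarith) (Real.rpow_nonneg hs0.le _))]
    calc (1 - Real.exp (-s)) * s ^ (-1 - a) ≤ s * s ^ (-1 - a) := by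
          gcongr; linarith
      _ = s ^ (-a) := by
          rw [show -a = 1 + (-1 - a) by ring, Real.rpow_add hs0, Real.rpow_one]
  · have h := integrableOn_Ioi_rpow_of_lt (a := -1 - a) (by linarith) one_pos
    refine h.mono' (hm _) ((ae_restrict_mem measurableSet_Ioi).mono fun s hs => ?_)
    have hs0 : (0 : ℝ) < s := one_pos.trans hs
    have e : Real.exp (-s) ≤ 1 := Real.exp_le_one_iff.2 (by linarith)
    rw [Real.norm_of_nonneg (mul_nonneg (by linarith) (Real.rpow_nonneg hs0.le _))]
    refine mul_le_of_le_one_left (Real.rpow_nonneg hs0.le _) ?_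
    linarith [Real.exp_pos (-s)]

lemma integral_one_sub_exp_mul_rpow {a l : ℝ} (hl : 0 < l) :
    ∫ s in Ioi (0 : ℝ), (1 - Real.exp (-l * s)) * s ^ (-1 - a)
      = l ^ a * ∫ s in Ioi (0 : ℝ), (1 - Real.exp (-s)) * s ^ (-1 - a) := by
  have h := integral_comp_mul_left_Ioi (fun s : ℝ => (1 - Real.exp (-s)) * s ^ (-1 - a)) 0 hl
  rw [mul_zero, smul_eq_mul] at h
  have h2 : ∫ s in Ioi (0 : ℝ), (1 - Real.exp (-(l * s))) * (l * s) ^ (-1 - a)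
      = l ^ (-1 - a) * ∫ s in Ioi (0 : ℝ), (1 - Real.exp (-l * s)) * s ^ (-1 - a) := by
    rw [← integral_const_mul]
    refine setIntegral_congr_fun measurableSet_Ioi fun s hs => ?_
    rw [Real.mul_rpow hl.le (le_of_lt hs), neg_mul]; ring
  rw [h2] at h
  have h3 : l ^ a = l⁻¹ * (l ^ (-1 - a))⁻¹ := by
    rw [← Real.rpow_neg_one l, ← Real.rpow_neg hl.le, ← Real.rpow_add hl]; congr 1; ring
  rw [h3, mul_assoc, mul_comm (l ^ (-1 - a))⁻¹, ← mul_assoc, ← h]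
  field_simp

lemma integral_one_sub_exp_mul_rpow_pos {a : ℝ} (ha : 0 < a) (ha1 : a < 1) :
    0 < ∫ s in Ioi (0 : ℝ), (1 - Real.exp (-s)) * s ^ (-1 - a) := by
  have hpos : ∀ s ∈ Ioi (0 : ℝ), 0 < (1 - Real.exp (-s)) * s ^ (-1 - a) := fun s hs =>
    mul_pos (by have := Real.exp_lt_one_iff.2 (neg_lt_zero.2 hs); linarith)
      (Real.rpow_pos_of_pos hs _)
  rw [setIntegral_pos_iff_support_of_nonneg_ae
    ((ae_restrict_mem measurableSet_Ioi).mono fun s hs => (hpos s hs).le)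
    (integrableOn_one_sub_exp_mul_rpow ha ha1)]
  rw [inter_eq_right.2 fun s hs => Function.mem_support.2 (hpos s hs).ne']
  simp

/-- Lévy–Khintchine formula: `l ^ a` is `1 / J` times the integral of `(1 - exp (-l * s)) * s ^ (-1
- a)` over `s > 0`. The weight alone is not integrable at zero, so it is cut off at `ε k`. The
truncated exponent splits into a constant and a Laplace transform, to which
`GaussPositive.exp_laplace` applies, and the cut-off is then removed. -/
lemma GaussPositive.exp_neg_rpow {a : ℝ} (ha : 0 < a) (ha1 : a < 1) {t : ℝ} (ht : 0 ≤ t) :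
    GaussPositive V (fun l => Real.exp (-t * l ^ a)) := by
  set J := ∫ s in Ioi (0 : ℝ), (1 - Real.exp (-s)) * s ^ (-1 - a) with hJ
  have hJ0 : 0 < J := integral_one_sub_exp_mul_rpow_pos ha ha1
  set ε : ℕ → ℝ := fun k => 1 / ((k : ℝ) + 1) with hεd
  have hε : ∀ k, 0 < ε k := fun k => Nat.one_div_pos_of_nat
  set w : ℝ → ℝ := fun s => t / J * s ^ (-1 - a) with hwd
  have hwm : Measurable w := by fun_prop
  have hw : ∀ k, IntegrableOn w (Ioi (ε k)) := fun k =>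
    (integrableOn_Ioi_rpow_of_lt (by linarith) (hε k)).const_mul _
  have hw0 : ∀ k, ∀ s ∈ Ioi (ε k), 0 ≤ w s := fun k s hs =>
    mul_nonneg (by positivity) (Real.rpow_nonneg ((hε k).le.trans (le_of_lt hs)) _)
  have hfull : ∀ l, 0 ≤ l → IntegrableOn (fun s => (1 - Real.exp (-l * s)) * w s) (Ioi 0) := by
    intro l hl
    rcases hl.eq_or_lt with rfl | hl
    · simp
    have h := (integrableOn_one_sub_exp_mul_rpow ha ha1)
    have h2 := ((integrableOn_Ioi_comp_mul_left_iff
      (fun s : ℝ => (1 - Real.exp (-s)) * s ^ (-1 - a)) 0 hl).2 (by simpa using h)).const_mul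
        (t / J * l ^ (1 + a))
    refine IntegrableOn.congr_fun h2 (fun s hs => ?_) measurableSet_Ioi
    simp only [hwd]
    rw [Real.mul_rpow hl.le (le_of_lt hs), neg_mul]
    have : l ^ (1 + a) * l ^ (-1 - a) = 1 := by
      rw [← Real.rpow_add hl]; simp
    linear_combination (t / J * (1 - Real.exp (-(l * s))) * s ^ (-1 - a)) * this
  have hval : ∀ l, 0 ≤ l → ∫ s in Ioi (0 : ℝ), (1 - Real.exp (-l * s)) * w s = t * l ^ a := by
    intro l hl
    rcases hl.eq_or_lt with rfl | hl
    · simp [Real.zero_rpow ha.ne']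
    have : ∀ s, (1 - Real.exp (-l * s)) * w s
        = t / J * ((1 - Real.exp (-l * s)) * s ^ (-1 - a)) := by intro s; simp only [hwd]; ring
    simp_rw [this]
    rw [integral_const_mul, integral_one_sub_exp_mul_rpow hl, ← hJ]
    field_simp
  refine GaussPositive.of_tendsto (C := 1) (f := fun k l => Real.exp (-∫ s in Ioi (ε k), w s) *
    Real.exp (∫ s in Ioi (ε k), Real.exp (-l * s) * w s)) (fun k =>
      (GaussPositive.exp_laplace (hε k).le hwm (hw k) (hw0 k)).const_mul (Real.exp_pos _).le)
      (by fun_prop) ?_ ?_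
  all_goals
    have heq : ∀ k l, 0 ≤ l → Real.exp (-∫ s in Ioi (ε k), w s) *
        Real.exp (∫ s in Ioi (ε k), Real.exp (-l * s) * w s)
        = Real.exp (-∫ s in Ioi (ε k), (1 - Real.exp (-l * s)) * w s) := by
      intro k l hl
      rw [← Real.exp_add]
      congr 1
      simp_rw [sub_mul, one_mul]
      rw [integral_sub (hw k) (integrable_exp_mul_weight (hε k).le (hw k) hl)]
      ring
  · intro k l hl
    rw [heq k l hl, Real.abs_exp]
    refine Real.exp_le_one_iff.2 (neg_nonpos.2 (setIntegral_nonneg measurableSet_Ioi ?_))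
    intro s hs
    refine mul_nonneg (sub_nonneg.2 (Real.exp_le_one_iff.2 ?_)) (hw0 k s hs)
    have : 0 ≤ s := (hε k).le.trans (le_of_lt hs)
    nlinarith
  · intro l hl
    simp_rw [heq _ l hl]
    have hU : ⋃ k, Ioi (ε k) = Ioi (0 : ℝ) := by
      ext s
      simp only [mem_iUnion, mem_Ioi]
      constructor
      · rintro ⟨k, hk⟩; exact (hε k).trans hk
      · intro hs; exact exists_nat_one_div_lt hs
    have hmono : Monotone fun k => Ioi (ε k) := fun i j hij =>
      Ioi_subset_Ioi (Nat.one_div_le_one_div hij)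
    have := tendsto_setIntegral_of_monotone (μ := volume) (fun k => measurableSet_Ioi) hmono
      (f := fun s => (1 - Real.exp (-l * s)) * w s) (by rw [hU]; exact hfull l hl)
    rw [hU, hval l hl] at this
    have h3 := (Real.continuous_exp.tendsto _).comp this.neg
    simpa [Function.comp_def] using h3

/-- For `a = 1` the symbol is Gaussian and `t` is absorbed into `δ`; this case serves `β = 2`. -/
lemma GaussPositive.exp_neg_rpow_of_le_one {a : ℝ} (ha : 0 < a) (ha1 : a ≤ 1) {t : ℝ}
    (ht : 0 ≤ t) : GaussPositive V (fun l => Real.exp (-t * l ^ a)) := by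
  rcases ha1.lt_or_eq with h | rfl
  · exact GaussPositive.exp_neg_rpow ha h ht
  · refine ⟨by fun_prop, ⟨1, fun l hl => ?_⟩, fun δ hδ x => ?_⟩
    · rw [Real.abs_exp, Real.rpow_one]
      exact Real.exp_le_one_iff.2 (by nlinarith)
    · have := (GaussPositive.one (V := V)).nonneg (t + δ) (by linarith) x
      refine this.trans_eq (integral_congr_ae (Eventually.of_forall fun ξ => ?_))
      simp only [Real.rpow_one]
      rw [← Real.exp_add, one_mul]
      congr 2; ring

end GaussianPositivity

/-! ### The fractional heat kernel: sign, scaling, regularity, integrability. -/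

section Kernel

variable {n : ℕ} {β : ℝ}

lemma integrable_norm_pow_mul_exp_neg_rpow [NeZero n] (hβ : 0 < β) {t : ℝ} (ht : 0 < t) (k : ℕ) :
    Integrable (fun ξ : EuclideanSpace ℝ (Fin n) => ‖ξ‖ ^ k * Real.exp (-(t * ‖ξ‖ ^ β))) := by
  rw [integrable_fun_norm_addHaar volume (f := fun r : ℝ => r ^ k * Real.exp (-(t * r ^ β)))]
  have h := integrableOn_rpow_mul_exp_neg_mul_rpow (s := (n - 1 + k : ℕ)) (p := β) (b := t)
    (by have : (0 : ℝ) ≤ ((n - 1 + k : ℕ) : ℝ) := Nat.cast_nonneg _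
        linarith) hβ ht
  refine h.congr_fun (fun r hr => ?_) measurableSet_Ioi
  simp only [finrank_euclideanSpace, Fintype.card_fin, Real.rpow_natCast, smul_eq_mul, pow_add,
    neg_mul]
  ring

lemma integrable_exp_neg_rpow [NeZero n] (hβ : 0 < β) {t : ℝ} (ht : 0 < t) :
    Integrable (fun ξ : EuclideanSpace ℝ (Fin n) => Real.exp (-(t * ‖ξ‖ ^ β))) := by
  simpa using integrable_norm_pow_mul_exp_neg_rpow (n := n) hβ ht 0

lemma fracHeatKernel_exponent_eq (t : ℝ) (x ξ : EuclideanSpace ℝ (Fin n)) :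
    Complex.exp (Complex.I * ((inner ℝ x ξ : ℝ) : ℂ) - ((t * ‖ξ‖ ^ β : ℝ) : ℂ))
      = Complex.exp (((inner ℝ x ξ : ℝ) : ℂ) * Complex.I) *
        ((Real.exp (-(t * ‖ξ‖ ^ β)) : ℝ) : ℂ) := by
  rw [sub_eq_add_neg, Complex.exp_add, mul_comm Complex.I]; push_cast; rfl

lemma integrable_fracHeatKernel_integrand [NeZero n] (hβ : 0 < β) {t : ℝ} (ht : 0 < t)
    (x : EuclideanSpace ℝ (Fin n)) :
    Integrable (fun ξ : EuclideanSpace ℝ (Fin n) =>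
      Complex.exp (Complex.I * ((inner ℝ x ξ : ℝ) : ℂ) - ((t * ‖ξ‖ ^ β : ℝ) : ℂ))) := by
  simp_rw [fracHeatKernel_exponent_eq]
  refine (integrable_exp_neg_rpow hβ ht).mono' ?_ (Eventually.of_forall fun ξ => ?_)
  · exact Measurable.aestronglyMeasurable (by fun_prop)
  · rw [norm_mul, Complex.norm_exp_ofReal_mul_I, one_mul, Complex.norm_real, Real.norm_eq_abs,
      Real.abs_exp]

lemma fracHeatKernel_eq_cos [NeZero n] (hβ : 0 < β) {t : ℝ} (ht : 0 < t)
    (x : EuclideanSpace ℝ (Fin n)) :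
    fracHeatKernel n β t x = ((2 * Real.pi) ^ n)⁻¹ *
      ∫ ξ : EuclideanSpace ℝ (Fin n), Real.cos (inner ℝ x ξ) * Real.exp (-(t * ‖ξ‖ ^ β)) := by
  rw [fracHeatKernel, ← Complex.reCLM_apply,
    ← ContinuousLinearMap.integral_comp_comm _ (integrable_fracHeatKernel_integrand hβ ht x)]
  congr 1
  refine integral_congr_ae (Eventually.of_forall fun ξ => ?_)
  simp only [Complex.reCLM_apply]
  rw [fracHeatKernel_exponent_eq, Complex.re_mul_ofReal, Complex.exp_ofReal_mul_I_re]

lemma integrable_cos_mul_exp_neg_rpow [NeZero n] (hβ : 0 < β) {t : ℝ} (ht : 0 < t)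
    (x : EuclideanSpace ℝ (Fin n)) : Integrable (fun ξ : EuclideanSpace ℝ (Fin n) =>
      Real.cos (inner ℝ x ξ) * Real.exp (-(t * ‖ξ‖ ^ β))) := by
  refine (integrable_exp_neg_rpow hβ ht).mono' (Measurable.aestronglyMeasurable (by fun_prop))
    (Eventually.of_forall fun ξ => ?_)
  rw [norm_mul, Real.norm_eq_abs, Real.norm_eq_abs, Real.abs_exp]
  exact mul_le_of_le_one_left (Real.exp_pos _).le (Real.abs_cos_le_one _)

lemma measurable_fracHeatKernel :
    Measurable (fun z : ℝ × EuclideanSpace ℝ (Fin n) => fracHeatKernel n β z.1 z.2) := by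
  unfold fracHeatKernel
  have : StronglyMeasurable (Function.uncurry fun (z : ℝ × EuclideanSpace ℝ (Fin n))
      (ξ : EuclideanSpace ℝ (Fin n)) => Complex.exp (Complex.I * ((inner ℝ z.2 ξ : ℝ) : ℂ) -
        ((z.1 * ‖ξ‖ ^ β : ℝ) : ℂ))) := by
    apply Measurable.stronglyMeasurable
    unfold Function.uncurry
    fun_prop
  exact (Complex.measurable_re.comp this.integral_prod_right.measurable).const_mul _

lemma measurable_fracHeatKernel_comp {α : Type*} [MeasurableSpace α] {f : α → ℝ}
    {g : α → EuclideanSpace ℝ (Fin n)} (hf : Measurable f) (hg : Measurable g) :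
    Measurable (fun a => fracHeatKernel n β (f a) (g a)) := by
  have h := (measurable_fracHeatKernel (n := n) (β := β)).comp (hf.prodMk hg)
  simpa only [Function.comp_def] using h

lemma fracHeatKernel_neg (t : ℝ) (x : EuclideanSpace ℝ (Fin n)) :
    fracHeatKernel n β t (-x) = fracHeatKernel n β t x := by
  unfold fracHeatKernel
  rw [← integral_neg_eq_self]
  simp

/-- The symbol is the case `a = β / 2` of the positivity class. Its own integrability allows the
auxiliary Gaussian to be removed by dominated convergence along `δ = 1 / (k + 1)`. -/
lemma fracHeatKernel_nonneg [NeZero n] (hβ : 0 < β) (hβ2 : β ≤ 2) {t : ℝ} (ht : 0 < t)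
    (x : EuclideanSpace ℝ (Fin n)) : 0 ≤ fracHeatKernel n β t x := by
  rw [fracHeatKernel_eq_cos hβ ht]
  refine mul_nonneg (by positivity) ?_
  have hpos := GaussPositive.exp_neg_rpow_of_le_one (V := EuclideanSpace ℝ (Fin n))
    (a := β / 2) (by linarith) (by linarith) ht.le
  have hpow : ∀ ξ : EuclideanSpace ℝ (Fin n), (‖ξ‖ ^ 2) ^ (β / 2) = ‖ξ‖ ^ β := by
    intro ξ
    rw [← Real.rpow_natCast, ← Real.rpow_mul (norm_nonneg _)]
    congr 1; push_cast; ring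
  refine ge_of_tendsto (tendsto_integral_of_dominated_convergence
    (F := fun (k : ℕ) ξ => Real.cos (inner ℝ x ξ) * (Real.exp (-(t * ‖ξ‖ ^ β)) *
      Real.exp (-(1 / ((k : ℝ) + 1)) * ‖ξ‖ ^ 2))) (fun ξ => Real.exp (-(t * ‖ξ‖ ^ β)))
    (fun k => Measurable.aestronglyMeasurable (by fun_prop)) (integrable_exp_neg_rpow hβ ht)
    (fun k => Eventually.of_forall fun ξ => ?_) (Eventually.of_forall fun ξ => ?_))
    (Eventually.of_forall fun k => ?_)
  · rw [norm_mul, norm_mul, Real.norm_eq_abs, Real.norm_eq_abs, Real.norm_eq_abs, Real.abs_exp,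
      Real.abs_exp]
    have h1 := Real.abs_cos_le_one (inner ℝ x ξ)
    have h2 : Real.exp (-(1 / ((k : ℝ) + 1)) * ‖ξ‖ ^ 2) ≤ 1 := by
      rw [Real.exp_le_one_iff, neg_mul]
      exact neg_nonpos.2 (by positivity)
    calc _ ≤ 1 * (Real.exp (-(t * ‖ξ‖ ^ β)) * 1) := by gcongr
      _ = _ := by ring
  · have h := tendsto_one_div_add_atTop_nhds_zero_nat (𝕜 := ℝ)
    have h2 := (Real.continuous_exp.tendsto _).comp ((h.neg).mul_const (‖ξ‖ ^ 2))
    simpa [Function.comp_def] using ((h2.const_mul (Real.exp (-(t * ‖ξ‖ ^ β)))).const_mul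
      (Real.cos (inner ℝ x ξ)))
  · refine (hpos.nonneg (1 / ((k : ℝ) + 1)) Nat.one_div_pos_of_nat x).trans_eq ?_
    simp_rw [hpow, neg_mul]

lemma fracHeatKernel_scaling {σ : ℝ} (hσ : 0 < σ)
    (t : ℝ) (x : EuclideanSpace ℝ (Fin n)) :
    fracHeatKernel n β (σ ^ β * t) x = (σ ^ n)⁻¹ * fracHeatKernel n β t (σ⁻¹ • x) := by
  have h := Measure.integral_comp_smul (volume : Measure (EuclideanSpace ℝ (Fin n)))
    (fun ξ : EuclideanSpace ℝ (Fin n) =>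
    Complex.exp (Complex.I * ((inner ℝ (σ⁻¹ • x) ξ : ℝ) : ℂ) - ((t * ‖ξ‖ ^ β : ℝ) : ℂ))) σ
  have e : ∀ ξ : EuclideanSpace ℝ (Fin n),
      Complex.exp (Complex.I * ((inner ℝ (σ⁻¹ • x) (σ • ξ) : ℝ) : ℂ) -
        ((t * ‖σ • ξ‖ ^ β : ℝ) : ℂ))
      = Complex.exp (Complex.I * ((inner ℝ x ξ : ℝ) : ℂ) - ((σ ^ β * t * ‖ξ‖ ^ β : ℝ) : ℂ)) := by
    intro ξ
    rw [inner_smul_left, inner_smul_right, norm_smul, Real.norm_of_nonneg hσ.le,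
      Real.mul_rpow hσ.le (norm_nonneg _)]
    have h1 : (starRingEnd ℝ) σ⁻¹ * (σ * inner ℝ x ξ) = inner ℝ x ξ := by
      simp only [conj_trivial]
      field_simp
    rw [h1]
    congr 3; ring
  simp only [e] at h
  unfold fracHeatKernel
  rw [h, Complex.smul_re, smul_eq_mul, finrank_euclideanSpace, Fintype.card_fin,
    abs_of_pos (by positivity)]
  ring

lemma fracHeatKernel_zero_pos [NeZero n] (hβ : 0 < β) {t : ℝ} (ht : 0 < t) :
    0 < fracHeatKernel n β t 0 := by
  rw [fracHeatKernel_eq_cos hβ ht]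
  refine mul_pos (by positivity) ?_
  simp only [inner_zero_left, Real.cos_zero, one_mul]
  exact integral_exp_pos (integrable_exp_neg_rpow (n := n) hβ ht)

lemma abs_fracHeatKernel_le [NeZero n] (hβ : 0 < β) {t : ℝ} (ht : 0 < t)
    (x : EuclideanSpace ℝ (Fin n)) : |fracHeatKernel n β t x| ≤ fracHeatKernel n β t 0 := by
  rw [fracHeatKernel_eq_cos hβ ht, fracHeatKernel_eq_cos hβ ht, abs_mul,
    abs_of_nonneg (by positivity : (0 : ℝ) ≤ ((2 * Real.pi) ^ n)⁻¹)]
  refine mul_le_mul_of_nonneg_left ?_ (by positivity)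
  rw [← Real.norm_eq_abs]
  refine norm_integral_le_of_norm_le (integrable_cos_mul_exp_neg_rpow (n := n) hβ ht 0)
    (Eventually.of_forall fun ξ => ?_)
  rw [norm_mul, Real.norm_eq_abs, Real.norm_eq_abs, Real.abs_exp, inner_zero_left, Real.cos_zero]
  exact mul_le_mul_of_nonneg_right (Real.abs_cos_le_one _) (Real.exp_pos _).le

/-- Varying `x` under the cosine costs one factor `‖ξ‖`, which remains integrable against the
symbol. -/
lemma exists_lipschitz_fracHeatKernel [NeZero n] (hβ : 0 < β) {t : ℝ} (ht : 0 < t) :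
    ∃ L : ℝ, 0 < L ∧ ∀ x y : EuclideanSpace ℝ (Fin n),
      |fracHeatKernel n β t x - fracHeatKernel n β t y| ≤ L * ‖x - y‖ := by
  set A := ((2 * Real.pi) ^ n)⁻¹ *
    ∫ ξ : EuclideanSpace ℝ (Fin n), ‖ξ‖ ^ 1 * Real.exp (-(t * ‖ξ‖ ^ β)) with hA
  have hA0 : 0 ≤ A := mul_nonneg (by positivity) (integral_nonneg fun ξ => by positivity)
  -- Only `0 ≤ A` has been established; adding one makes the constant strictly positive.
  refine ⟨A + 1, by linarith, fun x y => ?_⟩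
  suffices h : |fracHeatKernel n β t x - fracHeatKernel n β t y| ≤ A * ‖x - y‖ by
    nlinarith [norm_nonneg (x - y)]
  rw [fracHeatKernel_eq_cos hβ ht, fracHeatKernel_eq_cos hβ ht, ← mul_sub,
    ← integral_sub (integrable_cos_mul_exp_neg_rpow hβ ht x)
      (integrable_cos_mul_exp_neg_rpow hβ ht y), abs_mul,
    abs_of_nonneg (by positivity : (0 : ℝ) ≤ ((2 * Real.pi) ^ n)⁻¹), hA, mul_assoc]
  refine mul_le_mul_of_nonneg_left ?_ (by positivity)
  rw [← integral_mul_const (μ := (volume : Measure (EuclideanSpace ℝ (Fin n))))]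
  rw [← Real.norm_eq_abs]
  refine norm_integral_le_of_norm_le
    ((integrable_norm_pow_mul_exp_neg_rpow (n := n) hβ ht 1).mul_const _)
    (Eventually.of_forall fun ξ => ?_)
  rw [← sub_mul, norm_mul, Real.norm_eq_abs, Real.norm_eq_abs, Real.abs_exp]
  have h1 : |Real.cos (inner ℝ x ξ) - Real.cos (inner ℝ y ξ)| ≤ ‖x - y‖ * ‖ξ‖ := by
    refine (Real.abs_cos_sub_cos_le _ _).trans ?_
    rw [← inner_sub_left]
    exact abs_real_inner_le_norm _ _
  calc _ ≤ (‖x - y‖ * ‖ξ‖) * Real.exp (-(t * ‖ξ‖ ^ β)) := by gcongr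
    _ = _ := by ring

lemma continuous_fracHeatKernel [NeZero n] (hβ : 0 < β) {t : ℝ} (ht : 0 < t) :
    Continuous (fracHeatKernel n β t) := by
  obtain ⟨L, hL, h⟩ := exists_lipschitz_fracHeatKernel (n := n) hβ ht
  refine (LipschitzWith.of_dist_le_mul (K := ⟨L, hL.le⟩) fun x y => ?_).continuous
  rw [dist_eq_norm, dist_eq_norm]
  exact h x y

/-- By Fubini, the mass of the kernel weighted by `exp (-δ * ‖x‖ ^ 2)` is `(2π)^(-n)` times the
integral of the symbol against the transform `G` of the weight. The symbol is at most one and `G`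
has integral `(2π)^n`, so the weighted mass is at most one. Since the kernel is nonnegative, Fatou's
lemma lets `δ` tend to zero. -/
lemma integrable_fracHeatKernel [NeZero n] (hβ : 0 < β) (hβ2 : β ≤ 2) {t : ℝ} (ht : 0 < t) :
    Integrable (fracHeatKernel n β t) := by
  have hc := continuous_fracHeatKernel (n := n) hβ ht
  have hK0 := fracHeatKernel_nonneg (n := n) hβ hβ2 ht
  -- the Gaussian averages of the kernel are bounded by `K(0)`-independent constants
  have hgauss : ∀ k : ℕ, ∫⁻ x : EuclideanSpace ℝ (Fin n),
      ENNReal.ofReal (fracHeatKernel n β t x * Real.exp (-(1 / ((k : ℝ) + 1)) * ‖x‖ ^ 2)) ≤ 1 := by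
    intro k
    set δ : ℝ := 1 / ((k : ℝ) + 1)
    have hδ : 0 < δ := Nat.one_div_pos_of_nat
    have hgi := integrable_exp_neg_mul_sq_norm (V := EuclideanSpace ℝ (Fin n)) hδ
    have hint : Integrable (fun x : EuclideanSpace ℝ (Fin n) =>
        fracHeatKernel n β t x * Real.exp (-δ * ‖x‖ ^ 2)) := by
      refine (hgi.const_mul (fracHeatKernel n β t 0)).mono' (by fun_prop)
        (Eventually.of_forall fun x => ?_)
      rw [norm_mul, Real.norm_eq_abs, Real.norm_eq_abs, Real.abs_exp]
      exact mul_le_mul_of_nonneg_right (abs_fracHeatKernel_le hβ ht x) (Real.exp_pos _).le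
    rw [← ofReal_integral_eq_lintegral_ofReal hint
      (Eventually.of_forall fun x => mul_nonneg (hK0 x) (Real.exp_pos _).le)]
    rw [← ENNReal.ofReal_one]
    refine ENNReal.ofReal_le_ofReal ?_
    have hb : 0 < ((δ : ℂ)).re := by simpa using hδ
    set G : EuclideanSpace ℝ (Fin n) → ℝ := fun ξ =>
      (Real.pi / δ) ^ ((n : ℝ) / 2) * Real.exp (-(1 / (4 * δ)) * ‖ξ‖ ^ 2) with hG
    have hcosint : ∀ ξ : EuclideanSpace ℝ (Fin n),
        ∫ x : EuclideanSpace ℝ (Fin n), Real.cos (inner ℝ x ξ) * Real.exp (-δ * ‖x‖ ^ 2)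
          = G ξ := by
      intro ξ
      have h := GaussianFourier.integral_cexp_neg_mul_sq_norm_add
        (V := EuclideanSpace ℝ (Fin n)) (b := (δ : ℂ)) hb Complex.I ξ
      have hi := GaussianFourier.integrable_cexp_neg_mul_sq_norm_add
        (V := EuclideanSpace ℝ (Fin n)) (b := (δ : ℂ)) hb Complex.I ξ
      have h2 : ∫ x : EuclideanSpace ℝ (Fin n), Real.cos (inner ℝ x ξ) * Real.exp (-δ * ‖x‖ ^ 2)
          = (∫ v : EuclideanSpace ℝ (Fin n), Complex.exp (-(δ : ℂ) * (‖v‖ : ℂ) ^ 2 +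
              Complex.I * (inner ℝ ξ v : ℝ))).re := by
        rw [← Complex.reCLM_apply, ← ContinuousLinearMap.integral_comp_comm _ hi]
        refine integral_congr_ae (Eventually.of_forall fun v => ?_)
        simp only [Complex.reCLM_apply]
        have : (-(δ : ℂ) * (‖v‖ : ℂ) ^ 2 + Complex.I * (inner ℝ ξ v : ℝ))
            = ((-δ * ‖v‖ ^ 2 : ℝ) : ℂ) + (inner ℝ ξ v : ℝ) * Complex.I := by push_cast; ring
        rw [this, Complex.exp_re, Complex.add_re, Complex.add_im, Complex.ofReal_re,
          Complex.ofReal_im, Complex.re_ofReal_mul, Complex.im_ofReal_mul, Complex.I_re,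
          Complex.I_im]
        simp only [mul_zero, add_zero, mul_one, zero_add]
        rw [real_inner_comm]
        ring
      rw [h2, h]
      have e1 : ((Real.pi : ℂ) / δ) ^ ((Module.finrank ℝ (EuclideanSpace ℝ (Fin n)) : ℂ) / 2)
          = (((Real.pi / δ) ^ ((n : ℝ) / 2) : ℝ) : ℂ) := by
        rw [Complex.ofReal_cpow (by positivity)]; simp
      have e2 : Complex.exp (Complex.I ^ 2 * (‖ξ‖ : ℂ) ^ 2 / (4 * δ))
          = ((Real.exp (-(1 / (4 * δ)) * ‖ξ‖ ^ 2) : ℝ) : ℂ) := by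
        rw [Complex.I_sq]; push_cast; congr 1; ring
      rw [e1, e2, ← Complex.ofReal_mul, Complex.ofReal_re]
    have hswap : ∫ x : EuclideanSpace ℝ (Fin n), fracHeatKernel n β t x * Real.exp (-δ * ‖x‖ ^ 2)
        = ((2 * Real.pi) ^ n)⁻¹ * ∫ ξ : EuclideanSpace ℝ (Fin n),
          G ξ * Real.exp (-(t * ‖ξ‖ ^ β)) := by
      simp_rw [fracHeatKernel_eq_cos hβ ht, mul_assoc]
      rw [integral_const_mul]
      congr 1
      simp_rw [← integral_mul_const, ← hcosint, ← integral_mul_const]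
      rw [integral_integral_swap]
      · refine integral_congr_ae (Eventually.of_forall fun x => ?_)
        simp only
        refine integral_congr_ae (Eventually.of_forall fun ξ => ?_)
        simp only
        ring
      · refine (hgi.mul_prod (integrable_exp_neg_rpow (n := n) hβ ht)).mono' ?_
          (Eventually.of_forall fun z => ?_)
        · unfold Function.uncurry
          exact Measurable.aestronglyMeasurable (by fun_prop)
        · simp only [Function.uncurry]
          rw [norm_mul, norm_mul, Real.norm_eq_abs, Real.norm_eq_abs, Real.norm_eq_abs,
            Real.abs_exp, Real.abs_exp]
          have h1 := Real.abs_cos_le_one (inner ℝ z.1 z.2)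
          calc _ ≤ (1 * Real.exp (-(t * ‖z.2‖ ^ β))) * Real.exp (-δ * ‖z.1‖ ^ 2) := by gcongr
            _ = _ := by ring
    have h4 : (0 : ℝ) < 1 / (4 * δ) := by positivity
    have hGi : Integrable G := (integrable_exp_neg_mul_sq_norm h4).const_mul _
    have hle : ∫ ξ : EuclideanSpace ℝ (Fin n), G ξ * Real.exp (-(t * ‖ξ‖ ^ β)) ≤ ∫ ξ, G ξ := by
      have hG0 : ∀ ξ, 0 ≤ G ξ := fun ξ => by positivity
      refine integral_mono_of_nonneg (Eventually.of_forall fun ξ =>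
        mul_nonneg (hG0 ξ) (Real.exp_pos _).le) hGi (Eventually.of_forall fun ξ => ?_)
      refine mul_le_of_le_one_right (hG0 ξ) (Real.exp_le_one_iff.2 ?_)
      have : 0 ≤ t * ‖ξ‖ ^ β := by positivity
      linarith
    have hGval : ∫ ξ, G ξ = (2 * Real.pi) ^ n := by
      simp only [hG]
      rw [integral_const_mul, GaussianFourier.integral_rexp_neg_mul_sq_norm h4,
        finrank_euclideanSpace, Fintype.card_fin,
        ← Real.mul_rpow (by positivity) (by positivity)]
      have : Real.pi / δ * (Real.pi / (1 / (4 * δ))) = (2 * Real.pi) ^ (2 : ℝ) := by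
        rw [Real.rpow_two]; field_simp; ring
      rw [this, ← Real.rpow_mul (by positivity), ← Real.rpow_natCast]
      congr 1; ring
    rw [hswap]
    calc _ ≤ ((2 * Real.pi) ^ n)⁻¹ * ∫ ξ, G ξ := by gcongr
      _ = 1 := by rw [hGval]; field_simp
  refine ⟨hc.aestronglyMeasurable, ?_⟩
  rw [hasFiniteIntegral_iff_ofReal (Eventually.of_forall hK0)]
  have hfat : ∫⁻ x : EuclideanSpace ℝ (Fin n), ENNReal.ofReal (fracHeatKernel n β t x) ≤
      liminf (fun k : ℕ => ∫⁻ x : EuclideanSpace ℝ (Fin n), ENNReal.ofReal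
        (fracHeatKernel n β t x * Real.exp (-(1 / ((k : ℝ) + 1)) * ‖x‖ ^ 2))) atTop := by
    refine le_trans (lintegral_mono fun x => ?_) (lintegral_liminf_le (fun k => by fun_prop))
    have h := tendsto_one_div_add_atTop_nhds_zero_nat (𝕜 := ℝ)
    have h2 := (Real.continuous_exp.tendsto _).comp ((h.neg).mul_const (‖x‖ ^ 2))
    have h3 := (ENNReal.continuous_ofReal.tendsto _).comp (h2.const_mul (fracHeatKernel n β t x))
    simp only [neg_zero, zero_mul, Real.exp_zero, mul_one] at h3
    exact (h3.liminf_eq).ge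
  refine (hfat.trans ?_).trans_lt ENNReal.one_lt_top
  exact liminf_le_of_le (by isBoundedDefault) fun b hb => by
    obtain ⟨k, hk⟩ := hb.exists
    exact hk.trans (hgauss k)

end Kernel

/-! ### Mass one and the semigroup law, by Fourier inversion. -/

section HeatSemigroup

open scoped FourierTransform Convolution

variable {n : ℕ} {β : ℝ}

/-- The symbol of the fractional heat semigroup, in the normalisation of Mathlib's Fourier
transform. -/
noncomputable def heatSymbol (n : ℕ) (β t : ℝ) (w : EuclideanSpace ℝ (Fin n)) : ℂ :=
  ((Real.exp (-(t * (2 * Real.pi * ‖w‖) ^ β)) : ℝ) : ℂ)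

/-- The dilation by `2π` reconciles the two normalisations. The kernel is defined through a real
part, so the imaginary part has to be shown to vanish; it does because the symbol is real and even.
-/
lemma fourierInv_heatSymbol (t : ℝ)
    (x : EuclideanSpace ℝ (Fin n)) :
    𝓕⁻ (heatSymbol n β t) x = ((fracHeatKernel n β t x : ℝ) : ℂ) := by
  have hpi : (0 : ℝ) < 2 * Real.pi := by positivity
  have h := Measure.integral_comp_smul (volume : Measure (EuclideanSpace ℝ (Fin n)))
    (fun ξ : EuclideanSpace ℝ (Fin n) =>
      Complex.exp (((inner ℝ x ξ : ℝ) : ℂ) * Complex.I) *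
        ((Real.exp (-(t * ‖ξ‖ ^ β)) : ℝ) : ℂ)) (2 * Real.pi)
  have e : 𝓕⁻ (heatSymbol n β t) x = ((2 * Real.pi) ^ n)⁻¹ •
      ∫ ξ : EuclideanSpace ℝ (Fin n), Complex.exp (((inner ℝ x ξ : ℝ) : ℂ) * Complex.I) *
        ((Real.exp (-(t * ‖ξ‖ ^ β)) : ℝ) : ℂ) := by
    rw [finrank_euclideanSpace, Fintype.card_fin, abs_of_pos (by positivity)] at h
    rw [← h, Real.fourierInv_eq']
    refine integral_congr_ae (Eventually.of_forall fun v => ?_)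
    simp only [heatSymbol, smul_eq_mul, inner_smul_right, norm_smul, Real.norm_of_nonneg hpi.le,
      real_inner_comm]
  have hreal : (𝓕⁻ (heatSymbol n β t) x).im = 0 := by
    rw [← Complex.conj_eq_iff_im, Real.fourierInv_eq', ← integral_conj, ← integral_neg_eq_self]
    refine integral_congr_ae (Eventually.of_forall fun v => ?_)
    simp only [heatSymbol, smul_eq_mul, map_mul, Complex.conj_ofReal, ← Complex.exp_conj,
      Complex.conj_I, inner_neg_left, norm_neg]
    congr 2
    push_cast
    ring
  refine Complex.ext ?_ (by rw [hreal, Complex.ofReal_im])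
  rw [Complex.ofReal_re, e, fracHeatKernel, Complex.smul_re, smul_eq_mul]
  congr 3
  funext ξ
  rw [fracHeatKernel_exponent_eq]

lemma continuous_heatSymbol (hβ : 0 < β) (t : ℝ) : Continuous (heatSymbol n β t) := by
  unfold heatSymbol
  have : Continuous fun w : EuclideanSpace ℝ (Fin n) => (2 * Real.pi * ‖w‖) ^ β :=
    (continuous_const.mul continuous_norm).rpow_const fun _ => Or.inr hβ.le
  fun_prop

lemma integrable_heatSymbol [NeZero n] (hβ : 0 < β) {t : ℝ} (ht : 0 < t) :
    Integrable (heatSymbol n β t) := by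
  have h := integrable_exp_neg_rpow (n := n) hβ
    (t := t * (2 * Real.pi) ^ β) (mul_pos ht (by positivity))
  refine (h.ofReal (𝕜 := ℂ)).congr (Eventually.of_forall fun w => ?_)
  simp only [heatSymbol]
  rw [Real.mul_rpow (by positivity) (norm_nonneg _), ← mul_assoc]
  rfl

lemma integrable_ofReal_fracHeatKernel [NeZero n] (hβ : 0 < β) (hβ2 : β ≤ 2) {t : ℝ}
    (ht : 0 < t) :
    Integrable (fun x : EuclideanSpace ℝ (Fin n) => ((fracHeatKernel n β t x : ℝ) : ℂ)) :=
  (integrable_fracHeatKernel hβ hβ2 ht).ofReal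

/-- The symbol is even, so its direct and inverse transforms coincide; both being the kernel, which
is integrable, the inversion theorem applies. -/
lemma fourier_fracHeatKernel [NeZero n] (hβ : 0 < β) (hβ2 : β ≤ 2) {t : ℝ} (ht : 0 < t) :
    𝓕 (fun x : EuclideanSpace ℝ (Fin n) => ((fracHeatKernel n β t x : ℝ) : ℂ))
      = heatSymbol n β t := by
  have h1 : 𝓕⁻ (heatSymbol n β t) =
      fun x : EuclideanSpace ℝ (Fin n) => ((fracHeatKernel n β t x : ℝ) : ℂ) :=
    funext fun x => fourierInv_heatSymbol t x
  have h2 : 𝓕 (heatSymbol n β t) =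
      fun x : EuclideanSpace ℝ (Fin n) => ((fracHeatKernel n β t x : ℝ) : ℂ) := by
    funext x
    rw [← fracHeatKernel_neg, ← fourierInv_heatSymbol, Real.fourierInv_eq_fourier_neg,
      neg_neg]
  have h := Continuous.fourier_fourierInv_eq (continuous_heatSymbol (n := n) hβ t)
    (integrable_heatSymbol hβ ht) (by
      rw [h2]; exact integrable_ofReal_fracHeatKernel hβ hβ2 ht)
  rwa [h1] at h

/-- The mass is the value of the symbol at frequency zero. -/
lemma integral_fracHeatKernel [NeZero n] (hβ : 0 < β) (hβ2 : β ≤ 2) {t : ℝ} (ht : 0 < t) :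
    ∫ x, fracHeatKernel n β t x = 1 := by
  have h := congrFun (fourier_fracHeatKernel (n := n) hβ hβ2 ht) 0
  rw [Real.fourier_eq'] at h
  simp only [inner_zero_right, mul_zero, Complex.ofReal_zero, zero_mul, Complex.exp_zero,
    one_smul, heatSymbol, norm_zero, Real.zero_rpow hβ.ne', neg_zero, Real.exp_zero] at h
  rw [integral_complex_ofReal] at h
  exact_mod_cast h

/-- Symbols at times `t` and `s` multiply to the symbol at time `t + s`. The convolution is
continuous and integrable, so Fourier inversion gives the identity at every point and not just
almost everywhere. -/
lemma integral_fracHeatKernel_mul_fracHeatKernel [NeZero n] (hβ : 0 < β) (hβ2 : β ≤ 2)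
    {t s : ℝ} (ht : 0 < t) (hs : 0 < s) (x : EuclideanSpace ℝ (Fin n)) :
    ∫ y, fracHeatKernel n β t y * fracHeatKernel n β s (x - y) = fracHeatKernel n β (t + s) x := by
  set f : ℝ → EuclideanSpace ℝ (Fin n) → ℂ := fun t x => ((fracHeatKernel n β t x : ℝ) : ℂ)
    with hf
  have hint : ∀ {t : ℝ}, 0 < t → Integrable (f t) := fun ht =>
    integrable_ofReal_fracHeatKernel hβ hβ2 ht
  have hcont : ∀ {t : ℝ}, 0 < t → Continuous (f t) := fun ht =>
    Complex.continuous_ofReal.comp (continuous_fracHeatKernel hβ ht)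
  set g := convolution (f t) (f s) (ContinuousLinearMap.mul ℂ ℂ) volume with hg
  have hgF : 𝓕 g = heatSymbol n β (t + s) := by
    funext ξ
    rw [hg, Real.fourier_mul_convolution_eq (hint ht) (hint hs), hf]
    simp only
    rw [fourier_fracHeatKernel hβ hβ2 ht, fourier_fracHeatKernel hβ hβ2 hs]
    simp only [heatSymbol]
    rw [← Complex.ofReal_mul, ← Real.exp_add]
    congr 2; ring
  have hgc : Continuous g := by
    refine BddAbove.continuous_convolution_right_of_integrable _ ?_ (hint ht) (hcont hs)
    refine ⟨fracHeatKernel n β s 0, ?_⟩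
    rintro _ ⟨y, rfl⟩
    simp only [hf, Complex.norm_real]
    exact abs_fracHeatKernel_le hβ hs y
  have hgi : Integrable g := (hint ht).integrable_convolution _ (hint hs)
  have h := Continuous.fourierInv_fourier_eq hgc hgi (by
    rw [hgF]; exact integrable_heatSymbol hβ (add_pos ht hs))
  rw [hgF] at h
  have h2 := congrFun h x
  rw [fourierInv_heatSymbol] at h2
  have h3 : g x = ((∫ y, fracHeatKernel n β t y * fracHeatKernel n β s (x - y) : ℝ) : ℂ) := by
    rw [hg, convolution_def, ← integral_complex_ofReal]
    refine integral_congr_ae (Eventually.of_forall fun y => ?_)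
    simp [hf]
  rw [h3] at h2
  exact_mod_cast h2.symm

lemma lintegral_fracHeatKernel [NeZero n] (hβ : 0 < β) (hβ2 : β ≤ 2) {t : ℝ} (ht : 0 < t) :
    ∫⁻ x, ENNReal.ofReal (fracHeatKernel n β t x) = 1 := by
  rw [← ofReal_integral_eq_lintegral_ofReal (integrable_fracHeatKernel hβ hβ2 ht)
    (Eventually.of_forall (fracHeatKernel_nonneg hβ hβ2 ht)), integral_fracHeatKernel hβ hβ2 ht,
    ENNReal.ofReal_one]

lemma lintegral_fracHeatKernel_sub_left [NeZero n] (hβ : 0 < β) (hβ2 : β ≤ 2) {t : ℝ}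
    (ht : 0 < t) (x : EuclideanSpace ℝ (Fin n)) :
    ∫⁻ y, ENNReal.ofReal (fracHeatKernel n β t (x - y)) = 1 := by
  rw [lintegral_sub_left_eq_self (fun y => ENNReal.ofReal (fracHeatKernel n β t y)) x,
    lintegral_fracHeatKernel hβ hβ2 ht]

lemma lintegral_fracHeatKernel_sub_right [NeZero n] (hβ : 0 < β) (hβ2 : β ≤ 2) {t : ℝ}
    (ht : 0 < t) (y : EuclideanSpace ℝ (Fin n)) :
    ∫⁻ x, ENNReal.ofReal (fracHeatKernel n β t (x - y)) = 1 := by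
  rw [lintegral_sub_right_eq_self (fun y => ENNReal.ofReal (fracHeatKernel n β t y)) y,
    lintegral_fracHeatKernel hβ hβ2 ht]

/-- The fractional heat semigroup acting on nonnegative functions. -/
noncomputable def heatOp (n : ℕ) (β t : ℝ) (f : EuclideanSpace ℝ (Fin n) → ℝ≥0∞)
    (x : EuclideanSpace ℝ (Fin n)) : ℝ≥0∞ :=
  ∫⁻ y, ENNReal.ofReal (fracHeatKernel n β t (x - y)) * f y

lemma measurable_heatKer_sub_right (t : ℝ) (x : EuclideanSpace ℝ (Fin n)) :
    Measurable (fun y : EuclideanSpace ℝ (Fin n) =>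
      ENNReal.ofReal (fracHeatKernel n β t (x - y))) :=
  ENNReal.measurable_ofReal.comp (measurable_fracHeatKernel_comp (by fun_prop) (by fun_prop))

lemma measurable_heatKer_sub_prod (t : ℝ) :
    Measurable (fun z : EuclideanSpace ℝ (Fin n) × EuclideanSpace ℝ (Fin n) =>
      ENNReal.ofReal (fracHeatKernel n β t (z.1 - z.2))) :=
  ENNReal.measurable_ofReal.comp (measurable_fracHeatKernel_comp (by fun_prop) (by fun_prop))

lemma measurable_heatKer_sub_left (t : ℝ) (y : EuclideanSpace ℝ (Fin n)) :
    Measurable (fun x : EuclideanSpace ℝ (Fin n) =>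
      ENNReal.ofReal (fracHeatKernel n β t (x - y))) :=
  ENNReal.measurable_ofReal.comp (measurable_fracHeatKernel_comp (by fun_prop) (by fun_prop))

lemma heatOp_congr {t : ℝ} {f g : EuclideanSpace ℝ (Fin n) → ℝ≥0∞} (h : f =ᵐ[volume] g)
    (x : EuclideanSpace ℝ (Fin n)) : heatOp n β t f x = heatOp n β t g x :=
  lintegral_congr_ae (h.mono fun y hy => by simp only [hy])

lemma heatOp_mono {t : ℝ} {f g : EuclideanSpace ℝ (Fin n) → ℝ≥0∞} (h : f ≤ᵐ[volume] g)
    (x : EuclideanSpace ℝ (Fin n)) : heatOp n β t f x ≤ heatOp n β t g x :=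
  lintegral_mono_ae (h.mono fun y hy => by gcongr)

lemma measurable_heatOp (t : ℝ) {f : EuclideanSpace ℝ (Fin n) → ℝ≥0∞} (hf : Measurable f) :
    Measurable (heatOp n β t f) :=
  ((measurable_heatKer_sub_prod t).mul (hf.comp measurable_snd)).lintegral_prod_right'

lemma measurable_heatOp_param {α : Type*} [MeasurableSpace α]
    {t : α → ℝ} (ht : Measurable t) {f : α → EuclideanSpace ℝ (Fin n) → ℝ≥0∞}
    (hf : Measurable (Function.uncurry f)) {x : α → EuclideanSpace ℝ (Fin n)} (hx : Measurable x) :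
    Measurable (fun a => heatOp n β (t a) (f a) (x a)) := by
  unfold heatOp
  refine Measurable.lintegral_prod_right (f := fun a y =>
    ENNReal.ofReal (fracHeatKernel n β (t a) (x a - y)) * f a y) ?_
  refine Measurable.mul (ENNReal.measurable_ofReal.comp
    (measurable_fracHeatKernel_comp (ht.comp measurable_fst)
      ((hx.comp measurable_fst).sub measurable_snd))) hf

lemma heatOp_add {t : ℝ} {f g : EuclideanSpace ℝ (Fin n) → ℝ≥0∞}
    (hf : Measurable f) (x : EuclideanSpace ℝ (Fin n)) :
    heatOp n β t (fun y => f y + g y) x = heatOp n β t f x + heatOp n β t g x := by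
  unfold heatOp
  simp_rw [mul_add]
  exact lintegral_add_left ((measurable_heatKer_sub_right t x).mul hf) _

lemma heatOp_const [NeZero n] (hβ : 0 < β) (hβ2 : β ≤ 2) {t : ℝ} (ht : 0 < t) (c : ℝ≥0∞)
    (x : EuclideanSpace ℝ (Fin n)) : heatOp n β t (fun _ => c) x = c := by
  unfold heatOp
  rw [lintegral_mul_const _ (measurable_heatKer_sub_right t x),
    lintegral_fracHeatKernel_sub_left hβ hβ2 ht, one_mul]

lemma lintegral_heatOp [NeZero n] (hβ : 0 < β) (hβ2 : β ≤ 2) {t : ℝ} (ht : 0 < t)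
    {f : EuclideanSpace ℝ (Fin n) → ℝ≥0∞} (hf : AEMeasurable f) :
    ∫⁻ x, heatOp n β t f x = ∫⁻ x, f x := by
  unfold heatOp
  rw [lintegral_lintegral_swap]
  · refine lintegral_congr fun y => ?_
    rw [lintegral_mul_const _ (measurable_heatKer_sub_left t y),
      lintegral_fracHeatKernel_sub_right hβ hβ2 ht, one_mul]
  · exact (measurable_heatKer_sub_prod t).aemeasurable.mul hf.comp_snd

lemma lintegral_heatKer_mul_heatKer [NeZero n] (hβ : 0 < β) (hβ2 : β ≤ 2) {t s : ℝ}
    (ht : 0 < t) (hs : 0 < s) (x z : EuclideanSpace ℝ (Fin n)) :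
    ∫⁻ y, ENNReal.ofReal (fracHeatKernel n β t (x - y)) *
      ENNReal.ofReal (fracHeatKernel n β s (y - z))
      = ENNReal.ofReal (fracHeatKernel n β (t + s) (x - z)) := by
  have h1 := lintegral_sub_left_eq_self (μ := (volume : Measure (EuclideanSpace ℝ (Fin n))))
    (fun y => ENNReal.ofReal (fracHeatKernel n β t y) *
      ENNReal.ofReal (fracHeatKernel n β s ((x - z) - y))) x
  simp only [show ∀ y, x - z - (x - y) = y - z by intro y; abel] at h1
  rw [h1]
  have hK := fun {t : ℝ} (ht : 0 < t) => fracHeatKernel_nonneg (n := n) hβ hβ2 ht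
  simp_rw [← ENNReal.ofReal_mul (hK ht _)]
  rw [← ofReal_integral_eq_lintegral_ofReal,
    integral_fracHeatKernel_mul_fracHeatKernel hβ hβ2 ht hs]
  · refine (integrable_fracHeatKernel hβ hβ2 ht).mul_bdd (c := fracHeatKernel n β s 0) ?_ ?_
    · exact ((continuous_fracHeatKernel hβ hs).comp (by fun_prop)).aestronglyMeasurable
    · exact Eventually.of_forall fun y => abs_fracHeatKernel_le hβ hs _
  · exact Eventually.of_forall fun y => mul_nonneg (hK ht _) (hK hs _)

lemma heatOp_heatOp [NeZero n] (hβ : 0 < β) (hβ2 : β ≤ 2) {t s : ℝ} (ht : 0 < t) (hs : 0 < s)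
    {f : EuclideanSpace ℝ (Fin n) → ℝ≥0∞} (hf : AEMeasurable f)
    (x : EuclideanSpace ℝ (Fin n)) :
    heatOp n β t (heatOp n β s f) x = heatOp n β (t + s) f x := by
  unfold heatOp
  simp_rw [← lintegral_const_mul' _ _ ENNReal.ofReal_ne_top]
  rw [lintegral_lintegral_swap]
  · refine lintegral_congr fun z => ?_
    simp_rw [← mul_assoc]
    rw [lintegral_mul_const, lintegral_heatKer_mul_heatKer hβ hβ2 ht hs]
    exact (measurable_heatKer_sub_right t x).mul (measurable_heatKer_sub_left s z)
  · exact ((measurable_heatKer_sub_right t x).comp measurable_fst).aemeasurable.mul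
      ((measurable_heatKer_sub_prod s).aemeasurable.mul hf.comp_snd)

end HeatSemigroup

/-! ### Lower bounds and the bound on the lifespan. -/

section Blowup

variable {n : ℕ} {α β p q : ℝ}

/-- By scaling it suffices to look at time one, where the kernel is positive at the origin and
Lipschitz: within distance `k / (2 * L)` of the origin it stays above half of its value `k` there.
-/
lemma exists_fracHeatKernel_lower_bound [NeZero n] (hβ : 0 < β) :
    ∃ η κ : ℝ, 0 < η ∧ 0 < κ ∧ ∀ σ : ℝ, 0 < σ → ∀ x : EuclideanSpace ℝ (Fin n), ‖x‖ ≤ η * σ →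
      κ * (σ ^ n)⁻¹ ≤ fracHeatKernel n β (σ ^ β) x := by
  obtain ⟨L, hL, hLip⟩ := exists_lipschitz_fracHeatKernel (n := n) hβ one_pos
  have hk := fracHeatKernel_zero_pos (n := n) hβ one_pos
  set k := fracHeatKernel n β 1 0
  refine ⟨k / (2 * L), k / 2, by positivity, by positivity, fun σ hσ x hx => ?_⟩
  have h1 := fracHeatKernel_scaling (n := n) (β := β) hσ 1 x
  rw [mul_one] at h1
  rw [h1, mul_comm]
  refine mul_le_mul_of_nonneg_left ?_ (by positivity)
  have h2 := (abs_le.1 (hLip (σ⁻¹ • x) 0)).1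
  rw [sub_zero, norm_smul, norm_inv, Real.norm_of_nonneg hσ.le] at h2
  have h3 : L * (σ⁻¹ * ‖x‖) ≤ k / 2 := by
    calc L * (σ⁻¹ * ‖x‖) ≤ L * (σ⁻¹ * (k / (2 * L) * σ)) := by gcongr
      _ = k / 2 := by field_simp
  change -(L * (σ⁻¹ * ‖x‖)) ≤ fracHeatKernel n β 1 (σ⁻¹ • x) - k at h2
  linarith

lemma volume_ball_euclidean [NeZero n] (x : EuclideanSpace ℝ (Fin n)) {r : ℝ} (hr : 0 ≤ r) :
    volume (Metric.ball x r) = ENNReal.ofReal (r ^ n) *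
      volume (Metric.ball (0 : EuclideanSpace ℝ (Fin n)) 1) := by
  rw [Measure.addHaar_ball _ _ hr]; simp

/-- The point `x` may lie near the boundary of the large ball, so the test ball, of radius `η * σ /
2`, is centred at `x` pulled towards the origin by the factor `1 - σ / (2 * ρ)`. It then lies inside
the large ball and all its points are within `η * σ` of `x`. Its volume, of order `σ ^ n`, cancels
the factor `(σ ^ n)⁻¹`, so `c` depends on neither `ρ` nor `σ`. -/
lemma exists_heat_mass_ball_lower_bound [NeZero n] {η κ : ℝ} (hη : 0 < η)
    (hκ : 0 < κ) (hK : ∀ σ : ℝ, 0 < σ → ∀ x : EuclideanSpace ℝ (Fin n), ‖x‖ ≤ η * σ →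
      κ * (σ ^ n)⁻¹ ≤ fracHeatKernel n β (σ ^ β) x) :
    ∃ c : ℝ, 0 < c ∧ ∀ ρ σ : ℝ, 0 < σ → σ ≤ ρ →
      ∀ x ∈ Metric.ball (0 : EuclideanSpace ℝ (Fin n)) (η * ρ),
      ENNReal.ofReal c ≤ ∫⁻ y in Metric.ball (0 : EuclideanSpace ℝ (Fin n)) (η * ρ),
        ENNReal.ofReal (fracHeatKernel n β (σ ^ β) (x - y)) := by
  set ω := (volume (Metric.ball (0 : EuclideanSpace ℝ (Fin n)) 1)).toReal with hω
  have hωt : volume (Metric.ball (0 : EuclideanSpace ℝ (Fin n)) 1) = ENNReal.ofReal ω :=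
    (ENNReal.ofReal_toReal measure_ball_lt_top.ne).symm
  have hω0 : 0 < ω := ENNReal.toReal_pos (Metric.measure_ball_pos _ _ one_pos).ne'
    measure_ball_lt_top.ne
  refine ⟨κ * (η / 2) ^ n * ω, by positivity, fun ρ σ hσ hσρ x hx => ?_⟩
  have hρ : 0 < ρ := hσ.trans_le hσρ
  rw [mem_ball_zero_iff] at hx
  set A := Metric.ball ((1 - σ / (2 * ρ)) • x) (η * σ / 2) with hA
  have hfrac : 0 ≤ 1 - σ / (2 * ρ) := by
    rw [sub_nonneg, div_le_one (by positivity)]; linarith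
  have hAsub : A ⊆ Metric.ball 0 (η * ρ) := by
    intro y hy
    rw [hA, mem_ball_iff_norm] at hy
    rw [mem_ball_zero_iff]
    calc ‖y‖ = ‖(y - (1 - σ / (2 * ρ)) • x) + (1 - σ / (2 * ρ)) • x‖ := by rw [sub_add_cancel]
      _ ≤ ‖y - (1 - σ / (2 * ρ)) • x‖ + ‖(1 - σ / (2 * ρ)) • x‖ := norm_add_le _ _
      _ < η * σ / 2 + (1 - σ / (2 * ρ)) * (η * ρ) := by
        rw [norm_smul, Real.norm_of_nonneg hfrac]
        have := mul_le_mul_of_nonneg_left hx.le hfrac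
        linarith
      _ = η * ρ := by field_simp; ring
  have hAK : ∀ y ∈ A, κ * (σ ^ n)⁻¹ ≤ fracHeatKernel n β (σ ^ β) (x - y) := by
    intro y hy
    refine hK σ hσ _ ?_
    rw [hA, mem_ball_iff_norm, norm_sub_rev] at hy
    have e : x - y = ((1 - σ / (2 * ρ)) • x - y) + (σ / (2 * ρ)) • x := by
      rw [sub_smul, one_smul]; abel
    rw [e]
    refine (norm_add_le _ _).trans ?_
    rw [norm_smul, Real.norm_of_nonneg (by positivity : 0 ≤ σ / (2 * ρ))]
    have h2 : σ / (2 * ρ) * ‖x‖ ≤ σ / (2 * ρ) * (η * ρ) := by gcongr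
    have h3 : σ / (2 * ρ) * (η * ρ) = η * σ / 2 := by field_simp
    linarith
  calc ENNReal.ofReal (κ * (η / 2) ^ n * ω)
      = ENNReal.ofReal (κ * (σ ^ n)⁻¹) * volume A := by
        rw [hA, volume_ball_euclidean _ (by positivity), hωt,
          ← ENNReal.ofReal_mul (by positivity), ← ENNReal.ofReal_mul (by positivity)]
        congr 1
        rw [show η * σ / 2 = (η / 2) * σ by ring, mul_pow]
        field_simp
    _ = ∫⁻ y in A, ENNReal.ofReal (κ * (σ ^ n)⁻¹) := by rw [setLIntegral_const]
    _ ≤ ∫⁻ y in A, ENNReal.ofReal (fracHeatKernel n β (σ ^ β) (x - y)) :=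
        setLIntegral_mono' Metric.isOpen_ball.measurableSet fun y hy =>
          ENNReal.ofReal_le_ofReal (hAK y hy)
    _ ≤ _ := lintegral_mono_set hAsub

lemma rieszConst_pos [NeZero n] (hα : 0 < α) (hαn : α < n) : 0 < rieszConst n α := by
  unfold rieszConst
  have h1 := Real.Gamma_pos_of_pos (show 0 < ((n : ℝ) - α) / 2 by linarith)
  have h2 := Real.Gamma_pos_of_pos (show 0 < α / 2 by linarith)
  positivity

/-- Two points of the ball are at distance at most `2 * R`, so the Riesz kernel is at least of order
`R ^ (-(n - α))` there; integrating over a volume of order `R ^ n` leaves `R ^ α`. -/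
lemma exists_hartree_lower_bound [NeZero n] (hα : 0 < α) (hαn : α < n) (hp : 0 < p) (hq : 0 < q) :
    ∃ c : ℝ, 0 < c ∧ ∀ (R M : ℝ) (v : EuclideanSpace ℝ (Fin n) → ℝ), 0 < R → 0 < M →
      (∀ᵐ y, y ∈ Metric.ball (0 : EuclideanSpace ℝ (Fin n)) R → M ≤ v y) →
      ∀ᵐ x, x ∈ Metric.ball (0 : EuclideanSpace ℝ (Fin n)) R →
        ENNReal.ofReal (c * R ^ α * M ^ (p + q)) ≤ hartree n α p q v x := by
  set ω := (volume (Metric.ball (0 : EuclideanSpace ℝ (Fin n)) 1)).toReal with hω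
  have hωt : volume (Metric.ball (0 : EuclideanSpace ℝ (Fin n)) 1) = ENNReal.ofReal ω :=
    (ENNReal.ofReal_toReal measure_ball_lt_top.ne).symm
  have hω0 : 0 < ω := ENNReal.toReal_pos (Metric.measure_ball_pos _ _ one_pos).ne'
    measure_ball_lt_top.ne
  have hA := rieszConst_pos hα hαn
  refine ⟨rieszConst n α * 2 ^ (-((n : ℝ) - α)) * ω, by positivity, fun R M v hR hM hv => ?_⟩
  set B := Metric.ball (0 : EuclideanSpace ℝ (Fin n)) R with hB
  filter_upwards [hv] with x hx hxB
  have hvx := hx hxB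
  have hriesz : ENNReal.ofReal (rieszConst n α * (2 * R) ^ (-((n : ℝ) - α)) * M ^ p * (R ^ n * ω))
      ≤ rieszPotential n α (fun y => ENNReal.ofReal (|v y| ^ p)) x := by
    unfold rieszPotential
    calc _ = ∫⁻ y in B, ENNReal.ofReal (rieszConst n α * (2 * R) ^ (-((n : ℝ) - α)) * M ^ p) := by
          rw [setLIntegral_const, hB, volume_ball_euclidean _ hR.le, hωt,
            ← ENNReal.ofReal_mul (by positivity), ← ENNReal.ofReal_mul (by positivity)]
      _ ≤ ∫⁻ y in B, ENNReal.ofReal (rieszConst n α * ‖x - y‖ ^ (-((n : ℝ) - α))) *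
            ENNReal.ofReal (|v y| ^ p) := by
          refine lintegral_mono_ae ?_
          -- At `y = x` the negative power is `0` by convention and the lower bound would fail; a
          -- single point is negligible.
          have hne : ∀ᵐ y, y ≠ x := by simp [ae_iff]
          filter_upwards [ae_restrict_mem Metric.isOpen_ball.measurableSet,
            ae_restrict_of_ae hv, ae_restrict_of_ae hne] with y hyB hy hyx
          have hvy := hy hyB
          rw [← ENNReal.ofReal_mul (mul_nonneg hA.le (Real.rpow_nonneg (norm_nonneg _) _))]
          refine ENNReal.ofReal_le_ofReal ?_
          have h0 : 0 < ‖x - y‖ := norm_pos_iff.2 (sub_ne_zero.2 (Ne.symm hyx))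
          have h1 : ‖x - y‖ ≤ 2 * R := by
            rw [mem_ball_zero_iff] at hyB
            rw [hB, mem_ball_zero_iff] at hxB
            linarith [norm_sub_le x y]
          have h2 : (2 * R) ^ (-((n : ℝ) - α)) ≤ ‖x - y‖ ^ (-((n : ℝ) - α)) :=
            Real.rpow_le_rpow_of_nonpos h0 h1 (by linarith)
          have h3 : M ≤ |v y| := hvy.trans (le_abs_self _)
          gcongr
      _ ≤ _ := setLIntegral_le_lintegral _ _
  unfold hartree
  have h3 : M ≤ |v x| := hvx.trans (le_abs_self _)
  calc ENNReal.ofReal (rieszConst n α * 2 ^ (-((n : ℝ) - α)) * ω * R ^ α * M ^ (p + q))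
      = ENNReal.ofReal (rieszConst n α * (2 * R) ^ (-((n : ℝ) - α)) * M ^ p * (R ^ n * ω)) *
        ENNReal.ofReal (M ^ q) := by
        rw [← ENNReal.ofReal_mul (by positivity)]
        congr 1
        rw [Real.mul_rpow zero_le_two hR.le, Real.rpow_add hM]
        have : R ^ α = R ^ (-((n : ℝ) - α)) * R ^ n := by
          rw [← Real.rpow_natCast R n, ← Real.rpow_add hR]; congr 1; ring
        rw [this]; ring
    _ ≤ _ := mul_le_mul' hriesz (ENNReal.ofReal_le_ofReal (by gcongr))

/-- The time lag `t - τ` is at most `ρ ^ β`, so its spatial scale `σ` is at most `ρ` and the heat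
flow retains a fixed fraction of what the source puts on the ball. -/
lemma exists_duhamel_lower_bound [NeZero n] (hα : 0 < α) (hαn : α < n) (hβ : 0 < β) (hp : 0 < p)
    (hq : 0 < q) {η κ : ℝ} (hη : 0 < η) (hκ : 0 < κ)
    (hK : ∀ σ : ℝ, 0 < σ → ∀ x : EuclideanSpace ℝ (Fin n), ‖x‖ ≤ η * σ →
      κ * (σ ^ n)⁻¹ ≤ fracHeatKernel n β (σ ^ β) x) :
    ∃ c : ℝ, 0 < c ∧ ∀ (ρ M a t : ℝ) (u : ℝ → EuclideanSpace ℝ (Fin n) → ℝ), 0 < ρ → 0 < M →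
      0 ≤ a → a ≤ t → t ≤ ρ ^ β →
      (∀ τ ∈ Ioo a t, ∀ᵐ y, y ∈ Metric.ball (0 : EuclideanSpace ℝ (Fin n)) (η * ρ) → M ≤ u τ y) →
      ∀ x ∈ Metric.ball (0 : EuclideanSpace ℝ (Fin n)) (η * ρ),
        ENNReal.ofReal (c * (t - a) * ρ ^ α * M ^ (p + q)) ≤ duhamel n α β p q u t x := by
  obtain ⟨c₀, hc₀, hmass⟩ := exists_heat_mass_ball_lower_bound hη hκ hK
  obtain ⟨c₁, hc₁, hhar⟩ := exists_hartree_lower_bound (n := n) hα hαn hp hq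
  refine ⟨c₀ * c₁ * η ^ α, by positivity, fun ρ M a t u hρ hM ha hat htρ hu x hx => ?_⟩
  set F := c₁ * (η * ρ) ^ α * M ^ (p + q) with hF
  have hF0 : 0 < F := by positivity
  set B := Metric.ball (0 : EuclideanSpace ℝ (Fin n)) (η * ρ) with hB
  calc ENNReal.ofReal (c₀ * c₁ * η ^ α * (t - a) * ρ ^ α * M ^ (p + q))
      = ∫⁻ τ in Ioo a t, ENNReal.ofReal (c₀ * F) := by
        rw [setLIntegral_const, Real.volume_Ioo, ← ENNReal.ofReal_mul (by positivity), hF,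
          Real.mul_rpow hη.le hρ.le]
        congr 1; ring
    _ ≤ ∫⁻ τ in Ioo a t, ∫⁻ y, ENNReal.ofReal (fracHeatKernel n β (t - τ) (x - y)) *
          hartree n α p q (u τ) y := by
        refine setLIntegral_mono' measurableSet_Ioo fun τ hτ => ?_
        set σ := (t - τ) ^ (1 / β) with hσ
        have htτ : 0 < t - τ := sub_pos.2 hτ.2
        have hσ0 : 0 < σ := Real.rpow_pos_of_pos htτ _
        have hσβ : σ ^ β = t - τ := by
          rw [hσ, ← Real.rpow_mul htτ.le, one_div_mul_cancel hβ.ne', Real.rpow_one]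
        have hσρ : σ ≤ ρ := by
          rw [← Real.rpow_le_rpow_iff hσ0.le hρ.le hβ, hσβ]
          linarith [ha.trans_lt hτ.1]
        have h1 := hmass ρ σ hσ0 hσρ x hx
        rw [hσβ] at h1
        calc ENNReal.ofReal (c₀ * F) = ENNReal.ofReal c₀ * ENNReal.ofReal F :=
              ENNReal.ofReal_mul hc₀.le
          _ ≤ (∫⁻ y in B, ENNReal.ofReal (fracHeatKernel n β (t - τ) (x - y))) *
              ENNReal.ofReal F := by gcongr
          _ = ∫⁻ y in B, ENNReal.ofReal (fracHeatKernel n β (t - τ) (x - y)) *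
              ENNReal.ofReal F :=
            (lintegral_mul_const _ (measurable_heatKer_sub_right _ _)).symm
          _ ≤ ∫⁻ y in B, ENNReal.ofReal (fracHeatKernel n β (t - τ) (x - y)) *
              hartree n α p q (u τ) y := by
            refine lintegral_mono_ae ?_
            filter_upwards [ae_restrict_mem Metric.isOpen_ball.measurableSet,
              ae_restrict_of_ae (hhar (η * ρ) M (u τ) (by positivity) hM (hu τ hτ))] with y hyB hy
            gcongr
            exact hy hyB
          _ ≤ _ := setLIntegral_le_lintegral _ _
    _ ≤ _ := lintegral_mono_set (Ioo_subset_Ioo_left ha)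

/-- If the linear evolution of the datum is at least of order `ρ^{-g}` on parabolic cylinders of
size `ρ`, with `g (p + q - 1) < α + β`, the lifespan of every mild solution is bounded. -/
theorem exists_lifespan_bound_of_linear_lower_bound [NeZero n] (hα : 0 < α) (hαn : α < n)
    (hβ : 0 < β) (hp : 0 < p) (hq : 0 < q) (hpq : 1 < p + q) {η κ : ℝ} (hη : 0 < η) (hκ : 0 < κ)
    (hK : ∀ σ : ℝ, 0 < σ → ∀ x : EuclideanSpace ℝ (Fin n), ‖x‖ ≤ η * σ →
      κ * (σ ^ n)⁻¹ ≤ fracHeatKernel n β (σ ^ β) x)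
    {u0 : EuclideanSpace ℝ (Fin n) → ℝ} {g m ρ₀ : ℝ} (hm : 0 < m)
    (hg : g * (p + q - 1) < α + β)
    (hlin : ∀ ρ : ℝ, 0 < ρ → ρ₀ ≤ ρ → ∀ t ∈ Icc (ρ ^ β / 2) (ρ ^ β),
      ∀ x ∈ Metric.ball (0 : EuclideanSpace ℝ (Fin n)) (η * ρ),
      Integrable (fun y => fracHeatKernel n β t (x - y) * u0 y) →
        m * ρ ^ (-g) ≤ ∫ y, fracHeatKernel n β t (x - y) * u0 y) :
    ∃ Tstar : ℝ, ∀ (T : EReal) (u : ℝ → EuclideanSpace ℝ (Fin n) → ℝ),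
      IsMildSolution n α β p q u0 T u → T ≤ (Tstar : EReal) := by
  obtain ⟨c, hc, hduh⟩ := exists_duhamel_lower_bound (n := n) hα hαn hβ hp hq hη hκ hK
  -- Chosen so that `A ^ (p + q - 1) = 2`: the gain of the nonlinearity at each step compensates the
  -- halving of the time gaps.
  set A : ℝ := 2 ^ (1 / (p + q - 1)) with hA
  have hr : 0 < p + q - 1 := by linarith
  have hA1 : 1 < A := Real.one_lt_rpow one_lt_two (by positivity)
  have hA0 : 0 < A := one_pos.trans hA1
  have hAr : A ^ (p + q - 1) = 2 := by
    rw [hA, ← Real.rpow_mul zero_le_two, one_div_mul_cancel hr.ne', Real.rpow_one]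
  -- The only place where the subcritical inequality on `g` enters: it makes the exponent of `ρ`
  -- positive, so that `c * S * ρ ^ α * M₀ ^ (p + q - 1)` can be made at least `4 * A`.
  obtain ⟨ρ, hρ0, hρρ₀, hρ⟩ : ∃ ρ : ℝ, 0 < ρ ∧ ρ₀ ≤ ρ ∧
      4 * A / (c * m ^ (p + q - 1)) ≤ ρ ^ (α + β - g * (p + q - 1)) := by
    have h := tendsto_rpow_atTop (show 0 < α + β - g * (p + q - 1) by linarith)
    obtain ⟨ρ, h1, h2, h3⟩ := ((eventually_gt_atTop (0 : ℝ)).and ((eventually_ge_atTop ρ₀).and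
      (h.eventually_ge_atTop (4 * A / (c * m ^ (p + q - 1)))))).exists
    exact ⟨ρ, h1, h2, h3⟩
  set M₀ := m * ρ ^ (-g) with hM₀
  have hM₀0 : 0 < M₀ := by positivity
  set S := ρ ^ β with hS
  have hS0 : 0 < S := by positivity
  have hkey : 4 * A ≤ c * S * ρ ^ α * M₀ ^ (p + q - 1) := by
    rw [div_le_iff₀ (by positivity)] at hρ
    refine hρ.trans_eq ?_
    rw [hM₀, Real.mul_rpow hm.le (by positivity), ← Real.rpow_mul hρ0.le, hS,
      show α + β - g * (p + q - 1) = α + (β + -g * (p + q - 1)) by ring,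
      Real.rpow_add hρ0, Real.rpow_add hρ0]
    ring
  refine ⟨S, fun T u hu => le_of_not_gt fun hT => ?_⟩
  have hlt : ∀ t : ℝ, t ≤ S → (t : EReal) < T := fun t ht =>
    (EReal.coe_le_coe_iff.2 ht).trans_lt hT
  set B := Metric.ball (0 : EuclideanSpace ℝ (Fin n)) (η * ρ) with hB
  have hlin' : ∀ t ∈ Icc (S / 2) S, ∀ᵐ x, x ∈ B →
      M₀ + (duhamel n α β p q u t x).toReal ≤ u t x := by
    intro t ht
    have ht0 : 0 < t := (half_pos hS0).trans_le ht.1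
    filter_upwards [hu.linear_integrable t ht0 (hlt t ht.2), hu.equation t ht0 (hlt t ht.2)]
      with x hx1 hx2 hxB
    rw [hx2]
    have := hlin ρ hρ0 hρρ₀ t ht x hxB hx1
    linarith
  -- The starting times increase from `S / 2`, where the linear bound begins to hold, towards `S`.
  -- Consecutive ones differ by `S / 4 * (1 / 2) ^ k`.
  have hiter : ∀ k : ℕ, ∀ t ∈ Icc (S * (1 - (1 / 2) ^ (k + 1))) S, ∀ᵐ x, x ∈ B →
      M₀ * A ^ k ≤ u t x := by
    intro k
    induction k with
    | zero =>
      intro t ht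
      filter_upwards [hlin' t ⟨by have := ht.1; norm_num at this; linarith, ht.2⟩] with x hx hxB
      rw [pow_zero, mul_one]
      have := hx hxB
      have h0 : 0 ≤ (duhamel n α β p q u t x).toReal := ENNReal.toReal_nonneg
      linarith
    | succ k ih =>
      intro t ht
      have hpow : (0 : ℝ) < (1 / 2) ^ k := by positivity
      have hpow1 : ((1 : ℝ) / 2) ^ k ≤ 1 := pow_le_one₀ (by norm_num) (by norm_num)
      set a := S * (1 - (1 / 2) ^ (k + 1)) with ha
      have hta : S * (1 / 4) * (1 / 2) ^ k ≤ t - a := by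
        have := ht.1
        rw [ha]
        rw [pow_succ, pow_succ] at this
        rw [pow_succ]
        nlinarith
      have ha0 : 0 ≤ a := by
        rw [ha, pow_succ]
        apply mul_nonneg hS0.le
        linarith
      have hat : a ≤ t := by
        have : 0 ≤ S * (1 / 4) * (1 / 2) ^ k := by positivity
        linarith
      have haS : S / 2 ≤ a := by
        rw [ha, pow_succ]; nlinarith
      have ht0 : 0 < t := by linarith
      filter_upwards [hlin' t ⟨haS.trans hat, ht.2⟩,
        hu.duhamel_finite t ht0 (hlt t ht.2)] with x hx hxfin hxB
      have h1 := hx hxB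
      have h2 := hduh ρ (M₀ * A ^ k) a t u hρ0 (by positivity) ha0 hat ht.2
        (fun τ hτ => ih τ ⟨hτ.1.le, hτ.2.le.trans ht.2⟩) x hxB
      have h3 := (ENNReal.ofReal_le_iff_le_toReal hxfin.ne).1 h2
      -- The factor `2 ^ k` from `(M₀ * A ^ k) ^ (p + q - 1)` cancels the `(1 / 2) ^ k` of the time
      -- gap; `hkey` provides the remaining factor `A`.
      have h4 : M₀ * A ^ (k + 1) ≤ c * (t - a) * ρ ^ α * (M₀ * A ^ k) ^ (p + q) := by
        have e1 : (M₀ * A ^ k) ^ (p + q) = M₀ ^ (p + q - 1) * 2 ^ k * (M₀ * A ^ k) := by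
          rw [show p + q = (p + q - 1) + 1 by ring, Real.rpow_add (by positivity), Real.rpow_one,
            Real.mul_rpow hM₀0.le (by positivity), add_sub_cancel_right, ← Real.rpow_natCast A k,
            ← Real.rpow_mul hA0.le, mul_comm (k : ℝ), Real.rpow_mul hA0.le, hAr,
            Real.rpow_natCast]
        have e2 : ((1 : ℝ) / 2) ^ k * 2 ^ k = 1 := by rw [← mul_pow]; norm_num
        calc M₀ * A ^ (k + 1) = 4 * A * (1 / 4) * (M₀ * A ^ k) := by rw [pow_succ]; ring
          _ ≤ (c * S * ρ ^ α * M₀ ^ (p + q - 1)) * (1 / 4) * (M₀ * A ^ k) := by gcongr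
          _ = c * (S * (1 / 4) * ((1 / 2) ^ k)) * ρ ^ α *
              (M₀ ^ (p + q - 1) * 2 ^ k * (M₀ * A ^ k)) := by
            linear_combination (-(c * S * ρ ^ α * M₀ ^ (p + q - 1) * (1 / 4) * (M₀ * A ^ k))) * e2
          _ ≤ c * (t - a) * ρ ^ α * (M₀ ^ (p + q - 1) * 2 ^ k * (M₀ * A ^ k)) := by gcongr
          _ = _ := by rw [e1]
      linarith
  -- Time `S` belongs to all the intervals, so the real number `u S x` exceeds an unbounded sequence
  -- for almost every `x` in a ball of positive measure.
  have hall : ∀ᵐ x, x ∈ B → ∀ k : ℕ, M₀ * A ^ k ≤ u S x := by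
    have : ∀ᵐ x, ∀ k : ℕ, x ∈ B → M₀ * A ^ k ≤ u S x := by
      rw [ae_all_iff]
      intro k
      refine hiter k S ⟨?_, le_rfl⟩
      have : (0 : ℝ) ≤ (1 / 2) ^ (k + 1) := by positivity
      nlinarith
    filter_upwards [this] with x hx hxB k using hx k hxB
  have hBpos : volume B ≠ 0 := (Metric.measure_ball_pos _ _ (by positivity)).ne'
  obtain ⟨x, hxB, hx⟩ := (((frequently_ae_mem_iff (s := B)).2 hBpos).and_eventually hall).exists
  obtain ⟨k, hk⟩ := pow_unbounded_of_one_lt (u S x / M₀) hA1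
  have := hx hxB k
  rw [div_lt_iff₀ hM₀0] at hk
  linarith

/-- On the upper half of the time interval the parabolic scale `t ^ (1 / β)` is comparable to `ρ`.
-/
lemma exists_sigma_of_mem_Icc (hβ : 0 < β) {ρ t : ℝ} (hρ : 0 < ρ)
    (ht : t ∈ Icc (ρ ^ β / 2) (ρ ^ β)) :
    ∃ σ, 0 < σ ∧ σ ^ β = t ∧ σ ≤ ρ ∧ (1 / 2) ^ (1 / β) * ρ ≤ σ := by
  have hS : 0 < ρ ^ β := Real.rpow_pos_of_pos hρ _
  have ht0 : 0 < t := (half_pos hS).trans_le ht.1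
  have hσ0 : 0 < t ^ (1 / β) := Real.rpow_pos_of_pos ht0 _
  have hσβ : (t ^ (1 / β)) ^ β = t := by
    rw [← Real.rpow_mul ht0.le, one_div_mul_cancel hβ.ne', Real.rpow_one]
  refine ⟨t ^ (1 / β), hσ0, hσβ, ?_, ?_⟩
  · rw [← Real.rpow_le_rpow_iff hσ0.le hρ.le hβ, hσβ]; exact ht.2
  · rw [← Real.rpow_le_rpow_iff (by positivity) hσ0.le hβ, hσβ, Real.mul_rpow (by positivity)
      hρ.le, ← Real.rpow_mul (by positivity), one_div_mul_cancel hβ.ne', Real.rpow_one]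
    linarith [ht.1]

/-- Replacing the kernel at `x - y` by its value at `x` gives a main term at least `κ * σ ^ (-n) * ∫
u0`. The error is at most `σ ^ (-n)` times an integral that tends to zero as `σ → ∞`, since the
unit-time kernel is bounded and Lipschitz. Half of the main term therefore survives at large scales,
whatever the sign changes of `u0`, and `g = n`. -/
theorem exists_lifespan_bound_of_integral_pos [NeZero n] (hα : 0 < α) (hαn : α < n)
    (hβ : 0 < β) (hp : 0 < p) (hq : 0 < q) (hpq : 1 < p + q)
    {u0 : EuclideanSpace ℝ (Fin n) → ℝ} (hu0 : Integrable u0) (hpos : 0 < ∫ x, u0 x)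
    (hcrit : p + q < 1 + (α + β) / n) :
    ∃ Tstar : ℝ, ∀ (T : EReal) (u : ℝ → EuclideanSpace ℝ (Fin n) → ℝ),
      IsMildSolution n α β p q u0 T u → T ≤ (Tstar : EReal) := by
  have hn : (0 : ℝ) < n := hα.trans hαn
  obtain ⟨η, κ, hη, hκ, hK⟩ := exists_fracHeatKernel_lower_bound (n := n) hβ
  obtain ⟨L, hL, hLip⟩ := exists_lipschitz_fracHeatKernel (n := n) hβ one_pos
  set h2 : ℝ := (1 / 2) ^ (1 / β) with hh2
  have hh20 : 0 < h2 := by positivity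
  have hh21 : h2 ≤ 1 := Real.rpow_le_one (by norm_num) (by norm_num) (by positivity)
  set k := fracHeatKernel n β 1 0 with hk
  have hk0 : 0 < k := fracHeatKernel_zero_pos hβ one_pos
  -- oscillation of the rescaled kernel against the datum
  have herr : Tendsto (fun σ : ℝ => ∫ y, min (2 * k) (L * (‖y‖ / σ)) * |u0 y|) atTop (𝓝 0) := by
    have h := tendsto_integral_filter_of_dominated_convergence (μ := volume) (l := atTop)
      (F := fun (σ : ℝ) (y : EuclideanSpace ℝ (Fin n)) => min (2 * k) (L * (‖y‖ / σ)) * |u0 y|)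
      (f := fun _ => 0) (fun y => 2 * k * |u0 y|)
      (Eventually.of_forall fun σ => (Measurable.aestronglyMeasurable (by fun_prop)).mul
        hu0.abs.aestronglyMeasurable) ?_ (hu0.abs.const_mul _) ?_
    · simpa using h
    · filter_upwards [eventually_gt_atTop (0 : ℝ)] with σ hσ
      refine Eventually.of_forall fun y => ?_
      rw [Real.norm_of_nonneg (by positivity)]
      gcongr
      exact min_le_left _ _
    · refine Eventually.of_forall fun y => ?_
      have h1 : Tendsto (fun σ : ℝ => L * (‖y‖ / σ)) atTop (𝓝 0) := by
        simpa using (tendsto_const_nhds.div_atTop tendsto_id).const_mul L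
      have h3 := (tendsto_const_nhds (x := 2 * k)).min h1
      rw [min_eq_right (by positivity)] at h3
      simpa using h3.mul_const |u0 y|
  obtain ⟨σ₀, hσ₀⟩ := eventually_atTop.1 (herr.eventually
    (gt_mem_nhds (show 0 < κ * (∫ x, u0 x) / 2 by positivity)))
  refine exists_lifespan_bound_of_linear_lower_bound (u0 := u0) hα hαn hβ hp hq hpq
    -- The scale `σ` may be as small as `h2 * ρ`; shrinking `η` by `h2` keeps `x` within `η * σ`.
    (η := η * h2) (κ := κ)
    (by positivity) hκ (fun σ hσ x hx => hK σ hσ x (hx.trans ?_)) (g := n)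
    (m := κ * (∫ x, u0 x) / 2) (ρ₀ := σ₀ / h2) (by positivity) ?_ ?_
  · calc η * h2 * σ ≤ η * 1 * σ := by gcongr
      _ = η * σ := by ring
  · rw [← sub_lt_iff_lt_add', lt_div_iff₀ hn] at hcrit
    linarith
  · intro ρ hρ hρ₀ t ht x hx hint
    obtain ⟨σ, hσ, rfl, hσρ, hρσ⟩ := exists_sigma_of_mem_Icc hβ hρ ht
    have hσσ₀ : σ₀ ≤ σ := by
      rw [div_le_iff₀ hh20] at hρ₀
      linarith
    rw [mem_ball_zero_iff] at hx
    have hxσ : ‖x‖ ≤ η * σ := by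
      calc ‖x‖ ≤ η * (h2 * ρ) := by linarith
        _ ≤ η * σ := by gcongr
    have hsc : ∀ y, fracHeatKernel n β (σ ^ β) y = (σ ^ n)⁻¹ * fracHeatKernel n β 1 (σ⁻¹ • y) := by
      intro y
      simpa using fracHeatKernel_scaling (n := n) (β := β) hσ 1 y
    have hpt : ∀ y, fracHeatKernel n β (σ ^ β) x * u0 y -
        (σ ^ n)⁻¹ * (min (2 * k) (L * (‖y‖ / σ)) * |u0 y|)
        ≤ fracHeatKernel n β (σ ^ β) (x - y) * u0 y := by
      intro y
      rw [hsc, hsc]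
      have d1 : |fracHeatKernel n β 1 (σ⁻¹ • x) - fracHeatKernel n β 1 (σ⁻¹ • (x - y))|
          ≤ min (2 * k) (L * (‖y‖ / σ)) := by
        refine le_min ?_ ?_
        · refine (abs_sub _ _).trans ?_
          have a1 := abs_fracHeatKernel_le (n := n) hβ one_pos (σ⁻¹ • x)
          have a2 := abs_fracHeatKernel_le (n := n) hβ one_pos (σ⁻¹ • (x - y))
          linarith
        · refine (hLip _ _).trans_eq ?_
          rw [← smul_sub, sub_sub_cancel, norm_smul, norm_inv, Real.norm_of_nonneg hσ.le]
          ring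
      have d2 : (fracHeatKernel n β 1 (σ⁻¹ • x) - fracHeatKernel n β 1 (σ⁻¹ • (x - y))) * u0 y
          ≤ min (2 * k) (L * (‖y‖ / σ)) * |u0 y| := by
        refine (le_abs_self _).trans ?_
        rw [abs_mul]
        gcongr
      have d3 := mul_le_mul_of_nonneg_left d2 (show 0 ≤ (σ ^ n)⁻¹ by positivity)
      linarith
    have hi2 : Integrable (fun y => min (2 * k) (L * (‖y‖ / σ)) * |u0 y|) := by
      refine (hu0.abs.const_mul (2 * k)).mono' ((Measurable.aestronglyMeasurable
        (by fun_prop)).mul hu0.abs.aestronglyMeasurable) (Eventually.of_forall fun y => ?_)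
      rw [Real.norm_of_nonneg (by positivity)]
      gcongr
      exact min_le_left _ _
    have hmono := integral_mono ((hu0.const_mul (fracHeatKernel n β (σ ^ β) x)).sub
      (hi2.const_mul (σ ^ n)⁻¹)) hint hpt
    simp only [Pi.sub_apply] at hmono
    rw [integral_sub (hu0.const_mul _) (hi2.const_mul _), integral_const_mul,
      integral_const_mul] at hmono
    have hKx := hK σ hσ x hxσ
    have he := hσ₀ σ hσσ₀
    have hσn : (ρ ^ n)⁻¹ ≤ (σ ^ n)⁻¹ := by gcongr
    rw [Real.rpow_neg hρ.le, Real.rpow_natCast]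
    calc κ * (∫ x, u0 x) / 2 * (ρ ^ n)⁻¹ ≤ κ * (∫ x, u0 x) / 2 * (σ ^ n)⁻¹ := by gcongr
      _ = κ * (σ ^ n)⁻¹ * (∫ x, u0 x) - (σ ^ n)⁻¹ * (κ * (∫ x, u0 x) / 2) := by ring
      _ ≤ fracHeatKernel n β (σ ^ β) x * (∫ x, u0 x) -
          (σ ^ n)⁻¹ * ∫ y, min (2 * k) (L * (‖y‖ / σ)) * |u0 y| := by gcongr
      _ ≤ _ := hmono

/-- On a ball of radius of order `ρ ≥ 1` the datum is at least of order `ρ ^ (-γ)`, the kernel at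
least of order `ρ ^ (-n)`, and the volume is of order `ρ ^ n`. Outside the ball the integrand is
nonnegative and is discarded, so `g = γ`. -/
theorem exists_lifespan_bound_of_slow_decay [NeZero n] (hα : 0 < α) (hαn : α < n)
    (hβ : 0 < β) (hβ2 : β ≤ 2) (hp : 0 < p) (hq : 0 < q) (hpq : 1 < p + q)
    {u0 : EuclideanSpace ℝ (Fin n) → ℝ} {ε γ : ℝ} (hε : 0 < ε) (hγ : 0 < γ)
    (hdecay : ∀ᵐ x, ε * (1 + ‖x‖ ^ 2) ^ (-γ / 2) ≤ u0 x)
    (hcrit : p + q < 1 + (α + β) / γ) :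
    ∃ Tstar : ℝ, ∀ (T : EReal) (u : ℝ → EuclideanSpace ℝ (Fin n) → ℝ),
      IsMildSolution n α β p q u0 T u → T ≤ (Tstar : EReal) := by
  obtain ⟨η, κ, hη, hκ, hK⟩ := exists_fracHeatKernel_lower_bound (n := n) hβ
  set h2 : ℝ := (1 / 2) ^ (1 / β) with hh2
  have hh20 : 0 < h2 := by positivity
  have hh21 : h2 ≤ 1 := Real.rpow_le_one (by norm_num) (by norm_num) (by positivity)
  set ω := (volume (Metric.ball (0 : EuclideanSpace ℝ (Fin n)) 1)).toReal with hω
  have hω0 : 0 < ω := ENNReal.toReal_pos (Metric.measure_ball_pos _ _ one_pos).ne'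
    measure_ball_lt_top.ne
  -- Half the radius, because both `x` and `y` range over the ball and `‖x - y‖` has to stay below
  -- `η * σ`.
  set η' := η * h2 / 2 with hη'
  have hη'0 : 0 < η' := by positivity
  refine exists_lifespan_bound_of_linear_lower_bound (u0 := u0) hα hαn hβ hp hq hpq
    (η := η') (κ := κ)
    hη'0 hκ (fun σ hσ x hx => hK σ hσ x (hx.trans ?_)) (g := γ)
    (m := κ * (ε * (1 + η' ^ 2) ^ (-γ / 2)) * (η' ^ n * ω)) (ρ₀ := 1) (by positivity) ?_ ?_
  · have : η * h2 ≤ η * 1 := by gcongr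
    have h3 : η' ≤ η := by rw [hη']; linarith
    gcongr
  · rw [← sub_lt_iff_lt_add', lt_div_iff₀ hγ] at hcrit
    linarith
  · intro ρ hρ hρ₀ t ht x hx hint
    obtain ⟨σ, hσ, rfl, hσρ, hρσ⟩ := exists_sigma_of_mem_Icc hβ hρ ht
    rw [mem_ball_zero_iff] at hx
    set B := Metric.ball (0 : EuclideanSpace ℝ (Fin n)) (η' * ρ) with hB
    have hnn : 0 ≤ᵐ[volume] fun y => fracHeatKernel n β (σ ^ β) (x - y) * u0 y := by
      filter_upwards [hdecay] with y hy
      exact mul_nonneg (fracHeatKernel_nonneg hβ hβ2 (by positivity) _)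
        ((by positivity : (0 : ℝ) ≤ ε * (1 + ‖y‖ ^ 2) ^ (-γ / 2)).trans hy)
    have hlow : ∀ᵐ y ∂(volume.restrict B), κ * (ρ ^ n)⁻¹ *
        (ε * ((1 + η' ^ 2) ^ (-γ / 2) * ρ ^ (-γ))) ≤ fracHeatKernel n β (σ ^ β) (x - y) * u0 y := by
      filter_upwards [ae_restrict_of_ae hdecay, ae_restrict_mem Metric.isOpen_ball.measurableSet]
        with y hy hyB
      rw [mem_ball_zero_iff] at hyB
      have hxy : ‖x - y‖ ≤ η * σ := by
        have h3 := norm_sub_le x y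
        calc ‖x - y‖ ≤ η * (h2 * ρ) := by rw [hη'] at hx hyB; linarith
          _ ≤ η * σ := by gcongr
      have hKx : κ * (ρ ^ n)⁻¹ ≤ fracHeatKernel n β (σ ^ β) (x - y) := by
        refine le_trans ?_ (hK σ hσ _ hxy)
        gcongr
      have hd : (1 + η' ^ 2) ^ (-γ / 2) * ρ ^ (-γ) ≤ (1 + ‖y‖ ^ 2) ^ (-γ / 2) := by
        have e1 : ρ ^ (-γ) = (ρ ^ 2) ^ (-γ / 2) := by
          rw [← Real.rpow_natCast ρ 2, ← Real.rpow_mul hρ.le]; congr 1; push_cast; ring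
        rw [e1, ← Real.mul_rpow (by positivity) (by positivity)]
        refine Real.rpow_le_rpow_of_nonpos (by positivity) ?_ (by linarith)
        have h4 : ‖y‖ ^ 2 ≤ (η' * ρ) ^ 2 := by gcongr
        nlinarith
      have hu : ε * ((1 + η' ^ 2) ^ (-γ / 2) * ρ ^ (-γ)) ≤ u0 y := le_trans (by gcongr) hy
      exact mul_le_mul hKx hu (by positivity) (le_trans (by positivity) hKx)
    have hvol : volume.real B = (η' * ρ) ^ n * ω := by
      rw [Measure.real, hB, volume_ball_euclidean _ (by positivity), ENNReal.toReal_mul,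
        ENNReal.toReal_ofReal (by positivity)]
    calc κ * (ε * (1 + η' ^ 2) ^ (-γ / 2)) * (η' ^ n * ω) * ρ ^ (-γ)
        = ∫ y in B, κ * (ρ ^ n)⁻¹ * (ε * ((1 + η' ^ 2) ^ (-γ / 2) * ρ ^ (-γ))) := by
          rw [setIntegral_const, hvol, smul_eq_mul, mul_pow]
          field_simp
      _ ≤ ∫ y in B, fracHeatKernel n β (σ ^ β) (x - y) * u0 y :=
          integral_mono_ae (integrableOn_const (by exact measure_ball_lt_top.ne) enorm_ne_top)
            hint.integrableOn hlow
      _ ≤ _ := setIntegral_le_integral hint hnn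

end Blowup

/-! ### Simultaneous `L^s` and `L^∞` bounds, and the Duhamel operator. -/

section NormBounds

variable {n : ℕ} {β s : ℝ}

/-- Jensen's inequality for a weighted Lebesgue integral. -/
lemma lintegral_mul_rpow_le {X : Type*} [MeasurableSpace X] {ν : Measure X} {s : ℝ} (hs : 1 ≤ s)
    {h w : X → ℝ≥0∞} (hh : AEMeasurable h ν) (hw : AEMeasurable w ν) :
    (∫⁻ x, h x * w x ∂ν) ^ s ≤ (∫⁻ x, w x ∂ν) ^ (s - 1) * ∫⁻ x, h x ^ s * w x ∂ν := by
  have hs0 : 0 < s := one_pos.trans_le hs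
  have hs1 : 0 ≤ 1 - 1 / s := by
    rw [sub_nonneg, div_le_one hs0]; exact hs
  have h1 := ENNReal.lintegral_mul_norm_pow_le (μ := ν) (f := fun x => h x ^ s * w x) (g := w)
    ((hh.pow_const s).mul hw) hw (p := 1 / s) (q := 1 - 1 / s) (by positivity) hs1 (by ring)
  have h2 : ∀ x, (h x ^ s * w x) ^ (1 / s) * w x ^ (1 - 1 / s) = h x * w x := by
    intro x
    rw [ENNReal.mul_rpow_of_nonneg _ _ (by positivity), ← ENNReal.rpow_mul,
      mul_one_div_cancel hs0.ne', ENNReal.rpow_one, mul_assoc,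
      ← ENNReal.rpow_add_of_nonneg _ _ (by positivity) hs1]
    simp
  simp_rw [h2] at h1
  calc (∫⁻ x, h x * w x ∂ν) ^ s ≤ ((∫⁻ x, h x ^ s * w x ∂ν) ^ (1 / s) *
        (∫⁻ x, w x ∂ν) ^ (1 - 1 / s)) ^ s := by gcongr
    _ = _ := by
      rw [ENNReal.mul_rpow_of_nonneg _ _ hs0.le, ← ENNReal.rpow_mul, ← ENNReal.rpow_mul,
        one_div_mul_cancel hs0.ne', ENNReal.rpow_one, mul_comm]
      congr 2
      field_simp

/-- `f` is bounded by `c` in `L^∞` and in `L^s`. -/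
structure NormBd (s : ℝ) (c : ℝ≥0∞) (f : EuclideanSpace ℝ (Fin n) → ℝ≥0∞) : Prop where
  ae_le : ∀ᵐ x, f x ≤ c
  lintegral_le : ∫⁻ x, f x ^ s ≤ c ^ s

namespace NormBd

variable {c d : ℝ≥0∞} {f g : EuclideanSpace ℝ (Fin n) → ℝ≥0∞}

lemma mono (hs : 0 ≤ s) (hf : NormBd s c f) (hcd : c ≤ d) : NormBd s d f :=
  ⟨hf.1.mono fun _ h => h.trans hcd, hf.2.trans (by gcongr)⟩

lemma of_le (hs : 0 ≤ s) (hg : NormBd s c g) (h : ∀ᵐ x, f x ≤ g x) : NormBd s c f :=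
  ⟨by filter_upwards [h, hg.1] with x h1 h2 using h1.trans h2,
    (lintegral_mono_ae (h.mono fun x hx => by gcongr)).trans hg.2⟩

lemma const_mul (hs : 0 ≤ s) (hf : NormBd s c f) {k : ℝ≥0∞} (hk : k ≠ ∞) :
    NormBd s (k * c) (fun x => k * f x) := by
  refine ⟨hf.1.mono fun _ h => by gcongr, ?_⟩
  simp_rw [ENNReal.mul_rpow_of_nonneg _ _ hs]
  rw [lintegral_const_mul' _ _ (ENNReal.rpow_ne_top_of_nonneg hs hk)]
  gcongr
  exact hf.2

lemma add (hs : 1 ≤ s) (hf : NormBd s c f) (hg : NormBd s d g) (hfm : AEMeasurable f)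
    (hgm : AEMeasurable g) : NormBd s (c + d) (fun x => f x + g x) := by
  have hs0 : 0 < s := one_pos.trans_le hs
  refine ⟨by filter_upwards [hf.1, hg.1] with x h1 h2 using add_le_add h1 h2, ?_⟩
  have h := ENNReal.lintegral_Lp_add_le hfm hgm hs
  have h1 : (∫⁻ x, f x ^ s) ^ (1 / s) ≤ c := by
    calc _ ≤ (c ^ s) ^ (1 / s) := by gcongr; exact hf.2
      _ = c := by rw [← ENNReal.rpow_mul, mul_one_div_cancel hs0.ne', ENNReal.rpow_one]
  have h2 : (∫⁻ x, g x ^ s) ^ (1 / s) ≤ d := by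
    calc _ ≤ (d ^ s) ^ (1 / s) := by gcongr; exact hg.2
      _ = d := by rw [← ENNReal.rpow_mul, mul_one_div_cancel hs0.ne', ENNReal.rpow_one]
  have h3 := ENNReal.rpow_le_rpow (h.trans (add_le_add h1 h2)) hs0.le
  rw [← ENNReal.rpow_mul, one_div_mul_cancel hs0.ne', ENNReal.rpow_one] at h3
  exact h3

/-- The kernel is a probability density: Jensen's inequality moves the power inside, and the flow
preserves the integral of `f ^ s`. -/
lemma heatOp [NeZero n] (hs : 1 ≤ s) (hβ : 0 < β) (hβ2 : β ≤ 2) {t : ℝ} (ht : 0 < t)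
    (hf : NormBd s c f) (hfm : AEMeasurable f) : NormBd s c (heatOp n β t f) := by
  refine ⟨Eventually.of_forall fun x => ?_, ?_⟩
  · exact (heatOp_mono hf.1 x).trans_eq (heatOp_const hβ hβ2 ht c x)
  · calc ∫⁻ x, _root_.heatOp n β t f x ^ s
        ≤ ∫⁻ x, _root_.heatOp n β t (fun y => f y ^ s) x := by
          refine lintegral_mono fun x => ?_
          have h := lintegral_mul_rpow_le (ν := volume) hs hfm
            (measurable_heatKer_sub_right (n := n) (β := β) t x).aemeasurable
          rw [lintegral_fracHeatKernel_sub_left hβ hβ2 ht, ENNReal.one_rpow, one_mul] at h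
          simpa only [_root_.heatOp, mul_comm] using h
      _ = ∫⁻ x, f x ^ s := lintegral_heatOp hβ hβ2 ht (hfm.pow_const s)
      _ ≤ _ := hf.2

/-- A form of Minkowski's integral inequality. Jensen is applied to `F / γ` with the weight `γ`,
which is why `γ` must avoid zero and infinity; the `s`-th power of each quotient then has space
integral at most one. -/
lemma lintegral (hs : 1 ≤ s) {ν : Measure ℝ} [SFinite ν] {F : ℝ → EuclideanSpace ℝ (Fin n) → ℝ≥0∞}
    (hF : Measurable (Function.uncurry F)) {γ : ℝ → ℝ≥0∞} (hγ : Measurable γ)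
    (hγ0 : ∀ τ, γ τ ≠ 0) (hγt : ∀ τ, γ τ ≠ ∞) (h : ∀ᵐ τ ∂ν, NormBd s (γ τ) (F τ)) :
    NormBd s (∫⁻ τ, γ τ ∂ν) (fun x => ∫⁻ τ, F τ x ∂ν) := by
  have hs0 : 0 < s := one_pos.trans_le hs
  constructor
  · have h1 : ∀ᵐ τ ∂ν, ∀ᵐ x, F τ x ≤ γ τ := h.mono fun τ hτ => hτ.1
    have h2 : ∀ᵐ x, ∀ᵐ τ ∂ν, F τ x ≤ γ τ := by
      refine (Measure.ae_ae_comm (p := fun τ x => F τ x ≤ γ τ) ?_).1 h1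
      exact measurableSet_le hF (hγ.comp measurable_fst)
    exact h2.mono fun x hx => lintegral_mono_ae hx
  · set G := ∫⁻ τ, γ τ ∂ν with hG
    have hpt : ∀ x, (∫⁻ τ, F τ x ∂ν) ^ s ≤ G ^ (s - 1) * ∫⁻ τ, (F τ x / γ τ) ^ s * γ τ ∂ν := by
      intro x
      have hFx : Measurable fun τ => F τ x := hF.comp (measurable_id.prodMk measurable_const)
      have h1 := lintegral_mul_rpow_le (ν := ν) hs (hFx.div hγ).aemeasurable hγ.aemeasurable
      have h2 : ∀ τ, F τ x / γ τ * γ τ = F τ x := fun τ => ENNReal.div_mul_cancel (hγ0 τ) (hγt τ)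
      simpa only [Pi.div_apply, h2] using h1
    have hm : Measurable (Function.uncurry fun (x : EuclideanSpace ℝ (Fin n)) (τ : ℝ) =>
        (F τ x / γ τ) ^ s * γ τ) :=
      (((hF.comp measurable_swap).div (hγ.comp measurable_snd)).pow_const s).mul
        (hγ.comp measurable_snd)
    calc ∫⁻ x, (∫⁻ τ, F τ x ∂ν) ^ s
        ≤ ∫⁻ x, G ^ (s - 1) * ∫⁻ τ, (F τ x / γ τ) ^ s * γ τ ∂ν := lintegral_mono hpt
      _ = G ^ (s - 1) * ∫⁻ x, ∫⁻ τ, (F τ x / γ τ) ^ s * γ τ ∂ν :=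
          lintegral_const_mul _ hm.lintegral_prod_right'
      _ = G ^ (s - 1) * ∫⁻ τ, (∫⁻ x, (F τ x / γ τ) ^ s * γ τ) ∂ν := by
          rw [lintegral_lintegral_swap hm.aemeasurable]
      _ ≤ G ^ (s - 1) * ∫⁻ τ, γ τ ∂ν := by
          gcongr 1
          refine lintegral_mono_ae (h.mono fun τ hτ => ?_)
          have e : ∀ x, (F τ x / γ τ) ^ s * γ τ = ((γ τ)⁻¹ ^ s * γ τ) * F τ x ^ s := by
            intro x
            rw [div_eq_mul_inv, ENNReal.mul_rpow_of_nonneg _ _ hs0.le]; ring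
          simp_rw [e]
          have hfin : (γ τ)⁻¹ ^ s * γ τ ≠ ∞ := ENNReal.mul_ne_top
            (ENNReal.rpow_ne_top_of_nonneg hs0.le (ENNReal.inv_ne_top.2 (hγ0 τ))) (hγt τ)
          rw [lintegral_const_mul' _ _ hfin]
          calc _ ≤ ((γ τ)⁻¹ ^ s * γ τ) * γ τ ^ s := by gcongr; exact hτ.2
            _ = ((γ τ)⁻¹ * γ τ) ^ s * γ τ := by
              rw [ENNReal.mul_rpow_of_nonneg _ _ hs0.le]; ring
            _ = γ τ := by rw [ENNReal.inv_mul_cancel (hγ0 τ) (hγt τ)]; simp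
      _ = G ^ s := by
          rw [← hG]
          nth_rewrite 2 [← ENNReal.rpow_one G]
          rw [← ENNReal.rpow_add_of_nonneg _ _ (by linarith) zero_le_one, sub_add_cancel]

end NormBd

lemma normBd_enorm_iff (hs : 0 < s) {c : ℝ≥0∞} {v : EuclideanSpace ℝ (Fin n) → ℝ} :
    NormBd s c (fun x => ‖v x‖ₑ) ↔
      eLpNorm v ∞ volume ≤ c ∧ eLpNorm v (ENNReal.ofReal s) volume ≤ c := by
  have h1 : eLpNorm v ∞ volume ≤ c ↔ ∀ᵐ x, ‖v x‖ₑ ≤ c := by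
    rw [eLpNorm_exponent_top, eLpNormEssSup_eq_essSup_enorm]
    exact ⟨fun h => (ae_le_essSup (f := fun x => ‖v x‖ₑ)).mono fun x hx => hx.trans h,
      fun h => essSup_le_of_ae_le _ h⟩
  have h2 : eLpNorm v (ENNReal.ofReal s) volume ≤ c ↔ ∫⁻ x, ‖v x‖ₑ ^ s ≤ c ^ s := by
    rw [eLpNorm_eq_lintegral_rpow_enorm_toReal (by simpa using hs) ENNReal.ofReal_ne_top,
      ENNReal.toReal_ofReal hs.le, one_div, ENNReal.rpow_inv_le_iff hs]
  rw [h1, h2]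
  exact ⟨fun h => ⟨h.1, h.2⟩, fun h => ⟨h.1, h.2⟩⟩

/-- The Duhamel operator started at time `a`, acting on nonnegative sources. -/
noncomputable def heatInt (n : ℕ) (β a t : ℝ) (F : ℝ → EuclideanSpace ℝ (Fin n) → ℝ≥0∞)
    (x : EuclideanSpace ℝ (Fin n)) : ℝ≥0∞ :=
  ∫⁻ τ in Ioo a t, heatOp n β (t - τ) (F τ) x

lemma measurable_uncurry_heatOp_sub {F : ℝ → EuclideanSpace ℝ (Fin n) → ℝ≥0∞}
    (hF : Measurable (Function.uncurry F)) (t : ℝ) :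
    Measurable (Function.uncurry fun τ x => heatOp n β (t - τ) (F τ) x) := by
  unfold Function.uncurry
  refine measurable_heatOp_param (α := ℝ × EuclideanSpace ℝ (Fin n)) (t := fun z => t - z.1)
    (f := fun z => F z.1) (x := fun z => z.2) (by fun_prop) ?_ measurable_snd
  exact hF.comp ((measurable_fst.comp measurable_fst).prodMk measurable_snd)

lemma measurable_heatInt {F : ℝ → EuclideanSpace ℝ (Fin n) → ℝ≥0∞}
    (hF : Measurable (Function.uncurry F)) (a t : ℝ) : Measurable (heatInt n β a t F) :=
  (measurable_uncurry_heatOp_sub hF t).lintegral_prod_left'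

lemma measurable_uncurry_heatInt {F : ℝ → EuclideanSpace ℝ (Fin n) → ℝ≥0∞}
    (hF : Measurable (Function.uncurry F)) (a : ℝ) :
    Measurable (Function.uncurry fun t => heatInt n β a t F) := by
  -- The condition on `τ` is moved into the integrand, so that the domain of integration no longer
  -- depends on the parameter.
  have e : (Function.uncurry fun t => heatInt n β a t F) =
      fun z : ℝ × EuclideanSpace ℝ (Fin n) =>
        ∫⁻ τ, (if a < τ ∧ τ < z.1 then heatOp n β (z.1 - τ) (F τ) z.2 else 0) := by
    funext z
    simp only [Function.uncurry, heatInt]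
    rw [← lintegral_indicator measurableSet_Ioo]
    refine lintegral_congr fun τ => ?_
    simp [indicator_apply]
  rw [e]
  refine Measurable.lintegral_prod_right' (f := fun w : (ℝ × EuclideanSpace ℝ (Fin n)) × ℝ =>
    if a < w.2 ∧ w.2 < w.1.1 then heatOp n β (w.1.1 - w.2) (F w.2) w.1.2 else 0) ?_
  refine Measurable.ite ((measurableSet_lt measurable_const measurable_snd).inter
    (measurableSet_lt measurable_snd (measurable_fst.comp measurable_fst))) ?_ measurable_const
  refine measurable_heatOp_param (α := (ℝ × EuclideanSpace ℝ (Fin n)) × ℝ)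
    (t := fun w => w.1.1 - w.2) (f := fun w => F w.2) (x := fun w => w.1.2)
    (by fun_prop) ?_ (measurable_snd.comp measurable_fst)
  exact hF.comp ((measurable_snd.comp measurable_fst).prodMk measurable_snd)

lemma NormBd.heatInt [NeZero n] (hs : 1 ≤ s) (hβ : 0 < β) (hβ2 : β ≤ 2)
    {F : ℝ → EuclideanSpace ℝ (Fin n) → ℝ≥0∞} (hF : Measurable (Function.uncurry F))
    {γ : ℝ → ℝ≥0∞} (hγ : Measurable γ) (hγ0 : ∀ τ, γ τ ≠ 0) (hγt : ∀ τ, γ τ ≠ ∞) {a t : ℝ}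
    (h : ∀ᵐ τ ∂volume.restrict (Ioo a t), NormBd s (γ τ) (F τ)) :
    NormBd s (∫⁻ τ in Ioo a t, γ τ) (heatInt n β a t F) := by
  refine NormBd.lintegral (F := fun τ x => _root_.heatOp n β (t - τ) (F τ) x) hs
    (measurable_uncurry_heatOp_sub hF t) hγ hγ0 hγt ?_
  filter_upwards [h, ae_restrict_mem measurableSet_Ioo] with τ hτ hτt
  exact hτ.heatOp hs hβ hβ2 (sub_pos.2 hτt.2)
    (hF.comp (measurable_const.prodMk measurable_id)).aemeasurable

lemma heatInt_congr {a t : ℝ} {F G : ℝ → EuclideanSpace ℝ (Fin n) → ℝ≥0∞}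
    (h : ∀ᵐ τ ∂volume.restrict (Ioo a t), F τ =ᵐ[volume] G τ) (x : EuclideanSpace ℝ (Fin n)) :
    heatInt n β a t F x = heatInt n β a t G x :=
  lintegral_congr_ae (h.mono fun _ hτ => heatOp_congr hτ x)

lemma heatInt_mono {a t : ℝ} {F G : ℝ → EuclideanSpace ℝ (Fin n) → ℝ≥0∞}
    (h : ∀ᵐ τ ∂volume.restrict (Ioo a t), F τ ≤ᵐ[volume] G τ) (x : EuclideanSpace ℝ (Fin n)) :
    heatInt n β a t F x ≤ heatInt n β a t G x :=
  lintegral_mono_ae (h.mono fun _ hτ => heatOp_mono hτ x)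

lemma heatInt_add {a t : ℝ} {F G : ℝ → EuclideanSpace ℝ (Fin n) → ℝ≥0∞}
    (hF : Measurable (Function.uncurry F)) (x : EuclideanSpace ℝ (Fin n)) :
    heatInt n β a t (fun τ y => F τ y + G τ y) x
      = heatInt n β a t F x + heatInt n β a t G x := by
  unfold heatInt
  have h1 : ∀ τ, Measurable (F τ) := fun τ => hF.comp (measurable_const.prodMk measurable_id)
  simp_rw [fun τ => heatOp_add (n := n) (β := β) (t := t - τ) (g := G τ) (h1 τ) x]
  exact lintegral_add_left ((measurable_uncurry_heatOp_sub hF t).comp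
    (measurable_id.prodMk measurable_const)) _

lemma heatInt_split {a b t : ℝ} (hab : a ≤ b) (hbt : b ≤ t)
    (F : ℝ → EuclideanSpace ℝ (Fin n) → ℝ≥0∞) (x : EuclideanSpace ℝ (Fin n)) :
    heatInt n β a t F x
      = (∫⁻ τ in Ioo a b, heatOp n β (t - τ) (F τ) x) + heatInt n β b t F x := by
  unfold heatInt
  rw [Measure.restrict_congr_set Ioo_ae_eq_Ioc, ← Ioc_union_Ioc_eq_Ioc hab hbt,
    lintegral_union measurableSet_Ioc
      (Set.disjoint_left.2 fun y h1 h2 => absurd h1.2 (not_le.2 h2.1)),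
    Measure.restrict_congr_set (Ioo_ae_eq_Ioc (a := a) (b := b)),
    Measure.restrict_congr_set (Ioo_ae_eq_Ioc (a := b) (b := t))]

/-- Sources before time `b` are carried to `b` and then from `b` to `t` by the semigroup law;
Tonelli exchanges the two integrals. -/
lemma heatInt_eq_heatOp_add [NeZero n] (hβ : 0 < β) (hβ2 : β ≤ 2) {a b t : ℝ} (hab : a ≤ b)
    (hbt : b < t) {F : ℝ → EuclideanSpace ℝ (Fin n) → ℝ≥0∞}
    (hF : Measurable (Function.uncurry F)) (x : EuclideanSpace ℝ (Fin n)) :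
    heatInt n β a t F x
      = heatOp n β (t - b) (heatInt n β a b F) x + heatInt n β b t F x := by
  rw [heatInt_split hab hbt.le]
  congr 1
  have h1 : ∀ τ, Measurable (F τ) := fun τ => hF.comp (measurable_const.prodMk measurable_id)
  have h2 : heatOp n β (t - b) (heatInt n β a b F) x
      = ∫⁻ τ in Ioo a b, heatOp n β (t - b) (heatOp n β (b - τ) (F τ)) x := by
    have e : ∀ y, ENNReal.ofReal (fracHeatKernel n β (t - b) (x - y)) * heatInt n β a b F y
        = ∫⁻ τ in Ioo a b, ENNReal.ofReal (fracHeatKernel n β (t - b) (x - y)) *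
            heatOp n β (b - τ) (F τ) y := fun y =>
      (lintegral_const_mul' _ _ ENNReal.ofReal_ne_top).symm
    rw [heatOp]
    simp_rw [e]
    rw [lintegral_lintegral_swap]
    · rfl
    · exact (((measurable_heatKer_sub_right (n := n) (β := β) (t - b) x).comp measurable_fst).mul
        ((measurable_uncurry_heatOp_sub hF b).comp measurable_swap)).aemeasurable
  rw [h2]
  refine setLIntegral_congr_fun measurableSet_Ioo fun τ hτ => ?_
  rw [heatOp_heatOp hβ hβ2 (sub_pos.2 hbt) (sub_pos.2 hτ.2) (h1 τ).aemeasurable]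
  congr 1
  ring

lemma heatInt_shift {a t : ℝ} (F : ℝ → EuclideanSpace ℝ (Fin n) → ℝ≥0∞)
    (x : EuclideanSpace ℝ (Fin n)) :
    heatInt n β a t F x = heatInt n β 0 (t - a) (fun τ => F (τ + a)) x := by
  unfold heatInt
  have h := (measurePreserving_add_right (volume : Measure ℝ) a).setLIntegral_comp_emb
    (measurableEmbedding_addRight a)
    (fun τ => heatOp n β (t - τ) (F τ) x) (Ioo 0 (t - a))
  have himg : (fun τ => τ + a) '' Ioo 0 (t - a) = Ioo a t := by
    simp
  rw [himg] at h
  rw [← h]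
  refine lintegral_congr fun τ => ?_
  congr 1
  ring

end NormBounds

/-! ### Uniform bounds for the Riesz potential; the role of `s < n * p / α`. -/

section RieszBounds

variable {n : ℕ} {α p q s : ℝ}

lemma integrableOn_ball_norm_rpow [NeZero n] (hα : 0 < α) :
    IntegrableOn (fun z : EuclideanSpace ℝ (Fin n) => ‖z‖ ^ (-((n : ℝ) - α)))
      (Metric.ball 0 1) := by
  have h := (integrable_fun_norm_addHaar (volume : Measure (EuclideanSpace ℝ (Fin n)))
    (f := (Iio (1 : ℝ)).indicator fun r => r ^ (-((n : ℝ) - α)))).2 ?_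
  · rw [← integrable_indicator_iff Metric.isOpen_ball.measurableSet]
    refine h.congr (Eventually.of_forall fun z => ?_)
    beta_reduce
    by_cases hz : ‖z‖ < 1
    · rw [indicator_of_mem (show ‖z‖ ∈ Iio (1 : ℝ) from hz),
        indicator_of_mem (mem_ball_zero_iff.2 hz)]
    · rw [indicator_of_notMem (show ‖z‖ ∉ Iio (1 : ℝ) from hz),
        indicator_of_notMem (fun h => hz (mem_ball_zero_iff.1 h))]
  · have h2 : IntegrableOn ((Ioo (0 : ℝ) 1).indicator fun r => r ^ (α - 1)) (Ioi 0) := by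
      refine Integrable.integrableOn ?_
      rw [integrable_indicator_iff measurableSet_Ioo]
      exact ((intervalIntegral.intervalIntegrable_rpow' (a := 0) (b := 1) (r := α - 1)
        (by linarith)).1).mono_set Ioo_subset_Ioc_self
    refine h2.congr_fun (fun r hr => ?_) measurableSet_Ioi
    have hr0 : (0 : ℝ) < r := hr
    by_cases h1 : r < 1
    · rw [indicator_of_mem (show r ∈ Ioo (0 : ℝ) 1 from ⟨hr, h1⟩),
        indicator_of_mem (show r ∈ Iio (1 : ℝ) from h1)]
      rw [finrank_euclideanSpace, Fintype.card_fin, smul_eq_mul, ← Real.rpow_natCast,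
        ← Real.rpow_add hr0, Nat.cast_sub (NeZero.one_le)]
      congr 1
      push_cast
      ring
    · rw [indicator_of_notMem (show r ∉ Ioo (0 : ℝ) 1 from fun h => h1 h.2),
        indicator_of_notMem (show r ∉ Iio (1 : ℝ) from h1), smul_zero]

lemma integrableOn_compl_ball_norm_rpow [NeZero n] {m : ℝ} (hm : (n : ℝ) < m) :
    IntegrableOn (fun z : EuclideanSpace ℝ (Fin n) => ‖z‖ ^ (-m)) (Metric.ball 0 1)ᶜ := by
  have h := (integrable_one_add_norm (E := EuclideanSpace ℝ (Fin n)) (μ := volume) (r := m)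
    (by simpa using hm)).const_mul (2 ^ m)
  have hn : (0 : ℝ) ≤ n := Nat.cast_nonneg n
  refine (h.integrableOn (s := (Metric.ball 0 1)ᶜ)).mono'
    (Measurable.aestronglyMeasurable (by fun_prop))
    ((ae_restrict_mem Metric.isOpen_ball.measurableSet.compl).mono fun z hz => ?_)
  rw [mem_compl_iff, mem_ball_zero_iff, not_lt] at hz
  rw [Real.norm_of_nonneg (by positivity)]
  have h0 : 0 < 1 + ‖z‖ := by positivity
  calc ‖z‖ ^ (-m) ≤ ((1 + ‖z‖) / 2) ^ (-m) :=
        Real.rpow_le_rpow_of_nonpos (by positivity) (by linarith) (by linarith)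
    _ = 2 ^ m * (1 + ‖z‖) ^ (-m) := by
        rw [Real.div_rpow h0.le zero_le_two, Real.rpow_neg zero_le_two]
        field_simp

lemma measurable_rieszKer_sub :
    Measurable (fun z : EuclideanSpace ℝ (Fin n) × EuclideanSpace ℝ (Fin n) =>
      ENNReal.ofReal (rieszConst n α * ‖z.1 - z.2‖ ^ (-((n : ℝ) - α)))) := by
  fun_prop

/-- The Riesz potential of the `p`-th power of a function bounded by one in `L^s ∩ L^∞` is
bounded, provided `s < np/α`. -/
lemma exists_rieszPotential_bound [NeZero n] (hα : 0 < α) (hαn : α < n) (hp : 0 < p)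
    (hsp : s < n * p / α) :
    ∃ C : ℝ, 0 < C ∧ ∀ f : EuclideanSpace ℝ (Fin n) → ℝ≥0∞, Measurable f → NormBd s 1 f →
      ∀ x, rieszPotential n α (fun y => f y ^ p) x ≤ ENNReal.ofReal C := by
  have hn : (0 : ℝ) < n := hα.trans hαn
  have hA := rieszConst_pos hα hαn
  -- The exponent `r` must satisfy `s ≤ p * r`, so that `f ^ (p * r) ≤ f ^ s` when `f ≤ 1`, and `r <
  -- n / α`, which says that the kernel to the conjugate power `r'` is integrable away from the
  -- origin. Such an `r > 1` exists because `α < n` and `s < n * p / α`.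
  obtain ⟨r, hr1, hr2⟩ : ∃ r, max 1 (s / p) < r ∧ r < n / α := by
    apply exists_between
    refine max_lt ((one_lt_div hα).2 hαn) ?_
    rw [div_lt_div_iff₀ hp hα]
    rwa [lt_div_iff₀ hα] at hsp
  have hr : 1 < r := (le_max_left _ _).trans_lt hr1
  have hsr : s ≤ p * r := by
    have := (le_max_right _ _).trans hr1.le
    rw [div_le_iff₀ hp] at this
    linarith
  set r' := Real.conjExponent r with hr'
  have hconj : r.HolderConjugate r' := Real.HolderConjugate.conjExponent hr
  set k : EuclideanSpace ℝ (Fin n) → ℝ≥0∞ := fun z =>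
    ENNReal.ofReal (rieszConst n α * ‖z‖ ^ (-((n : ℝ) - α))) with hk
  have hkm : Measurable k := by rw [hk]; fun_prop
  set B := Metric.ball (0 : EuclideanSpace ℝ (Fin n)) 1 with hB
  have hBm : MeasurableSet B := Metric.isOpen_ball.measurableSet
  have hI1 : ∫⁻ z in B, k z < ∞ := by
    have h := ((integrableOn_ball_norm_rpow (n := n) hα).const_mul (rieszConst n α)).2
    rwa [hasFiniteIntegral_iff_ofReal (Eventually.of_forall fun z => by positivity)] at h
  have hI2 : ∫⁻ z in Bᶜ, k z ^ r' < ∞ := by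
    have hm : (n : ℝ) < (n - α) * r' := by
      rw [hr', Real.conjExponent, ← mul_div_assoc, lt_div_iff₀ (by linarith)]
      rw [lt_div_iff₀ hα] at hr2
      linarith
    have h := ((integrableOn_compl_ball_norm_rpow (n := n) hm).const_mul
      (rieszConst n α ^ r')).2
    rw [hasFiniteIntegral_iff_ofReal (Eventually.of_forall fun z => by positivity)] at h
    refine lt_of_eq_of_lt (lintegral_congr fun z => ?_) h
    simp only [hk]
    rw [ENNReal.ofReal_rpow_of_nonneg (by positivity) hconj.symm.nonneg,
      Real.mul_rpow hA.le (by positivity), ← Real.rpow_mul (norm_nonneg _), neg_mul]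
  set Ct := (∫⁻ z in B, k z) + (∫⁻ z in Bᶜ, k z ^ r') + 1 with hCt
  have hCtop : Ct ≠ ∞ := by
    rw [hCt]; exact ENNReal.add_ne_top.2 ⟨(ENNReal.add_lt_top.2 ⟨hI1, hI2⟩).ne, ENNReal.one_ne_top⟩
  refine ⟨Ct.toReal, ENNReal.toReal_pos (by rw [hCt]; simp) hCtop, fun f hf hbd x => ?_⟩
  rw [ENNReal.ofReal_toReal hCtop]
  have h1 : rieszPotential n α (fun y => f y ^ p) x = ∫⁻ z, k z * f (x - z) ^ p := by
    unfold rieszPotential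
    rw [← lintegral_sub_left_eq_self _ x]
    simp [hk]
  have hbd' : ∀ᵐ z, f (x - z) ≤ 1 :=
    (volume.measurePreserving_sub_left x).quasiMeasurePreserving.ae hbd.ae_le
  have hfx : Measurable fun z => f (x - z) := hf.comp (by fun_prop)
  have h2 : ∫⁻ z, f (x - z) ^ s ≤ 1 := by
    rw [lintegral_sub_left_eq_self (fun z => f z ^ s) x]
    simpa using hbd.lintegral_le
  rw [h1, ← lintegral_add_compl _ hBm, hCt, add_assoc]
  refine add_le_add (lintegral_mono_ae ?_) ?_
  -- Near the origin the kernel is integrable and only the bound `f ≤ 1` is used.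
  · filter_upwards [ae_restrict_of_ae hbd'] with z hz
    exact mul_le_of_le_one_right' (ENNReal.rpow_le_one hz hp.le)
  -- Away from the origin, Young's inequality separates the kernel from `f`; its factors `1 / r` and
  -- `1 / r'` are dropped.
  · calc ∫⁻ z in Bᶜ, k z * f (x - z) ^ p ≤ ∫⁻ z in Bᶜ, (k z ^ r' + f (x - z) ^ s) := by
          refine lintegral_mono_ae ?_
          filter_upwards [ae_restrict_of_ae hbd'] with z hz
          have hy := ENNReal.young_inequality (k z) (f (x - z) ^ p) hconj.symm
          have e1 : (1 : ℝ≥0∞) ≤ ENNReal.ofReal r := by simpa using hr.le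
          have e2 : (1 : ℝ≥0∞) ≤ ENNReal.ofReal r' := by simpa using hconj.symm.lt.le
          refine hy.trans (add_le_add ?_ ?_)
          · exact ENNReal.div_le_of_le_mul (le_mul_of_one_le_right' e2)
          · refine (ENNReal.div_le_of_le_mul (le_mul_of_one_le_right' e1)).trans ?_
            rw [← ENNReal.rpow_mul]
            exact ENNReal.rpow_le_rpow_of_exponent_ge hz hsr
      _ = (∫⁻ z in Bᶜ, k z ^ r') + ∫⁻ z in Bᶜ, f (x - z) ^ s :=
          lintegral_add_left (hkm.pow_const _) _
      _ ≤ _ := by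
          gcongr
          exact (setLIntegral_le_lintegral _ _).trans h2

lemma rieszPotential_mono {f g : EuclideanSpace ℝ (Fin n) → ℝ≥0∞} (h : f ≤ᵐ[volume] g)
    (x : EuclideanSpace ℝ (Fin n)) : rieszPotential n α f x ≤ rieszPotential n α g x :=
  lintegral_mono_ae (h.mono fun y hy => by gcongr)

lemma rieszPotential_congr {f g : EuclideanSpace ℝ (Fin n) → ℝ≥0∞} (h : f =ᵐ[volume] g)
    (x : EuclideanSpace ℝ (Fin n)) : rieszPotential n α f x = rieszPotential n α g x :=
  lintegral_congr_ae (h.mono fun y hy => by simp only [hy])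

lemma rieszPotential_add {f g : EuclideanSpace ℝ (Fin n) → ℝ≥0∞} (hf : Measurable f)
    (x : EuclideanSpace ℝ (Fin n)) : rieszPotential n α (fun y => f y + g y) x
      = rieszPotential n α f x + rieszPotential n α g x := by
  unfold rieszPotential
  simp_rw [mul_add]
  exact lintegral_add_left ((measurable_rieszKer_sub.comp
    (measurable_const.prodMk measurable_id)).mul hf) _

lemma rieszPotential_const_mul {f : EuclideanSpace ℝ (Fin n) → ℝ≥0∞} {c : ℝ≥0∞} (hc : c ≠ ∞)
    (x : EuclideanSpace ℝ (Fin n)) : rieszPotential n α (fun y => c * f y) x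
      = c * rieszPotential n α f x := by
  unfold rieszPotential
  rw [← lintegral_const_mul' _ _ hc]
  exact lintegral_congr fun y => by ring

lemma measurable_uncurry_rieszPotential {X : Type*} [MeasurableSpace X]
    {f : X → EuclideanSpace ℝ (Fin n) → ℝ≥0∞} (hf : Measurable (Function.uncurry f)) :
    Measurable (Function.uncurry fun a x => rieszPotential n α (f a) x) := by
  unfold rieszPotential
  refine Measurable.lintegral_prod_right' (f := fun z : (X × EuclideanSpace ℝ (Fin n)) ×
    EuclideanSpace ℝ (Fin n) => ENNReal.ofReal (rieszConst n α * ‖z.1.2 - z.2‖ ^ (-((n : ℝ) - α)))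
      * f z.1.1 z.2) ?_
  exact (measurable_rieszKer_sub.comp ((measurable_snd.comp measurable_fst).prodMk
    measurable_snd)).mul (hf.comp ((measurable_fst.comp measurable_fst).prodMk measurable_snd))

end RieszBounds

/-! ### Boundedness and local Lipschitz continuity of the nonlinearity on `L^s ∩ L^∞`. -/

section Nonlinearity

variable {n : ℕ} {α p q s : ℝ}

/-- Bernoulli's inequality for `(b / a) ^ m`, multiplied by `a ^ m`. -/
lemma rpow_sub_rpow_le {m a b : ℝ} (hm : 1 ≤ m) (hb : 0 ≤ b) (hba : b ≤ a) :
    a ^ m - b ^ m ≤ m * a ^ (m - 1) * (a - b) := by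
  rcases (hb.trans hba).eq_or_lt with rfl | ha
  · have : b = 0 := le_antisymm hba hb
    subst this; simp
  have h := one_add_mul_self_le_rpow_one_add (s := b / a - 1)
    (by have : 0 ≤ b / a := by positivity
        linarith) hm
  rw [add_sub_cancel, Real.div_rpow hb ha.le, le_div_iff₀ (by positivity)] at h
  have e : a ^ m = a ^ (m - 1) * a := by
    rw [← Real.rpow_add_one ha.ne', sub_add_cancel]
  have e2 : (1 + m * (b / a - 1)) * a ^ m = a ^ m - m * a ^ (m - 1) * (a - b) := by
    rw [e]; field_simp; ring
  linarith

lemma abs_rpow_sub_rpow_le {m a b : ℝ} (hm : 1 ≤ m) :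
    |(|a| ^ m - |b| ^ m)| ≤ m * max |a| |b| ^ (m - 1) * |a - b| := by
  have h1 := abs_abs_sub_abs_le_abs_sub a b
  rcases le_total |b| |a| with h | h
  · rw [abs_of_nonneg (sub_nonneg.2 (by gcongr)), max_eq_left h]
    rw [abs_of_nonneg (sub_nonneg.2 h)] at h1
    refine (rpow_sub_rpow_le hm (abs_nonneg b) h).trans ?_
    gcongr
  · rw [abs_of_nonpos (sub_nonpos.2 (by gcongr)), max_eq_right h, neg_sub]
    rw [abs_of_nonpos (sub_nonpos.2 h), neg_sub] at h1
    refine (rpow_sub_rpow_le hm (abs_nonneg a) h).trans ?_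
    gcongr

/-- With `M` and `η` the sizes of the functions and of their difference, each term on the right is
the `m`-th power of a function of unit size. The Riesz bound thus applies to every term separately,
and no Hölder inequality for mixed products is needed. The mixed term is handled by `X ^ (m - 1) * Y
≤ X ^ m + Y ^ m`. -/
lemma abs_rpow_sub_rpow_le_of_scale {m a b M η : ℝ} (hm : 1 ≤ m) (hM : 0 < M) (hη : 0 < η) :
    |(|a| ^ m - |b| ^ m)| ≤ m * M ^ (m - 1) * η *
      ((|a| / M) ^ m + (|b| / M) ^ m + (|a - b| / η) ^ m) := by
  have hm0 : 0 < m := by linarith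
  refine (abs_rpow_sub_rpow_le hm).trans ?_
  set X := max |a| |b| / M with hX
  set Y := |a - b| / η with hY
  have hX0 : 0 ≤ X := by positivity
  have hY0 : 0 ≤ Y := by positivity
  have e1 : max |a| |b| = M * X := by rw [hX]; field_simp
  have e2 : |a - b| = η * Y := by rw [hY]; field_simp
  have h1 : X ^ (m - 1) * Y ≤ X ^ m + Y ^ m := by
    have hz : ∀ z : ℝ, 0 ≤ z → z ^ (m - 1) * z = z ^ m := by
      intro z hz
      rcases hz.eq_or_lt with rfl | hz
      · rw [mul_zero, Real.zero_rpow hm0.ne']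
      · rw [← Real.rpow_add_one hz.ne', sub_add_cancel]
    rcases le_total X Y with h | h
    · calc X ^ (m - 1) * Y ≤ Y ^ (m - 1) * Y := by gcongr
        _ = Y ^ m := hz Y hY0
        _ ≤ _ := le_add_of_nonneg_left (by positivity)
    · calc X ^ (m - 1) * Y ≤ X ^ (m - 1) * X := by gcongr
        _ = X ^ m := hz X hX0
        _ ≤ _ := le_add_of_nonneg_right (by positivity)
  have h2 : X ^ m ≤ (|a| / M) ^ m + (|b| / M) ^ m := by
    rcases le_total |b| |a| with h | h
    · rw [hX, max_eq_left h]; exact le_add_of_nonneg_right (by positivity)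
    · rw [hX, max_eq_right h]; exact le_add_of_nonneg_left (by positivity)
  calc m * max |a| |b| ^ (m - 1) * |a - b| = m * M ^ (m - 1) * η * (X ^ (m - 1) * Y) := by
        rw [e1, e2, Real.mul_rpow hM.le hX0]; ring
    _ ≤ m * M ^ (m - 1) * η * ((|a| / M) ^ m + (|b| / M) ^ m + Y ^ m) := by
        gcongr; linarith

/-- A majorant of the difference of the nonlinearities of `v` and `w`. -/
noncomputable def hartreeDiff (n : ℕ) (α p q : ℝ) (v w : EuclideanSpace ℝ (Fin n) → ℝ)
    (x : EuclideanSpace ℝ (Fin n)) : ℝ≥0∞ :=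
  rieszPotential n α (fun y => ENNReal.ofReal |(|v y| ^ p - |w y| ^ p)|) x *
      ENNReal.ofReal (|v x| ^ q) +
    rieszPotential n α (fun y => ENNReal.ofReal (|w y| ^ p)) x *
      ENNReal.ofReal |(|v x| ^ q - |w x| ^ q)|

lemma ofReal_le_add_ofReal_abs_sub (a b : ℝ) :
    ENNReal.ofReal a ≤ ENNReal.ofReal b + ENNReal.ofReal |a - b| := by
  refine le_trans (ENNReal.ofReal_le_ofReal ?_) ENNReal.ofReal_add_le
  linarith [le_abs_self (a - b)]

lemma rieszPotential_le_add_diff {v w : EuclideanSpace ℝ (Fin n) → ℝ} (hw : Measurable w)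
    (x : EuclideanSpace ℝ (Fin n)) :
    rieszPotential n α (fun y => ENNReal.ofReal (|v y| ^ p)) x ≤
      rieszPotential n α (fun y => ENNReal.ofReal (|w y| ^ p)) x +
      rieszPotential n α (fun y => ENNReal.ofReal |(|v y| ^ p - |w y| ^ p)|) x := by
  rw [← rieszPotential_add (by fun_prop)]
  exact rieszPotential_mono (Eventually.of_forall fun y => ofReal_le_add_ofReal_abs_sub _ _) x

lemma hartree_le_add_hartreeDiff {v w : EuclideanSpace ℝ (Fin n) → ℝ}
    (hw : Measurable w) (x : EuclideanSpace ℝ (Fin n)) :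
    hartree n α p q v x ≤ hartree n α p q w x + hartreeDiff n α p q v w x := by
  unfold hartree hartreeDiff
  have h1 := rieszPotential_le_add_diff (α := α) (p := p) (v := v) hw x
  have h2 := ofReal_le_add_ofReal_abs_sub (|v x| ^ q) (|w x| ^ q)
  refine (mul_le_mul_left h1 _).trans ?_
  rw [add_mul]
  refine (add_le_add_left (mul_le_mul_right h2 _) _).trans_eq ?_
  ring

lemma hartree_le_add_hartreeDiff' {v w : EuclideanSpace ℝ (Fin n) → ℝ}
    (hv : Measurable v) (x : EuclideanSpace ℝ (Fin n)) :
    hartree n α p q w x ≤ hartree n α p q v x + hartreeDiff n α p q v w x := by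
  unfold hartree hartreeDiff
  have h1 := rieszPotential_le_add_diff (α := α) (p := p) (v := w) hv x
  have h2 := ofReal_le_add_ofReal_abs_sub (|w x| ^ q) (|v x| ^ q)
  simp_rw [fun y => abs_sub_comm (|w y| ^ p) (|v y| ^ p)] at h1
  rw [abs_sub_comm (|w x| ^ q)] at h2
  refine (mul_le_mul_right h2 _).trans ?_
  rw [mul_add]
  refine (add_le_add_left (mul_le_mul_left h1 _) _).trans_eq ?_
  ring

lemma hartree_congr {v w : EuclideanSpace ℝ (Fin n) → ℝ} (h : v =ᵐ[volume] w) :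
    hartree n α p q v =ᵐ[volume] hartree n α p q w := by
  filter_upwards [h] with x hx
  unfold hartree
  rw [hx, rieszPotential_congr (f := fun y => ENNReal.ofReal (|v y| ^ p))
    (g := fun y => ENNReal.ofReal (|w y| ^ p)) (h.mono fun y hy => by simp only [hy])]

lemma measurable_uncurry_hartree {X : Type*} [MeasurableSpace X]
    {v : X → EuclideanSpace ℝ (Fin n) → ℝ} (hv : Measurable (Function.uncurry v)) :
    Measurable (Function.uncurry fun a => hartree n α p q (v a)) := by
  unfold hartree
  refine Measurable.mul (measurable_uncurry_rieszPotential
    (f := fun a y => ENNReal.ofReal (|v a y| ^ p)) ?_) ?_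
  · unfold Function.uncurry at hv ⊢
    fun_prop
  · unfold Function.uncurry at hv
    fun_prop

lemma measurable_uncurry_hartreeDiff {X : Type*} [MeasurableSpace X]
    {v w : X → EuclideanSpace ℝ (Fin n) → ℝ} (hv : Measurable (Function.uncurry v))
    (hw : Measurable (Function.uncurry w)) :
    Measurable (Function.uncurry fun a => hartreeDiff n α p q (v a) (w a)) := by
  unfold hartreeDiff
  refine Measurable.add (Measurable.mul (measurable_uncurry_rieszPotential
    (f := fun a y => ENNReal.ofReal |(|v a y| ^ p - |w a y| ^ p)|) ?_) ?_)
    (Measurable.mul (measurable_uncurry_rieszPotential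
    (f := fun a y => ENNReal.ofReal (|w a y| ^ p)) ?_) ?_)
  all_goals
    unfold Function.uncurry at *
    fun_prop

lemma NormBd.div_scale (hs : 0 ≤ s) {v : EuclideanSpace ℝ (Fin n) → ℝ} {M : ℝ} (hM : 0 < M)
    (hv : NormBd s (ENNReal.ofReal M) (fun x => ‖v x‖ₑ)) :
    NormBd s 1 (fun x => ENNReal.ofReal (|v x| / M)) := by
  have h := hv.const_mul hs (k := ENNReal.ofReal M⁻¹) ENNReal.ofReal_ne_top
  rw [← ENNReal.ofReal_mul (by positivity), inv_mul_cancel₀ hM.ne', ENNReal.ofReal_one] at h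
  refine h.of_le hs (Eventually.of_forall fun x => le_of_eq ?_)
  rw [← ofReal_norm, ← ENNReal.ofReal_mul (by positivity), Real.norm_eq_abs]
  congr 1
  rw [div_eq_inv_mul]

lemma NormBd.ae_abs_le {v : EuclideanSpace ℝ (Fin n) → ℝ} {M : ℝ} (hM : 0 ≤ M)
    (hv : NormBd s (ENNReal.ofReal M) (fun x => ‖v x‖ₑ)) : ∀ᵐ x, |v x| ≤ M := by
  refine hv.ae_le.mono fun x hx => ?_
  rw [← ofReal_norm, Real.norm_eq_abs] at hx
  exact (ENNReal.ofReal_le_ofReal_iff hM).1 hx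

/-- The nonlinearity is bounded and locally Lipschitz on `L^s ∩ L^∞`. -/
theorem exists_hartree_bounds [NeZero n] (hα : 0 < α) (hαn : α < n) (hp : 1 ≤ p)
    (hq : 1 ≤ q) (hs : 1 ≤ s) (hsp : s < n * p / α) :
    ∃ Λ : ℝ, 0 < Λ ∧
      (∀ (M : ℝ) (v : EuclideanSpace ℝ (Fin n) → ℝ), 0 < M → Measurable v →
        NormBd s (ENNReal.ofReal M) (fun x => ‖v x‖ₑ) →
        NormBd s (ENNReal.ofReal (Λ * M ^ (p + q))) (hartree n α p q v)) ∧
      (∀ (M η : ℝ) (v w : EuclideanSpace ℝ (Fin n) → ℝ), 0 < M → 0 < η → Measurable v →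
        Measurable w → NormBd s (ENNReal.ofReal M) (fun x => ‖v x‖ₑ) →
        NormBd s (ENNReal.ofReal M) (fun x => ‖w x‖ₑ) →
        NormBd s (ENNReal.ofReal η) (fun x => ‖v x - w x‖ₑ) →
        NormBd s (ENNReal.ofReal (Λ * M ^ (p + q - 1) * η)) (hartreeDiff n α p q v w)) := by
  have hp0 : 0 < p := by linarith
  have hq0 : 0 < q := by linarith
  have hs0 : 0 ≤ s := by linarith
  obtain ⟨C, hC, hR⟩ := exists_rieszPotential_bound (n := n) hα hαn hp0 hsp
  have hRp : ∀ (M : ℝ) (v : EuclideanSpace ℝ (Fin n) → ℝ), 0 < M → Measurable v →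
      NormBd s (ENNReal.ofReal M) (fun x => ‖v x‖ₑ) → ∀ x,
      rieszPotential n α (fun y => ENNReal.ofReal ((|v y| / M) ^ p)) x ≤ ENNReal.ofReal C := by
    intro M v hM hv hvM x
    have h := hR _ (by fun_prop) (hvM.div_scale hs0 hM) x
    simpa only [ENNReal.ofReal_rpow_of_nonneg (div_nonneg (abs_nonneg (v _)) hM.le) hp0.le] using h
  have hRM : ∀ (M : ℝ) (v : EuclideanSpace ℝ (Fin n) → ℝ), 0 < M → Measurable v →
      NormBd s (ENNReal.ofReal M) (fun x => ‖v x‖ₑ) → ∀ x,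
      rieszPotential n α (fun y => ENNReal.ofReal (|v y| ^ p)) x ≤
        ENNReal.ofReal (C * M ^ p) := by
    intro M v hM hv hvM x
    have e : (fun y => ENNReal.ofReal (|v y| ^ p)) =
        fun y => ENNReal.ofReal (M ^ p) * ENNReal.ofReal ((|v y| / M) ^ p) := by
      funext y
      rw [← ENNReal.ofReal_mul (by positivity), Real.div_rpow (abs_nonneg _) hM.le]
      congr 1
      field_simp
    rw [e, rieszPotential_const_mul ENNReal.ofReal_ne_top, mul_comm C,
      ENNReal.ofReal_mul (by positivity)]
    gcongr
    exact hRp M v hM hv hvM x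
  have hpow : ∀ M : ℝ, 0 < M → M ^ (p + q - 1) = M ^ p * M ^ (q - 1) := by
    intro M hM
    rw [← Real.rpow_add hM]; congr 1; ring
  -- All but one power of `|a|` is bounded by `M`; the remaining linear factor lets the product
  -- inherit the `L^s` bound of `v`.
  have hqpow : ∀ (M a : ℝ), 0 < M → |a| ≤ M → |a| ^ q ≤ M ^ (q - 1) * |a| := by
    intro M a hM ha
    rcases (abs_nonneg a).eq_or_lt with h | h
    · rw [← h, Real.zero_rpow hq0.ne', mul_zero]
    · calc |a| ^ q = |a| ^ (q - 1) * |a| := by rw [← Real.rpow_add_one h.ne', sub_add_cancel]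
        _ ≤ _ := by gcongr
  -- The three terms of `abs_rpow_sub_rpow_le_of_scale` inside the potential give `3 * p`; the
  -- difference of the `q`-th powers gives `q`.
  refine ⟨C * (3 * p + q) , by positivity, ?_, ?_⟩
  · intro M v hM hv hvM
    have h := hvM.const_mul hs0 (k := ENNReal.ofReal (C * M ^ p * M ^ (q - 1)))
      ENNReal.ofReal_ne_top
    rw [← ENNReal.ofReal_mul (by positivity)] at h
    refine (h.mono hs0 (ENNReal.ofReal_le_ofReal ?_)).of_le hs0 ?_
    · have e : M ^ (p + q) = M ^ p * M ^ (q - 1) * M := by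
        rw [← hpow M hM, ← Real.rpow_add_one hM.ne', sub_add_cancel]
      rw [e]
      have : (1 : ℝ) ≤ 3 * p + q := by linarith
      have h2 : C * 1 * (M ^ p * M ^ (q - 1) * M) ≤ C * (3 * p + q) *
        (M ^ p * M ^ (q - 1) * M) := by gcongr
      linarith
    · filter_upwards [hvM.ae_abs_le hM.le] with x hx
      unfold hartree
      calc _ ≤ ENNReal.ofReal (C * M ^ p) * ENNReal.ofReal (M ^ (q - 1) * |v x|) :=
            mul_le_mul' (hRM M v hM hv hvM x) (ENNReal.ofReal_le_ofReal (hqpow M _ hM hx))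
        _ = _ := by
            rw [← ofReal_norm, Real.norm_eq_abs, ← ENNReal.ofReal_mul (by positivity),
              ← ENNReal.ofReal_mul (by positivity)]
            congr 1; ring
  · intro M η v w hM hη hv hw hvM hwM hvw
    have hRd : ∀ x, rieszPotential n α (fun y => ENNReal.ofReal |(|v y| ^ p - |w y| ^ p)|) x
        ≤ ENNReal.ofReal (p * M ^ (p - 1) * η * (C + C + C)) := by
      intro x
      calc _ ≤ rieszPotential n α (fun y => ENNReal.ofReal (p * M ^ (p - 1) * η) *
            (ENNReal.ofReal ((|v y| / M) ^ p) + ENNReal.ofReal ((|w y| / M) ^ p) +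
              ENNReal.ofReal ((|v y - w y| / η) ^ p))) x := by
            refine rieszPotential_mono (Eventually.of_forall fun y => ?_) x
            rw [← ENNReal.ofReal_add (by positivity) (by positivity),
              ← ENNReal.ofReal_add (by positivity) (by positivity),
              ← ENNReal.ofReal_mul (by positivity)]
            exact ENNReal.ofReal_le_ofReal (abs_rpow_sub_rpow_le_of_scale hp hM hη)
        _ = ENNReal.ofReal (p * M ^ (p - 1) * η) *
            (rieszPotential n α (fun y => ENNReal.ofReal ((|v y| / M) ^ p)) x +
            rieszPotential n α (fun y => ENNReal.ofReal ((|w y| / M) ^ p)) x +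
            rieszPotential n α (fun y => ENNReal.ofReal ((|v y - w y| / η) ^ p)) x) := by
            rw [rieszPotential_const_mul ENNReal.ofReal_ne_top, rieszPotential_add (by fun_prop),
              rieszPotential_add (by fun_prop)]
        _ ≤ ENNReal.ofReal (p * M ^ (p - 1) * η) *
            (ENNReal.ofReal C + ENNReal.ofReal C + ENNReal.ofReal C) := by
            gcongr
            · exact hRp M v hM hv hvM x
            · exact hRp M w hM hw hwM x
            · exact hRp η (fun y => v y - w y) hη (hv.sub hw) hvw x
        _ = _ := by
            rw [← ENNReal.ofReal_add (by positivity) (by positivity),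
              ← ENNReal.ofReal_add (by positivity) (by positivity),
              ← ENNReal.ofReal_mul (by positivity)]
    have h1 := hvM.const_mul hs0
      (k := ENNReal.ofReal (p * M ^ (p - 1) * η * (C + C + C) * M ^ (q - 1)))
      ENNReal.ofReal_ne_top
    have h2 := hvw.const_mul hs0 (k := ENNReal.ofReal (C * M ^ p * (q * M ^ (q - 1))))
      ENNReal.ofReal_ne_top
    rw [← ENNReal.ofReal_mul (by positivity)] at h1 h2
    have h3 := h1.add hs h2 (by fun_prop) (by fun_prop)
    rw [← ENNReal.ofReal_add (by positivity) (by positivity)] at h3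
    refine (h3.mono hs0 (ENNReal.ofReal_le_ofReal (le_of_eq ?_))).of_le hs0 ?_
    · have e : M ^ p = M ^ (p - 1) * M := by rw [← Real.rpow_add_one hM.ne', sub_add_cancel]
      rw [hpow M hM, e]; ring
    · filter_upwards [hvM.ae_abs_le hM.le, hwM.ae_abs_le hM.le] with x hx hx'
      unfold hartreeDiff
      refine add_le_add ?_ ?_
      · calc _ ≤ ENNReal.ofReal (p * M ^ (p - 1) * η * (C + C + C)) *
              ENNReal.ofReal (M ^ (q - 1) * |v x|) :=
            mul_le_mul' (hRd x) (ENNReal.ofReal_le_ofReal (hqpow M _ hM hx))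
          _ = _ := by
            rw [← ofReal_norm, Real.norm_eq_abs, ← ENNReal.ofReal_mul (by positivity),
              ← ENNReal.ofReal_mul (by positivity)]
            congr 1; ring
      · calc _ ≤ ENNReal.ofReal (C * M ^ p) * ENNReal.ofReal (q * M ^ (q - 1) * |v x - w x|) := by
              refine mul_le_mul' (hRM M w hM hw hwM x) (ENNReal.ofReal_le_ofReal ?_)
              refine (abs_rpow_sub_rpow_le hq).trans ?_
              have : max |v x| |w x| ≤ M := max_le hx hx'
              have h0 : 0 ≤ max |v x| |w x| := (abs_nonneg _).trans (le_max_left _ _)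
              have h5 : 0 ≤ q - 1 := by linarith
              gcongr
          _ = _ := by
            rw [← ofReal_norm, Real.norm_eq_abs, ← ENNReal.ofReal_mul (by positivity),
              ← ENNReal.ofReal_mul (by positivity)]
            congr 1; ring

end Nonlinearity

/-! ### The semigroup on real functions and its strong continuity in `L^s`. -/

section HeatReal

variable {n : ℕ} {β s : ℝ}

/-- The fractional heat semigroup acting on real functions. -/
noncomputable def heatReal (n : ℕ) (β t : ℝ) (f : EuclideanSpace ℝ (Fin n) → ℝ)
    (x : EuclideanSpace ℝ (Fin n)) : ℝ :=
  ∫ y, fracHeatKernel n β t (x - y) * f y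

variable {f g : EuclideanSpace ℝ (Fin n) → ℝ}

lemma integrable_fracHeatKernel_mul [NeZero n] (hβ : 0 < β) (hβ2 : β ≤ 2) {t : ℝ} (ht : 0 < t)
    (hf : AEStronglyMeasurable f) {c : ℝ} (hc : ∀ᵐ y, |f y| ≤ c) (x : EuclideanSpace ℝ (Fin n)) :
    Integrable (fun y => fracHeatKernel n β t (x - y) * f y) :=
  ((integrable_fracHeatKernel hβ hβ2 ht).comp_sub_left x).mul_bdd hf hc

lemma heatReal_congr {t : ℝ} (h : f =ᵐ[volume] g) (x : EuclideanSpace ℝ (Fin n)) :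
    heatReal n β t f x = heatReal n β t g x :=
  integral_congr_ae (h.mono fun y hy => by simp only [hy])

lemma measurable_uncurry_heatReal (hf : Measurable f) :
    Measurable (Function.uncurry fun t => heatReal n β t f) := by
  have hK : Measurable fun z : (ℝ × EuclideanSpace ℝ (Fin n)) × EuclideanSpace ℝ (Fin n) =>
      fracHeatKernel n β z.1.1 (z.1.2 - z.2) :=
    measurable_fracHeatKernel_comp
      (f := fun z : (ℝ × EuclideanSpace ℝ (Fin n)) × EuclideanSpace ℝ (Fin n) => z.1.1)
      (g := fun z => z.1.2 - z.2) (by fun_prop) (by fun_prop)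
  have hm : Measurable fun z : (ℝ × EuclideanSpace ℝ (Fin n)) × EuclideanSpace ℝ (Fin n) =>
      fracHeatKernel n β z.1.1 (z.1.2 - z.2) * f z.2 := hK.mul (hf.comp measurable_snd)
  have h : Measurable fun z : ℝ × EuclideanSpace ℝ (Fin n) =>
      ∫ y, fracHeatKernel n β z.1 (z.2 - y) * f y :=
    (hm.stronglyMeasurable.integral_prod_right' (ν := volume)).measurable
  simp only [Function.uncurry_def, heatReal]
  exact h

lemma measurable_heatReal (hf : Measurable f) (t : ℝ) : Measurable (heatReal n β t f) :=
  (measurable_uncurry_heatReal (β := β) hf).comp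
    (g := Function.uncurry fun t => heatReal n β t f) (f := fun x => (t, x))
    (measurable_const.prodMk measurable_id)

lemma enorm_heatReal_le [NeZero n] (hβ : 0 < β) (hβ2 : β ≤ 2) {t : ℝ} (ht : 0 < t)
    (f : EuclideanSpace ℝ (Fin n) → ℝ) (x : EuclideanSpace ℝ (Fin n)) :
    ‖heatReal n β t f x‖ₑ ≤ heatOp n β t (fun y => ‖f y‖ₑ) x := by
  refine (enorm_integral_le_lintegral_enorm _).trans_eq (lintegral_congr fun y => ?_)
  rw [enorm_mul, Real.enorm_of_nonneg (fracHeatKernel_nonneg hβ hβ2 ht _)]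

lemma NormBd.heatReal [NeZero n] (hs : 1 ≤ s) (hβ : 0 < β) (hβ2 : β ≤ 2) {t : ℝ} (ht : 0 < t)
    (hf : Measurable f) {c : ℝ≥0∞} (h : NormBd s c (fun y => ‖f y‖ₑ)) :
    NormBd s c (fun y => ‖heatReal n β t f y‖ₑ) :=
  (h.heatOp hs hβ hβ2 ht (by fun_prop)).of_le (by linarith)
    (Eventually.of_forall fun x => enorm_heatReal_le hβ hβ2 ht f x)

lemma eLpNorm_heatReal_le [NeZero n] (hs : 1 ≤ s) (hβ : 0 < β) (hβ2 : β ≤ 2) {t : ℝ} (ht : 0 < t)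
    (hf : Measurable f) :
    eLpNorm (heatReal n β t f) (ENNReal.ofReal s) volume ≤
      eLpNorm f (ENNReal.ofReal s) volume := by
  have hs0 : 0 < s := by linarith
  rw [eLpNorm_eq_lintegral_rpow_enorm_toReal (by simpa using hs0) ENNReal.ofReal_ne_top,
    eLpNorm_eq_lintegral_rpow_enorm_toReal (by simpa using hs0) ENNReal.ofReal_ne_top,
    ENNReal.toReal_ofReal hs0.le]
  refine ENNReal.rpow_le_rpow ?_ (by positivity)
  calc ∫⁻ x, ‖heatReal n β t f x‖ₑ ^ s
      ≤ ∫⁻ x, heatOp n β t (fun y => ‖f y‖ₑ ^ s) x := by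
        refine lintegral_mono fun x => ?_
        have h := lintegral_mul_rpow_le (ν := volume) hs (h := fun y => ‖f y‖ₑ) (by fun_prop)
          (measurable_heatKer_sub_right (n := n) (β := β) t x).aemeasurable
        rw [lintegral_fracHeatKernel_sub_left hβ hβ2 ht, ENNReal.one_rpow, one_mul] at h
        refine (ENNReal.rpow_le_rpow (enorm_heatReal_le hβ hβ2 ht f x) hs0.le).trans ?_
        simpa only [heatOp, mul_comm] using h
    _ = _ := lintegral_heatOp hβ hβ2 ht (by fun_prop)

lemma heatReal_sub [NeZero n] (hβ : 0 < β) (hβ2 : β ≤ 2) {t : ℝ} (ht : 0 < t)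
    (hf : AEStronglyMeasurable f) (hg : AEStronglyMeasurable g) {c d : ℝ} (hc : ∀ᵐ y, |f y| ≤ c)
    (hd : ∀ᵐ y, |g y| ≤ d) (x : EuclideanSpace ℝ (Fin n)) :
    heatReal n β t (fun y => f y - g y) x = heatReal n β t f x - heatReal n β t g x := by
  unfold heatReal
  simp_rw [mul_sub]
  exact integral_sub (integrable_fracHeatKernel_mul hβ hβ2 ht hf hc x)
    (integrable_fracHeatKernel_mul hβ hβ2 ht hg hd x)

lemma heatReal_add [NeZero n] (hβ : 0 < β) (hβ2 : β ≤ 2) {t : ℝ} (ht : 0 < t)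
    (hf : AEStronglyMeasurable f) (hg : AEStronglyMeasurable g) {c d : ℝ} (hc : ∀ᵐ y, |f y| ≤ c)
    (hd : ∀ᵐ y, |g y| ≤ d) (x : EuclideanSpace ℝ (Fin n)) :
    heatReal n β t (fun y => f y + g y) x = heatReal n β t f x + heatReal n β t g x := by
  unfold heatReal
  simp_rw [mul_add]
  exact integral_add (integrable_fracHeatKernel_mul hβ hβ2 ht hf hc x)
    (integrable_fracHeatKernel_mul hβ hβ2 ht hg hd x)

lemma heatReal_toReal [NeZero n] (hβ : 0 < β) (hβ2 : β ≤ 2) {t : ℝ} (ht : 0 < t)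
    {F : EuclideanSpace ℝ (Fin n) → ℝ≥0∞} (hF : AEMeasurable F) (hfin : ∀ᵐ y, F y < ∞)
    (x : EuclideanSpace ℝ (Fin n)) :
    heatReal n β t (fun y => (F y).toReal) x = (heatOp n β t F x).toReal := by
  unfold heatReal heatOp
  rw [← integral_toReal (f := fun y => ENNReal.ofReal (fracHeatKernel n β t (x - y)) * F y)
    ((measurable_heatKer_sub_right t x).aemeasurable.mul hF)
    (hfin.mono fun y hy => ENNReal.mul_lt_top ENNReal.ofReal_lt_top hy)]
  refine integral_congr_ae (Eventually.of_forall fun y => ?_)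
  simp only
  rw [ENNReal.toReal_mul, ENNReal.toReal_ofReal (fracHeatKernel_nonneg hβ hβ2 ht _)]

lemma heatOp_le_of_ae_le [NeZero n] (hβ : 0 < β) (hβ2 : β ≤ 2) {t : ℝ} (ht : 0 < t)
    {F : EuclideanSpace ℝ (Fin n) → ℝ≥0∞} {c : ℝ≥0∞} (hF : ∀ᵐ y, F y ≤ c)
    (x : EuclideanSpace ℝ (Fin n)) : heatOp n β t F x ≤ c :=
  (heatOp_mono hF x).trans_eq (heatOp_const hβ hβ2 ht c x)

/-- Splitting `f` into positive and negative parts reduces the law to `heatOp_heatOp`, where Tonelli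
applies; boundedness makes both parts finite. -/
lemma heatReal_heatReal [NeZero n] (hβ : 0 < β) (hβ2 : β ≤ 2) {t r : ℝ} (ht : 0 < t) (hr : 0 < r)
    (hf : Measurable f) {c : ℝ} (hc : ∀ᵐ y, |f y| ≤ c) (x : EuclideanSpace ℝ (Fin n)) :
    heatReal n β t (heatReal n β r f) x = heatReal n β (t + r) f x := by
  set P : EuclideanSpace ℝ (Fin n) → ℝ≥0∞ := fun y => ENNReal.ofReal (f y)
  set N : EuclideanSpace ℝ (Fin n) → ℝ≥0∞ := fun y => ENNReal.ofReal (-f y)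
  have hPm : Measurable P := by fun_prop
  have hNm : Measurable N := by fun_prop
  have hPc : ∀ᵐ y, P y ≤ ENNReal.ofReal c := hc.mono fun y hy =>
    ENNReal.ofReal_le_ofReal ((le_abs_self _).trans hy)
  have hNc : ∀ᵐ y, N y ≤ ENNReal.ofReal c := hc.mono fun y hy =>
    ENNReal.ofReal_le_ofReal ((neg_le_abs _).trans hy)
  have bdd : ∀ {F : EuclideanSpace ℝ (Fin n) → ℝ≥0∞}, (∀ᵐ y, F y ≤ ENNReal.ofReal c) →
      ∀ᵐ y, |(F y).toReal| ≤ (ENNReal.ofReal c).toReal := fun h => h.mono fun y hy => by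
    rw [abs_of_nonneg ENNReal.toReal_nonneg]
    exact ENNReal.toReal_mono ENNReal.ofReal_ne_top hy
  have fin : ∀ {F : EuclideanSpace ℝ (Fin n) → ℝ≥0∞}, (∀ᵐ y, F y ≤ ENNReal.ofReal c) →
      ∀ᵐ y, F y < ∞ := fun h => h.mono fun y hy => hy.trans_lt ENNReal.ofReal_lt_top
  have decomp : ∀ {r : ℝ}, 0 < r → ∀ y, heatReal n β r f y =
      (heatOp n β r P y).toReal - (heatOp n β r N y).toReal := by
    intro r hr y
    rw [← heatReal_toReal hβ hβ2 hr hPm.aemeasurable (fin hPc),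
      ← heatReal_toReal hβ hβ2 hr hNm.aemeasurable (fin hNc),
      ← heatReal_sub hβ hβ2 hr hPm.ennreal_toReal.aestronglyMeasurable
        hNm.ennreal_toReal.aestronglyMeasurable (bdd hPc) (bdd hNc)]
    refine heatReal_congr (Eventually.of_forall fun z => ?_) y
    simp only [P, N]
    rw [ENNReal.toReal_ofReal', ENNReal.toReal_ofReal', max_zero_sub_eq_self]
  have hP2 : ∀ᵐ y, heatOp n β r P y ≤ ENNReal.ofReal c :=
    Eventually.of_forall (heatOp_le_of_ae_le hβ hβ2 hr hPc)
  have hN2 : ∀ᵐ y, heatOp n β r N y ≤ ENNReal.ofReal c :=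
    Eventually.of_forall (heatOp_le_of_ae_le hβ hβ2 hr hNc)
  have hPm2 := measurable_heatOp (β := β) r hPm
  have hNm2 := measurable_heatOp (β := β) r hNm
  rw [funext (decomp hr), heatReal_sub hβ hβ2 ht hPm2.ennreal_toReal.aestronglyMeasurable
    hNm2.ennreal_toReal.aestronglyMeasurable (bdd hP2) (bdd hN2),
    heatReal_toReal hβ hβ2 ht hPm2.aemeasurable (fin hP2),
    heatReal_toReal hβ hβ2 ht hNm2.aemeasurable (fin hN2),
    heatOp_heatOp hβ hβ2 ht hr hPm.aemeasurable, heatOp_heatOp hβ hβ2 ht hr hNm.aemeasurable,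
    decomp (add_pos ht hr)]

lemma lintegral_comp_smul_euclidean {σ : ℝ} (hσ : 0 < σ)
    {F : EuclideanSpace ℝ (Fin n) → ℝ≥0∞} (hF : Measurable F) :
    ∫⁻ z, F (σ • z) = ENNReal.ofReal ((σ ^ n)⁻¹) * ∫⁻ z, F z := by
  have h := Measure.map_addHaar_smul (volume : Measure (EuclideanSpace ℝ (Fin n))) hσ.ne'
  rw [← lintegral_map hF (measurable_const_smul σ), h, lintegral_smul_measure,
    finrank_euclideanSpace, Fintype.card_fin, abs_of_pos (by positivity), smul_eq_mul]

/-- The kernel is an approximate identity: by scaling, the integral is that of the fixed kernel at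
time one against `ω (h ^ (1 / β) • z)`, and dominated convergence concludes. -/
lemma tendsto_lintegral_fracHeatKernel_mul [NeZero n] (hβ : 0 < β) (hβ2 : β ≤ 2)
    {ω : EuclideanSpace ℝ (Fin n) → ℝ≥0∞} (hω : Measurable ω) {W : ℝ≥0∞} (hW : W ≠ ∞)
    (hωW : ∀ z, ω z ≤ W) (h0 : Tendsto ω (𝓝 0) (𝓝 0)) :
    Tendsto (fun h : ℝ => ∫⁻ z, ENNReal.ofReal (fracHeatKernel n β h z) * ω z) (𝓝[>] 0) (𝓝 0) := by
  have e : ∀ᶠ h : ℝ in 𝓝[>] 0, ∫⁻ z, ENNReal.ofReal (fracHeatKernel n β 1 z) *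
      ω ((h ^ (1 / β)) • z) = ∫⁻ z, ENNReal.ofReal (fracHeatKernel n β h z) * ω z := by
    filter_upwards [self_mem_nhdsWithin] with h (hh : 0 < h)
    set σ := h ^ (1 / β) with hσ
    have hσ0 : 0 < σ := Real.rpow_pos_of_pos hh _
    have hσβ : σ ^ β = h := by
      rw [hσ, ← Real.rpow_mul hh.le, one_div_mul_cancel hβ.ne', Real.rpow_one]
    have h1 := lintegral_comp_smul_euclidean (n := n) hσ0
      (F := fun z => ENNReal.ofReal (fracHeatKernel n β h z) * ω z)
      ((ENNReal.measurable_ofReal.comp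
        (measurable_fracHeatKernel_comp measurable_const measurable_id)).mul hω)
    have h2 : ∀ z, ENNReal.ofReal (fracHeatKernel n β h (σ • z)) =
        ENNReal.ofReal ((σ ^ n)⁻¹) * ENNReal.ofReal (fracHeatKernel n β 1 z) := by
      intro z
      have := fracHeatKernel_scaling (n := n) (β := β) hσ0 1 (σ • z)
      rw [mul_one, hσβ, inv_smul_smul₀ hσ0.ne'] at this
      rw [this, ENNReal.ofReal_mul (by positivity)]
    simp_rw [h2, mul_assoc] at h1
    rw [lintegral_const_mul' _ _ ENNReal.ofReal_ne_top] at h1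
    exact (ENNReal.mul_right_inj (by simpa using pow_pos hσ0 n) ENNReal.ofReal_ne_top).1 h1
  refine Tendsto.congr' e ?_
  have hK : Measurable fun z : EuclideanSpace ℝ (Fin n) =>
      ENNReal.ofReal (fracHeatKernel n β 1 z) := ENNReal.measurable_ofReal.comp
        (measurable_fracHeatKernel_comp measurable_const measurable_id)
  have h := tendsto_lintegral_filter_of_dominated_convergence (μ := volume) (l := 𝓝[>] (0 : ℝ))
    (F := fun (h : ℝ) z => ENNReal.ofReal (fracHeatKernel n β 1 z) * ω ((h ^ (1 / β)) • z))
    (f := fun _ => 0) (fun z => ENNReal.ofReal (fracHeatKernel n β 1 z) * W)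
    (Eventually.of_forall fun h => hK.mul (hω.comp (measurable_const_smul _)))
    (Eventually.of_forall fun h => Eventually.of_forall fun z => by gcongr; exact hωW _) ?_
    (Eventually.of_forall fun z => ?_)
  · simpa using h
  · rw [lintegral_mul_const _ hK, lintegral_fracHeatKernel hβ hβ2 one_pos, one_mul]
    exact hW
  · have h1 : Tendsto (fun h : ℝ => (h ^ (1 / β)) • z) (𝓝[>] 0) (𝓝 0) := by
      have h2 : Tendsto (fun h : ℝ => h ^ (1 / β)) (𝓝[>] 0) (𝓝 0) := by
        have := (Real.continuousAt_rpow_const 0 (1 / β) (Or.inr (by positivity))).tendsto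
        rw [Real.zero_rpow (by positivity)] at this
        exact this.mono_left nhdsWithin_le_nhds
      simpa using h2.smul_const z
    have h3 := ENNReal.Tendsto.const_mul (h0.comp h1)
      (Or.inr (ENNReal.ofReal_ne_top (r := fracHeatKernel n β 1 z)))
    simpa using h3

/-- Continuity of translations in `L^s`. -/
lemma tendsto_eLpNorm_translate_sub (hs : 1 ≤ s) (hf : MemLp f (ENNReal.ofReal s) volume) :
    Tendsto (fun z => eLpNorm (fun x => f (x - z) - f x) (ENNReal.ofReal s) volume) (𝓝 0)
      (𝓝 0) := by
  have : Fact (1 ≤ ENNReal.ofReal s) := ⟨by simpa using hs⟩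
  set F : C(EuclideanSpace ℝ (Fin n), C(EuclideanSpace ℝ (Fin n), EuclideanSpace ℝ (Fin n))) :=
    ContinuousMap.curry ⟨fun z : EuclideanSpace ℝ (Fin n) × EuclideanSpace ℝ (Fin n) => z.2 - z.1,
      by fun_prop⟩ with hF
  have hFm : ∀ z, MeasurePreserving (F z) volume volume := fun z =>
    measurePreserving_sub_right volume z
  have h1 := Continuous.compMeasurePreservingLp (g := F) (f := fun _ => hf.toLp f)
    continuous_const F.continuous hFm ENNReal.ofReal_ne_top
  have h2 := (h1.edist (continuous_const (y := hf.toLp f))).tendsto 0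
  have e : ∀ z, edist (Lp.compMeasurePreserving (F z) (hFm z) (hf.toLp f)) (hf.toLp f)
      = eLpNorm (fun x => f (x - z) - f x) (ENNReal.ofReal s) volume := by
    intro z
    rw [Lp.edist_def]
    refine eLpNorm_congr_ae ?_
    have a1 := Lp.coeFn_compMeasurePreserving (hf.toLp f) (hFm z)
    have a2 := hf.coeFn_toLp
    have a3 := (hFm z).quasiMeasurePreserving.ae_eq_comp a2
    filter_upwards [a1, a2, a3] with x h1 h2 h3
    simp only [Pi.sub_apply]
    rw [h1, h2, h3]
    rfl
  simp_rw [e] at h2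
  simpa using h2

/-- Strong continuity of the semigroup at time zero. -/
lemma tendsto_eLpNorm_heatReal_sub [NeZero n] (hs : 1 ≤ s) (hβ : 0 < β) (hβ2 : β ≤ 2)
    (hfm : Measurable f) (hf : MemLp f (ENNReal.ofReal s) volume) {c : ℝ}
    (hc : ∀ᵐ y, |f y| ≤ c) :
    Tendsto (fun h : ℝ => eLpNorm (fun x => heatReal n β h f x - f x) (ENNReal.ofReal s) volume)
      (𝓝[>] 0) (𝓝 0) := by
  have hs0 : 0 < s := by linarith
  have hsn : ENNReal.ofReal s ≠ 0 := by simpa using hs0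
  have hs1 : 1 ≤ ENNReal.ofReal s := by simpa using hs
  -- The `s`-th power of the `L^s` modulus of translation. Jensen and Tonelli bound the `s`-th power
  -- of the norm of `S_β(h) f - f` by the average of `ω` against the kernel at time `h`.
  set ω : EuclideanSpace ℝ (Fin n) → ℝ≥0∞ := fun z => ∫⁻ x, ‖f (x - z) - f x‖ₑ ^ s with hω
  have hωe : ∀ z, ω z = eLpNorm (fun x => f (x - z) - f x) (ENNReal.ofReal s) volume ^ s := by
    intro z
    rw [eLpNorm_eq_lintegral_rpow_enorm_toReal hsn ENNReal.ofReal_ne_top,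
      ENNReal.toReal_ofReal hs0.le, ← ENNReal.rpow_mul, one_div_mul_cancel hs0.ne',
      ENNReal.rpow_one]
  have hdm : Measurable fun w : EuclideanSpace ℝ (Fin n) × EuclideanSpace ℝ (Fin n) =>
      ‖f (w.2 - w.1) - f w.2‖ₑ ^ s := by fun_prop
  have hωm : Measurable ω := hdm.lintegral_prod_right'
  have hω0 : Tendsto ω (𝓝 0) (𝓝 0) := by
    have h1 := (tendsto_eLpNorm_translate_sub hs hf).ennrpow_const s
    rw [ENNReal.zero_rpow_of_pos hs0] at h1
    simpa only [← hωe] using h1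
  set W := (eLpNorm f (ENNReal.ofReal s) volume + eLpNorm f (ENNReal.ofReal s) volume) ^ s with hW
  have hWtop : W ≠ ∞ := ENNReal.rpow_ne_top_of_nonneg hs0.le
    (ENNReal.add_ne_top.2 ⟨hf.2.ne, hf.2.ne⟩)
  have hωW : ∀ z, ω z ≤ W := by
    intro z
    rw [hωe, hW]
    refine ENNReal.rpow_le_rpow ?_ hs0.le
    have h1 : eLpNorm (fun x => f (x - z)) (ENNReal.ofReal s) volume
        = eLpNorm f (ENNReal.ofReal s) volume :=
      eLpNorm_comp_measurePreserving hf.1 (measurePreserving_sub_right volume z)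
    have h2 := eLpNorm_sub_le (p := ENNReal.ofReal s) (μ := volume) (f := fun x => f (x - z))
      (g := f) (hfm.comp (measurable_id.sub_const z)).aestronglyMeasurable hf.1 hs1
    rw [h1] at h2
    exact h2
  have hlim := tendsto_lintegral_fracHeatKernel_mul hβ hβ2 hωm hWtop hωW hω0
  have hlim2 := hlim.ennrpow_const (1 / s)
  rw [ENNReal.zero_rpow_of_pos (by positivity)] at hlim2
  refine tendsto_of_tendsto_of_tendsto_of_le_of_le' tendsto_const_nhds hlim2
    (Eventually.of_forall fun _ => zero_le) ?_
  filter_upwards [self_mem_nhdsWithin] with h (hh : 0 < h)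
  rw [eLpNorm_eq_lintegral_rpow_enorm_toReal hsn ENNReal.ofReal_ne_top,
    ENNReal.toReal_ofReal hs0.le]
  refine ENNReal.rpow_le_rpow ?_ (by positivity)
  have hKm : Measurable fun z : EuclideanSpace ℝ (Fin n) =>
      ENNReal.ofReal (fracHeatKernel n β h z) := ENNReal.measurable_ofReal.comp
        (measurable_fracHeatKernel_comp measurable_const measurable_id)
  have hpt : ∀ x, ‖heatReal n β h f x - f x‖ₑ ^ s ≤
      ∫⁻ z, ENNReal.ofReal (fracHeatKernel n β h z) * ‖f (x - z) - f x‖ₑ ^ s := by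
    intro x
    have hint := integrable_fracHeatKernel_mul hβ hβ2 hh hfm.aestronglyMeasurable hc x
    have hint2 : Integrable fun z => fracHeatKernel n β h z * f (x - z) := by
      have := hint.comp_sub_left x
      simpa using this
    have h1 : heatReal n β h f x - f x =
        ∫ z, fracHeatKernel n β h z * (f (x - z) - f x) := by
      simp_rw [mul_sub]
      rw [integral_sub hint2 ((integrable_fracHeatKernel hβ hβ2 hh).mul_const _),
        integral_mul_const, integral_fracHeatKernel hβ hβ2 hh, one_mul, heatReal,
        ← integral_sub_left_eq_self _ volume x]
      simp
    have h2 : ‖heatReal n β h f x - f x‖ₑ ≤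
        ∫⁻ z, ‖f (x - z) - f x‖ₑ * ENNReal.ofReal (fracHeatKernel n β h z) := by
      rw [h1]
      refine (enorm_integral_le_lintegral_enorm _).trans_eq (lintegral_congr fun z => ?_)
      rw [enorm_mul, Real.enorm_of_nonneg (fracHeatKernel_nonneg hβ hβ2 hh _), mul_comm]
    have h3 := lintegral_mul_rpow_le (ν := volume) hs (h := fun z => ‖f (x - z) - f x‖ₑ)
      (by fun_prop) hKm.aemeasurable
    rw [lintegral_fracHeatKernel hβ hβ2 hh, ENNReal.one_rpow, one_mul] at h3
    refine (ENNReal.rpow_le_rpow h2 hs0.le).trans (h3.trans_eq ?_)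
    simp_rw [mul_comm]
  calc ∫⁻ x, ‖heatReal n β h f x - f x‖ₑ ^ s
      ≤ ∫⁻ x, ∫⁻ z, ENNReal.ofReal (fracHeatKernel n β h z) * ‖f (x - z) - f x‖ₑ ^ s :=
        lintegral_mono hpt
    _ = ∫⁻ z, ∫⁻ x, ENNReal.ofReal (fracHeatKernel n β h z) * ‖f (x - z) - f x‖ₑ ^ s := by
        rw [lintegral_lintegral_swap]
        exact ((hKm.comp measurable_snd).mul (hdm.comp measurable_swap)).aemeasurable
    _ = ∫⁻ z, ENNReal.ofReal (fracHeatKernel n β h z) * ω z := by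
        refine lintegral_congr fun z => ?_
        rw [lintegral_const_mul' _ _ ENNReal.ofReal_ne_top]

end HeatReal

/-! ### Bounded solutions: Duhamel estimates, restarting, continuity in time, uniqueness. -/

section BoundedSolutions

variable {n : ℕ} {α β p q s : ℝ}

/-- `Λ` is a bound and Lipschitz constant of the nonlinearity in `L^s ∩ L^∞`. -/
structure HartreeBounds (n : ℕ) (α p q s Λ : ℝ) : Prop where
  pos : 0 < Λ
  bound : ∀ (M : ℝ) (v : EuclideanSpace ℝ (Fin n) → ℝ), 0 < M → Measurable v →
    NormBd s (ENNReal.ofReal M) (fun x => ‖v x‖ₑ) →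
    NormBd s (ENNReal.ofReal (Λ * M ^ (p + q))) (hartree n α p q v)
  lipschitz : ∀ (M η : ℝ) (v w : EuclideanSpace ℝ (Fin n) → ℝ), 0 < M → 0 < η → Measurable v →
    Measurable w → NormBd s (ENNReal.ofReal M) (fun x => ‖v x‖ₑ) →
    NormBd s (ENNReal.ofReal M) (fun x => ‖w x‖ₑ) →
    NormBd s (ENNReal.ofReal η) (fun x => ‖v x - w x‖ₑ) →
    NormBd s (ENNReal.ofReal (Λ * M ^ (p + q - 1) * η)) (hartreeDiff n α p q v w)

/-- The Duhamel term of `u` started at time `a`. -/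
noncomputable abbrev duhamelFrom (n : ℕ) (α β p q a t : ℝ)
    (u : ℝ → EuclideanSpace ℝ (Fin n) → ℝ) : EuclideanSpace ℝ (Fin n) → ℝ≥0∞ :=
  heatInt n β a t (fun τ => hartree n α p q (u τ))

lemma NormBd.ae_eq_zero {f : EuclideanSpace ℝ (Fin n) → ℝ≥0∞} {c : ℕ → ℝ}
    (h : ∀ k, NormBd s (ENNReal.ofReal (c k)) f) (hc : Tendsto c atTop (𝓝 0)) :
    ∀ᵐ x, f x = 0 := by
  have h1 : ∀ᵐ x, ∀ k, f x ≤ ENNReal.ofReal (c k) := ae_all_iff.2 fun k => (h k).ae_le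
  filter_upwards [h1] with x hx
  have h2 := (ENNReal.continuous_ofReal.tendsto 0).comp hc
  rw [ENNReal.ofReal_zero] at h2
  exact le_antisymm (ge_of_tendsto h2 (Eventually.of_forall hx)) zero_le

/-- Fatou's lemma; only almost everywhere convergence is required. -/
lemma NormBd.of_tendsto {f : ℕ → EuclideanSpace ℝ (Fin n) → ℝ≥0∞}
    {g : EuclideanSpace ℝ (Fin n) → ℝ≥0∞} {c : ℝ≥0∞} (hfm : ∀ k, Measurable (f k))
    (h : ∀ k, NormBd s c (f k)) (hlim : ∀ᵐ x, Tendsto (fun k => f k x) atTop (𝓝 (g x))) :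
    NormBd s c g := by
  constructor
  · have h1 : ∀ᵐ x, ∀ k, f k x ≤ c := ae_all_iff.2 fun k => (h k).ae_le
    filter_upwards [h1, hlim] with x hx hx2
    exact le_of_tendsto hx2 (Eventually.of_forall hx)
  · calc ∫⁻ x, g x ^ s = ∫⁻ x, liminf (fun k => f k x ^ s) atTop := by
          refine lintegral_congr_ae (hlim.mono fun x hx => ?_)
          exact (hx.ennrpow_const s).liminf_eq.symm
      _ ≤ liminf (fun k => ∫⁻ x, f k x ^ s) atTop :=
          lintegral_liminf_le fun k => (hfm k).pow_const s
      _ ≤ c ^ s := liminf_le_of_le (by isBoundedDefault) fun b hb => by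
          obtain ⟨k, hk⟩ := hb.exists
          exact hk.trans (h k).lintegral_le

lemma NormBd.memLp (hs : 0 < s) {v : EuclideanSpace ℝ (Fin n) → ℝ} {c : ℝ≥0∞} (hc : c ≠ ∞)
    (hv : AEStronglyMeasurable v) (h : NormBd s c (fun x => ‖v x‖ₑ)) :
    MemLp v (ENNReal.ofReal s) volume :=
  ⟨hv, ((normBd_enorm_iff hs).1 h).2.trans_lt hc.lt_top⟩

/-- Subtraction on `[0,∞]` is truncated, so differences of nonlinearities are controlled by two
one-sided inequalities with a common majorant, which are converted here into a bound on a real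
difference. -/
lemma enorm_toReal_sub_toReal_le {a b g : ℝ≥0∞} (ha : a ≠ ∞) (hb : b ≠ ∞) (h1 : a ≤ b + g)
    (h2 : b ≤ a + g) : ‖a.toReal - b.toReal‖ₑ ≤ g := by
  by_cases hg : g = ∞
  · simp [hg]
  lift a to NNReal using ha
  lift b to NNReal using hb
  lift g to NNReal using hg
  have h1' : (a : ℝ) ≤ b + g := by exact_mod_cast h1
  have h2' : (b : ℝ) ≤ a + g := by exact_mod_cast h2
  rw [← ofReal_norm, Real.norm_eq_abs]
  simp only [ENNReal.coe_toReal]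
  rw [show (g : ℝ≥0∞) = ENNReal.ofReal (g : ℝ) by simp]
  exact ENNReal.ofReal_le_ofReal (abs_le.2 ⟨by linarith, by linarith⟩)

variable {Λ M a t : ℝ} {u v : ℝ → EuclideanSpace ℝ (Fin n) → ℝ}

lemma normBd_duhamelFrom [NeZero n] (hs : 1 ≤ s) (hβ : 0 < β) (hβ2 : β ≤ 2)
    (hΛ : HartreeBounds n α p q s Λ) (hM : 0 < M) (hu : Measurable (Function.uncurry u))
    (hbd : ∀ τ ∈ Ioo a t, NormBd s (ENNReal.ofReal M) (fun x => ‖u τ x‖ₑ)) :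
    NormBd s (ENNReal.ofReal ((Λ * M ^ (p + q)) * (t - a))) (duhamelFrom n α β p q a t u) := by
  have hL : 0 < Λ * M ^ (p + q) := mul_pos hΛ.pos (by positivity)
  have h := NormBd.heatInt (n := n) hs hβ hβ2 (measurable_uncurry_hartree (α := α) (p := p)
    (q := q) hu) (γ := fun _ => ENNReal.ofReal (Λ * M ^ (p + q))) measurable_const
    (fun _ => by simpa using hL) (fun _ => ENNReal.ofReal_ne_top) (a := a) (t := t)
    ((ae_restrict_mem measurableSet_Ioo).mono fun τ hτ =>
      hΛ.bound M (u τ) hM (hu.comp (measurable_const.prodMk measurable_id)) (hbd τ hτ))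
  rwa [setLIntegral_const, Real.volume_Ioo, ← ENNReal.ofReal_mul hL.le] at h

/-- The bound `η` on the difference may vary with time; uniqueness uses an exponential weight there.
-/
lemma normBd_duhamelFrom_sub [NeZero n] (hs : 1 ≤ s) (hβ : 0 < β) (hβ2 : β ≤ 2)
    (hΛ : HartreeBounds n α p q s Λ) (hM : 0 < M) (hu : Measurable (Function.uncurry u))
    (hv : Measurable (Function.uncurry v))
    (hubd : ∀ τ ∈ Ioo a t, NormBd s (ENNReal.ofReal M) (fun x => ‖u τ x‖ₑ))
    (hvbd : ∀ τ ∈ Ioo a t, NormBd s (ENNReal.ofReal M) (fun x => ‖v τ x‖ₑ))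
    {η : ℝ → ℝ} (hη : Measurable η) (hη0 : ∀ τ, 0 < η τ)
    (hd : ∀ τ ∈ Ioo a t, NormBd s (ENNReal.ofReal (η τ)) (fun x => ‖u τ x - v τ x‖ₑ)) :
    NormBd s (∫⁻ τ in Ioo a t, ENNReal.ofReal (Λ * M ^ (p + q - 1) * η τ))
      (fun x => ‖(duhamelFrom n α β p q a t u x).toReal -
        (duhamelFrom n α β p q a t v x).toReal‖ₑ) := by
  have hL : 0 < Λ * M ^ (p + q - 1) := mul_pos hΛ.pos (by positivity)
  have hum : ∀ τ, Measurable (u τ) := fun τ => hu.comp (measurable_const.prodMk measurable_id)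
  have hvm : ∀ τ, Measurable (v τ) := fun τ => hv.comp (measurable_const.prodMk measurable_id)
  have hFu := measurable_uncurry_hartree (α := α) (p := p) (q := q) hu
  have hFv := measurable_uncurry_hartree (α := α) (p := p) (q := q) hv
  have h := NormBd.heatInt (n := n) hs hβ hβ2 (measurable_uncurry_hartreeDiff (α := α) (p := p)
    (q := q) hu hv) (γ := fun τ => ENNReal.ofReal (Λ * M ^ (p + q - 1) * η τ)) (by fun_prop)
    (fun τ => by simpa using mul_pos hL (hη0 τ)) (fun _ => ENNReal.ofReal_ne_top) (a := a) (t := t)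
    ((ae_restrict_mem measurableSet_Ioo).mono fun τ hτ =>
      hΛ.lipschitz M (η τ) (u τ) (v τ) hM (hη0 τ) (hum τ) (hvm τ) (hubd τ hτ) (hvbd τ hτ)
        (hd τ hτ))
  refine h.of_le (by linarith) ?_
  filter_upwards [(normBd_duhamelFrom hs hβ hβ2 hΛ hM hu hubd).ae_le,
    (normBd_duhamelFrom hs hβ hβ2 hΛ hM hv hvbd).ae_le] with x hx1 hx2
  refine enorm_toReal_sub_toReal_le (hx1.trans_lt ENNReal.ofReal_lt_top).ne
    (hx2.trans_lt ENNReal.ofReal_lt_top).ne ?_ ?_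
  · rw [← heatInt_add hFv]
    exact heatInt_mono (Eventually.of_forall fun τ => Eventually.of_forall fun y =>
      hartree_le_add_hartreeDiff (hvm τ) y) x
  · rw [← heatInt_add hFu]
    exact heatInt_mono (Eventually.of_forall fun τ => Eventually.of_forall fun y =>
      hartree_le_add_hartreeDiff' (hum τ) y) x

/-- A jointly measurable mild solution on `(0,T)` with datum `φ`, bounded by `M` in
`L^s ∩ L^∞`. -/
structure BddSol (n : ℕ) (α β p q s : ℝ) (φ : EuclideanSpace ℝ (Fin n) → ℝ) (T M : ℝ)
    (u : ℝ → EuclideanSpace ℝ (Fin n) → ℝ) : Prop where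
  measurable : Measurable (Function.uncurry u)
  normBd : ∀ t ∈ Ioo 0 T, NormBd s (ENNReal.ofReal M) (fun x => ‖u t x‖ₑ)
  equation : ∀ t ∈ Ioo 0 T, ∀ᵐ x,
    u t x = heatReal n β t φ x + (duhamelFrom n α β p q 0 t u x).toReal

variable {φ : EuclideanSpace ℝ (Fin n) → ℝ} {T : ℝ}

lemma BddSol.measurable_slice (hu : BddSol n α β p q s φ T M u) (t : ℝ) : Measurable (u t) :=
  hu.measurable.comp (measurable_const.prodMk measurable_id)

lemma BddSol.mono (hu : BddSol n α β p q s φ T M u) (hs : 0 ≤ s) {T' M' : ℝ} (hT : T' ≤ T)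
    (hM : M ≤ M') : BddSol n α β p q s φ T' M' u :=
  ⟨hu.measurable, fun t ht => (hu.normBd t ⟨ht.1, ht.2.trans_le hT⟩).mono hs
    (ENNReal.ofReal_le_ofReal hM), fun t ht => hu.equation t ⟨ht.1, ht.2.trans_le hT⟩⟩

/-- The equation is assumed only at time `a`, and nothing is assumed at time `t`. The identity
therefore serves both to restart a solution and to check the equation for a function obtained by
gluing. -/
lemma heatReal_add_duhamelFrom [NeZero n] (hs : 1 ≤ s) (hβ : 0 < β) (hβ2 : β ≤ 2)
    (hΛ : HartreeBounds n α p q s Λ) (hM : 0 < M) (hφ : Measurable φ)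
    (hφM : NormBd s (ENNReal.ofReal M) (fun x => ‖φ x‖ₑ)) (hu : Measurable (Function.uncurry u))
    (ha : 0 < a) (hat : a < t)
    (hbd : ∀ τ ∈ Ioo 0 t, NormBd s (ENNReal.ofReal M) (fun x => ‖u τ x‖ₑ))
    (heq : ∀ᵐ x, u a x = heatReal n β a φ x + (duhamelFrom n α β p q 0 a u x).toReal) :
    ∀ᵐ x, heatReal n β t φ x + (duhamelFrom n α β p q 0 t u x).toReal =
      heatReal n β (t - a) (u a) x + (duhamelFrom n α β p q a t u x).toReal := by
  have hF := measurable_uncurry_hartree (α := α) (p := p) (q := q) hu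
  have hta : 0 < t - a := sub_pos.2 hat
  set A := duhamelFrom n α β p q 0 a u with hA
  have hAbd := normBd_duhamelFrom hs hβ hβ2 hΛ hM hu (a := 0) (t := a)
    (fun τ hτ => hbd τ ⟨hτ.1, hτ.2.trans hat⟩)
  have hBbd := normBd_duhamelFrom hs hβ hβ2 hΛ hM hu (a := a) (t := t)
    (fun τ hτ => hbd τ ⟨ha.trans hτ.1, hτ.2⟩)
  have hAm : Measurable A := measurable_heatInt hF 0 a
  have hφc := hφM.ae_abs_le hM.le
  have hSφ := (hφM.heatReal hs hβ hβ2 ha hφ).ae_abs_le hM.le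
  have hAc : ∀ᵐ x, |(A x).toReal| ≤ (ENNReal.ofReal (Λ * M ^ (p + q) * (a - 0))).toReal :=
    hAbd.ae_le.mono fun x hx => by
      rw [abs_of_nonneg ENNReal.toReal_nonneg]
      exact ENNReal.toReal_mono ENNReal.ofReal_ne_top hx
  filter_upwards [hBbd.ae_le] with x hx
  rw [heatReal_congr heq, heatReal_add hβ hβ2 hta
    (measurable_heatReal hφ a).aestronglyMeasurable hAm.ennreal_toReal.aestronglyMeasurable
    hSφ hAc, heatReal_heatReal hβ hβ2 hta ha hφ hφc, sub_add_cancel,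
    heatReal_toReal hβ hβ2 hta hAm.aemeasurable
      (hAbd.ae_le.mono fun x hx => hx.trans_lt ENNReal.ofReal_lt_top)]
  simp only [duhamelFrom]
  rw [heatInt_eq_heatOp_add hβ hβ2 ha.le hat hF, ENNReal.toReal_add
    ((heatOp_le_of_ae_le hβ hβ2 hta hAbd.ae_le x).trans_lt ENNReal.ofReal_lt_top).ne
    (hx.trans_lt ENNReal.ofReal_lt_top).ne, add_assoc]

lemma BddSol.restart [NeZero n] (hu : BddSol n α β p q s φ T M u) (hs : 1 ≤ s) (hβ : 0 < β)
    (hβ2 : β ≤ 2) (hΛ : HartreeBounds n α p q s Λ) (hM : 0 < M) (hφ : Measurable φ)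
    (hφM : NormBd s (ENNReal.ofReal M) (fun x => ‖φ x‖ₑ)) (ha : 0 < a) (hat : a < t) (htT : t < T) :
    ∀ᵐ x, u t x = heatReal n β (t - a) (u a) x + (duhamelFrom n α β p q a t u x).toReal := by
  filter_upwards [hu.equation t ⟨ha.trans hat, htT⟩,
    heatReal_add_duhamelFrom hs hβ hβ2 hΛ hM hφ hφM hu.measurable ha hat
    (fun τ hτ => hu.normBd τ ⟨hτ.1, hτ.2.trans htT⟩)
    (hu.equation a ⟨ha, hat.trans htT⟩)] with x h1 h2
  rw [h1, h2]

lemma eLpNorm_sub_heatReal_le [NeZero n] (hs : 1 ≤ s) (hβ : 0 < β) (hβ2 : β ≤ 2)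
    (hΛ : HartreeBounds n α p q s Λ) (hM : 0 < M) (hu : Measurable (Function.uncurry u))
    (hbd : ∀ τ ∈ Ioo a t, NormBd s (ENNReal.ofReal M) (fun x => ‖u τ x‖ₑ))
    {w ψ : EuclideanSpace ℝ (Fin n) → ℝ}
    (heq : ∀ᵐ x, w x = heatReal n β (t - a) ψ x + (duhamelFrom n α β p q a t u x).toReal) :
    eLpNorm (fun x => w x - heatReal n β (t - a) ψ x) (ENNReal.ofReal s) volume ≤
      ENNReal.ofReal ((Λ * M ^ (p + q)) * (t - a)) := by
  have h := normBd_duhamelFrom hs hβ hβ2 hΛ hM hu hbd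
  refine ((normBd_enorm_iff (by linarith)).1 (h.of_le (by linarith) ?_)).2
  filter_upwards [heq] with x hx
  rw [hx, add_sub_cancel_left, Real.enorm_of_nonneg ENNReal.toReal_nonneg]
  exact ENNReal.ofReal_toReal_le

/-- A bounded function of time which is Lipschitz along the semigroup is continuous in `L^s`. -/
lemma tendsto_eLpNorm_sub_of_increment [NeZero n] (hs : 1 ≤ s) (hβ : 0 < β) (hβ2 : β ≤ 2)
    {v : ℝ → EuclideanSpace ℝ (Fin n) → ℝ} {C : ℝ} (hM : 0 ≤ M)
    (hvm : ∀ t ∈ Ico 0 T, Measurable (v t))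
    (hv : ∀ t ∈ Ico 0 T, NormBd s (ENNReal.ofReal M) (fun x => ‖v t x‖ₑ))
    (hinc : ∀ a t, 0 ≤ a → a < t → t < T →
      eLpNorm (fun x => v t x - heatReal n β (t - a) (v a) x) (ENNReal.ofReal s) volume ≤
        ENNReal.ofReal (C * (t - a))) {t₀ : ℝ} (ht₀ : t₀ ∈ Ico 0 T) :
    Tendsto (fun t => eLpNorm (v t - v t₀) (ENNReal.ofReal s) volume) (𝓝[Ico 0 T] t₀) (𝓝 0) := by
  have hs0 : 0 < s := by linarith
  have hs1 : 1 ≤ ENNReal.ofReal s := by simpa using hs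
  have hsc : ∀ t ∈ Ico 0 T, ∀ ε : ℝ≥0∞, 0 < ε → ∃ δ > 0, ∀ h ∈ Ioo 0 δ,
      eLpNorm (fun x => heatReal n β h (v t) x - v t x) (ENNReal.ofReal s) volume ≤ ε := by
    intro t ht ε hε
    have h := tendsto_eLpNorm_heatReal_sub hs hβ hβ2 (hvm t ht)
      ((hv t ht).memLp hs0 ENNReal.ofReal_ne_top (hvm t ht).aestronglyMeasurable)
      ((hv t ht).ae_abs_le hM)
    have h2 := ENNReal.tendsto_nhds_zero.1 h ε hε
    obtain ⟨δ, hδ, hsub⟩ := mem_nhdsGT_iff_exists_Ioo_subset.1 h2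
    exact ⟨δ, hδ, fun h hh => hsub hh⟩
  have hlin : ∀ ε : ℝ≥0∞, 0 < ε → ∃ δ > 0, ∀ h ∈ Ioo 0 δ, ENNReal.ofReal (C * h) ≤ ε := by
    intro ε hε
    have h : Tendsto (fun h : ℝ => ENNReal.ofReal (C * h)) (𝓝[>] 0) (𝓝 0) := by
      have h1 : Continuous fun h : ℝ => ENNReal.ofReal (C * h) := 
        ENNReal.continuous_ofReal.comp (continuous_const.mul continuous_id)
      have h2 := h1.tendsto 0
      rw [mul_zero, ENNReal.ofReal_zero] at h2
      exact h2.mono_left nhdsWithin_le_nhds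
    obtain ⟨δ, hδ, hsub⟩ := mem_nhdsGT_iff_exists_Ioo_subset.1 (ENNReal.tendsto_nhds_zero.1 h ε hε)
    exact ⟨δ, hδ, fun h hh => hsub hh⟩
  refine ENNReal.tendsto_nhds_zero.2 fun ε hε => ?_
  set ε' := ε / 3 with hε'
  have hε'0 : 0 < ε' := ENNReal.div_pos hε.ne' (by norm_num)
  have hsum : ε' + ε' + ε' = ε := ENNReal.add_thirds ε
  obtain ⟨δ₁, hδ₁, h₁⟩ := hsc t₀ ht₀ ε' hε'0
  obtain ⟨δ₂, hδ₂, h₂⟩ := hlin ε' hε'0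
  -- From the right, `v t` is compared with the semigroup applied to the fixed function `v t₀`.
  have hright : ∀ t ∈ Ico 0 T, t₀ < t → t < t₀ + min δ₁ δ₂ →
      eLpNorm (v t - v t₀) (ENNReal.ofReal s) volume ≤ ε := by
    intro t ht htt hlt
    have e : v t - v t₀ = (fun x => v t x - heatReal n β (t - t₀) (v t₀) x) +
        (fun x => heatReal n β (t - t₀) (v t₀) x - v t₀ x) := by
      funext x; simp
    have m1 := measurable_heatReal (β := β) (hvm t₀ ht₀) (t - t₀)
    rw [e]
    refine (eLpNorm_add_le ((hvm t ht).sub m1).aestronglyMeasurable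
      (m1.sub (hvm t₀ ht₀)).aestronglyMeasurable hs1).trans ?_
    calc _ ≤ ε' + ε' := by
          refine add_le_add ((hinc t₀ t ht₀.1 htt ht.2).trans (h₂ _ ⟨by linarith, ?_⟩))
            (h₁ _ ⟨by linarith, ?_⟩)
          · linarith [min_le_right δ₁ δ₂]
          · linarith [min_le_left δ₁ δ₂]
      _ ≤ ε := by rw [← hsum]; exact le_self_add
  obtain ⟨δ₃, hδ₃, hleft⟩ : ∃ δ > 0, ∀ t ∈ Ico 0 T, t < t₀ → t₀ - δ < t →
      eLpNorm (v t - v t₀) (ENNReal.ofReal s) volume ≤ ε := by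
    rcases ht₀.1.eq_or_lt with h0 | h0
    · exact ⟨1, one_pos, fun t ht htt => absurd (h0 ▸ htt) (not_lt.2 ht.1)⟩
    -- From the left, strong continuity at `v t` would not be uniform in `t`. Both `v t` and `v t₀`
    -- are therefore compared with the evolution of `v b` from a fixed earlier time `b`, close
    -- enough to `t₀` for the two increments to be small; contractivity reduces the middle term to
    -- strong continuity at `v b`.
    set b := max (t₀ / 2) (t₀ - δ₂ / 2) with hb
    have hbt : b < t₀ := max_lt (by linarith) (by linarith)
    have hb0 : 0 ≤ b := (by linarith : (0 : ℝ) ≤ t₀ / 2).trans (le_max_left _ _)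
    have hbδ : t₀ - b < δ₂ := by
      have := le_max_right (t₀ / 2) (t₀ - δ₂ / 2)
      rw [← hb] at this
      linarith
    have hbT : b ∈ Ico 0 T := ⟨hb0, hbt.trans ht₀.2⟩
    obtain ⟨δ₄, hδ₄, h₄⟩ := hsc b hbT ε' hε'0
    refine ⟨min (t₀ - b) δ₄, lt_min (by linarith) hδ₄, fun t ht htt hlt => ?_⟩
    have hbt' : b < t := by linarith [min_le_left (t₀ - b) δ₄]
    have htδ : t₀ - t < δ₄ := by linarith [min_le_right (t₀ - b) δ₄]
    have m0 := hvm b hbT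
    have m1 := measurable_heatReal (β := β) m0 (t - b)
    have m2 := measurable_heatReal (β := β) m0 (t₀ - b)
    have m3 := measurable_heatReal (β := β) m0 (t₀ - t)
    have e : v t - v t₀ = ((fun x => v t x - heatReal n β (t - b) (v b) x) +
        (fun x => heatReal n β (t - b) (v b) x - heatReal n β (t₀ - b) (v b) x)) -
        (fun x => v t₀ x - heatReal n β (t₀ - b) (v b) x) := by
      funext x; simp only [Pi.sub_apply, Pi.add_apply]; ring
    have hmid : eLpNorm (fun x => heatReal n β (t - b) (v b) x - heatReal n β (t₀ - b) (v b) x)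
        (ENNReal.ofReal s) volume ≤ ε' := by
      have hbc := (hv b hbT).ae_abs_le hM
      have hSc := ((hv b hbT).heatReal hs hβ hβ2 (sub_pos.2 htt) m0).ae_abs_le hM
      have e2 : (fun x => heatReal n β (t - b) (v b) x - heatReal n β (t₀ - b) (v b) x)
          = heatReal n β (t - b) (fun y => v b y - heatReal n β (t₀ - t) (v b) y) := by
        funext x
        rw [heatReal_sub hβ hβ2 (sub_pos.2 hbt') m0.aestronglyMeasurable
          m3.aestronglyMeasurable hbc hSc, heatReal_heatReal hβ hβ2 (sub_pos.2 hbt')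
          (sub_pos.2 htt) m0 hbc]
        congr 2; ring
      rw [e2]
      refine (eLpNorm_heatReal_le hs hβ hβ2 (sub_pos.2 hbt') (m0.sub m3)).trans ?_
      have e3 : eLpNorm (fun y => v b y - heatReal n β (t₀ - t) (v b) y) (ENNReal.ofReal s) volume
          = eLpNorm (fun y => heatReal n β (t₀ - t) (v b) y - v b y) (ENNReal.ofReal s) volume :=
        eLpNorm_sub_comm _ _ _ _
      change eLpNorm (fun y => v b y - heatReal n β (t₀ - t) (v b) y) _ _ ≤ ε'
      rw [e3]
      exact h₄ _ ⟨by linarith, htδ⟩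
    rw [e]
    refine (eLpNorm_sub_le (((hvm t ht).sub m1).add (m1.sub m2)).aestronglyMeasurable
      ((hvm t₀ ht₀).sub m2).aestronglyMeasurable hs1).trans ?_
    refine (add_le_add_left (eLpNorm_add_le ((hvm t ht).sub m1).aestronglyMeasurable
      (m1.sub m2).aestronglyMeasurable hs1) _).trans ?_
    rw [← hsum]
    refine add_le_add (add_le_add ((hinc b t hb0 hbt' ht.2).trans (h₂ _ ⟨by linarith, ?_⟩)) hmid)
      ((hinc b t₀ hb0 hbt ht₀.2).trans (h₂ _ ⟨by linarith, hbδ⟩))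
    linarith
  have hnhds : Ioo (t₀ - δ₃) (t₀ + min δ₁ δ₂) ∈ 𝓝 t₀ :=
    Ioo_mem_nhds (by linarith) (by linarith [lt_min hδ₁ hδ₂])
  filter_upwards [self_mem_nhdsWithin, mem_nhdsWithin_of_mem_nhds hnhds] with t ht ht2
  rcases lt_trichotomy t t₀ with h | rfl | h
  · exact hleft t ht h ht2.1
  · simp
  · exact hright t ht h ht2.2

/-- Uniqueness in the class of bounded solutions. -/
theorem BddSol.ae_eq [NeZero n] (hs : 1 ≤ s) (hβ : 0 < β)
    (hβ2 : β ≤ 2) (hΛ : HartreeBounds n α p q s Λ) (hM : 0 < M)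
    (hu : BddSol n α β p q s φ T M u) (hv : BddSol n α β p q s φ T M v) :
    ∀ t ∈ Ioo 0 T, u t =ᵐ[volume] v t := by
  have hs0 : 0 ≤ s := by linarith
  set L := Λ * M ^ (p + q - 1) with hL
  have hL0 : 0 < L := mul_pos hΛ.pos (by positivity)
  -- The integral of `L * exp (2 * L * τ)` over `(0, t)` is at most `exp (2 * L * t) / 2`, so each
  -- use of the equation halves the bound, with no smallness condition on `T`.
  have key : ∀ k : ℕ, ∀ t ∈ Ioo 0 T,
      NormBd s (ENNReal.ofReal (2 * M * (1 / 2) ^ k * Real.exp (2 * L * t)))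
        (fun x => ‖u t x - v t x‖ₑ) := by
    intro k
    induction k with
    | zero =>
      intro t ht
      have h := (hu.normBd t ht).add hs (hv.normBd t ht) (hu.measurable_slice t).enorm.aemeasurable
        (hv.measurable_slice t).enorm.aemeasurable
      rw [← ENNReal.ofReal_add hM.le hM.le] at h
      refine (h.mono hs0 (ENNReal.ofReal_le_ofReal ?_)).of_le hs0
        (Eventually.of_forall fun x => enorm_sub_le)
      have h1 : 1 ≤ Real.exp (2 * L * t) := Real.one_le_exp (by have := ht.1; positivity)
      nlinarith
    | succ k ih =>
      intro t ht
      have h := normBd_duhamelFrom_sub hs hβ hβ2 hΛ hM hu.measurable hv.measurable (a := 0) (t := t)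
        (fun τ hτ => hu.normBd τ ⟨hτ.1, hτ.2.trans ht.2⟩)
        (fun τ hτ => hv.normBd τ ⟨hτ.1, hτ.2.trans ht.2⟩)
        (η := fun τ => 2 * M * (1 / 2) ^ k * Real.exp (2 * L * τ)) (by fun_prop)
        (fun τ => by positivity) (fun τ hτ => ih τ ⟨hτ.1, hτ.2.trans ht.2⟩)
      refine (h.mono hs0 ?_).of_le hs0 ?_
      · have hint : IntegrableOn (fun τ => L * (2 * M * (1 / 2) ^ k * Real.exp (2 * L * τ)))
            (Ioo 0 t) := by
          refine (Continuous.integrableOn_Icc ?_).mono_set Ioo_subset_Icc_self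
          fun_prop
        rw [← ofReal_integral_eq_lintegral_ofReal hint
          (Eventually.of_forall fun τ => by positivity)]
        refine ENNReal.ofReal_le_ofReal ?_
        rw [← integral_Ioc_eq_integral_Ioo, ← intervalIntegral.integral_of_le ht.1.le]
        have hder : ∀ τ ∈ uIcc 0 t, HasDerivAt
            (fun τ => 2 * M * (1 / 2) ^ (k + 1) * Real.exp (2 * L * τ))
            (L * (2 * M * (1 / 2) ^ k * Real.exp (2 * L * τ))) τ := by
          intro τ _
          have h1 : HasDerivAt (fun τ : ℝ => 2 * L * τ) (2 * L) τ := by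
            simpa using (hasDerivAt_id τ).const_mul (2 * L)
          refine (h1.exp.const_mul (2 * M * (1 / 2) ^ (k + 1))).congr_deriv ?_
          rw [pow_succ]; ring
        rw [intervalIntegral.integral_eq_sub_of_hasDerivAt hder
          (Continuous.intervalIntegrable (by fun_prop) _ _)]
        have : 0 ≤ 2 * M * (1 / 2) ^ (k + 1) * Real.exp (2 * L * 0) := by positivity
        linarith
      · filter_upwards [hu.equation t ht, hv.equation t ht] with x h1 h2
        rw [h1, h2, add_sub_add_left_eq_sub]
  intro t ht
  have hlim : Tendsto (fun k : ℕ => 2 * M * (1 / 2) ^ k * Real.exp (2 * L * t)) atTop (𝓝 0) := by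
    have := ((tendsto_pow_atTop_nhds_zero_of_lt_one (r := (1 / 2 : ℝ)) (by norm_num)
      (by norm_num)).const_mul (2 * M)).mul_const (Real.exp (2 * L * t))
    simpa using this
  filter_upwards [NormBd.ae_eq_zero (fun k => key k t ht) hlim] with x hx
  exact sub_eq_zero.1 (enorm_eq_zero.1 hx)

end BoundedSolutions

/-! ### Local existence by Picard iteration. -/

section LocalExistence

variable {n : ℕ} {α β p q s Λ M a t : ℝ} {u v : ℝ → EuclideanSpace ℝ (Fin n) → ℝ}
  {φ : EuclideanSpace ℝ (Fin n) → ℝ} {T : ℝ}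

/-- The right-hand side of the integral equation with datum `φ`. -/
noncomputable def picardMap (n : ℕ) (α β p q : ℝ) (φ : EuclideanSpace ℝ (Fin n) → ℝ)
    (u : ℝ → EuclideanSpace ℝ (Fin n) → ℝ) (t : ℝ) (x : EuclideanSpace ℝ (Fin n)) : ℝ :=
  heatReal n β t φ x + (duhamelFrom n α β p q 0 t u x).toReal

lemma measurable_uncurry_picardMap (hφ : Measurable φ) (hu : Measurable (Function.uncurry u)) :
    Measurable (Function.uncurry (picardMap n α β p q φ u)) :=
  (measurable_uncurry_heatReal (β := β) hφ).add (measurable_uncurry_heatInt (β := β)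
    (measurable_uncurry_hartree (α := α) (p := p) (q := q) hu) 0).ennreal_toReal

lemma normBd_duhamelFrom_sub_const [NeZero n] (hs : 1 ≤ s) (hβ : 0 < β) (hβ2 : β ≤ 2)
    (hΛ : HartreeBounds n α p q s Λ) (hM : 0 < M) (hu : Measurable (Function.uncurry u))
    (hv : Measurable (Function.uncurry v))
    (hubd : ∀ τ ∈ Ioo a t, NormBd s (ENNReal.ofReal M) (fun x => ‖u τ x‖ₑ))
    (hvbd : ∀ τ ∈ Ioo a t, NormBd s (ENNReal.ofReal M) (fun x => ‖v τ x‖ₑ))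
    {η : ℝ} (hη : 0 < η)
    (hd : ∀ τ ∈ Ioo a t, NormBd s (ENNReal.ofReal η) (fun x => ‖u τ x - v τ x‖ₑ)) :
    NormBd s (ENNReal.ofReal (Λ * M ^ (p + q - 1) * η * (t - a)))
      (fun x => ‖(duhamelFrom n α β p q a t u x).toReal -
        (duhamelFrom n α β p q a t v x).toReal‖ₑ) := by
  have h := normBd_duhamelFrom_sub hs hβ hβ2 hΛ hM hu hv hubd hvbd (η := fun _ => η)
    measurable_const (fun _ => hη) hd
  have hL : 0 < Λ * M ^ (p + q - 1) * η :=
    mul_pos (mul_pos hΛ.pos (Real.rpow_pos_of_pos hM _)) hη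
  rwa [setLIntegral_const, Real.volume_Ioo, ← ENNReal.ofReal_mul hL.le] at h

lemma NormBd.enorm_add {c d : ℝ} (hs : 1 ≤ s) (hc : 0 ≤ c) (hd : 0 ≤ d)
    {f g h : EuclideanSpace ℝ (Fin n) → ℝ} (hfm : Measurable f) (hgm : Measurable g)
    (hf : NormBd s (ENNReal.ofReal c) (fun x => ‖f x‖ₑ))
    (hg : NormBd s (ENNReal.ofReal d) (fun x => ‖g x‖ₑ)) (hh : ∀ᵐ x, h x = f x + g x) :
    NormBd s (ENNReal.ofReal (c + d)) (fun x => ‖h x‖ₑ) := by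
  have h1 := hf.add hs hg hfm.enorm.aemeasurable hgm.enorm.aemeasurable
  rw [← ENNReal.ofReal_add hc hd] at h1
  exact h1.of_le (by linarith) (hh.mono fun x hx => by rw [hx]; exact enorm_add_le _ _)

/-- Local existence, on a time interval which depends only on the size of the datum. -/
theorem exists_bddSol [NeZero n] (hs : 1 ≤ s) (hβ : 0 < β) (hβ2 : β ≤ 2)
    (hΛ : HartreeBounds n α p q s Λ) (hM : 0 < M) :
    ∃ δ : ℝ, 0 < δ ∧ ∀ φ : EuclideanSpace ℝ (Fin n) → ℝ, Measurable φ →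
      NormBd s (ENNReal.ofReal M) (fun x => ‖φ x‖ₑ) →
      ∃ u, BddSol n α β p q s φ δ (2 * M) u := by
  have hs0 : 0 ≤ s := by linarith
  have h2M : 0 < 2 * M := by linarith
  set L := Λ * (2 * M) ^ (p + q - 1) with hLdef
  have hL : 0 < L := mul_pos hΛ.pos (Real.rpow_pos_of_pos h2M _)
  refine ⟨1 / (2 * L), by positivity, fun φ hφ hφM => ?_⟩
  -- With `L * δ = 1 / 2` the Picard map both preserves the bound `2 * M`, the datum contributing
  -- `M` and the Duhamel term at most `M`, and contracts differences by the factor `1 / 2`.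
  set δ := 1 / (2 * L) with hδ
  have hLδ : L * δ = 1 / 2 := by rw [hδ]; field_simp
  have hLt : ∀ t ∈ Ioo 0 δ, L * (t - 0) ≤ 1 / 2 := fun t ht => by
    rw [← hLδ, sub_zero]; exact mul_le_mul_of_nonneg_left ht.2.le hL.le
  have hstep : ∀ w : ℝ → EuclideanSpace ℝ (Fin n) → ℝ, Measurable (Function.uncurry w) →
      (∀ t ∈ Ioo 0 δ, NormBd s (ENNReal.ofReal (2 * M)) (fun x => ‖w t x‖ₑ)) →
      ∀ t ∈ Ioo 0 δ, NormBd s (ENNReal.ofReal (2 * M))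
        (fun x => ‖picardMap n α β p q φ w t x‖ₑ) := by
    intro w hw hbd t ht
    have hD := normBd_duhamelFrom hs hβ hβ2 hΛ h2M hw (a := 0) (t := t)
      (fun τ hτ => hbd τ ⟨hτ.1, hτ.2.trans ht.2⟩)
    have hDm := measurable_heatInt (β := β)
      (measurable_uncurry_hartree (α := α) (p := p) (q := q) hw) 0 t
    have hle : Λ * (2 * M) ^ (p + q) * (t - 0) ≤ M := by
      have e : (2 * M) ^ (p + q) = (2 * M) ^ (p + q - 1) * (2 * M) := by
        rw [← Real.rpow_add_one h2M.ne', sub_add_cancel]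
      rw [e]
      nlinarith [hLt t ht]
    have h := NormBd.enorm_add (h := picardMap n α β p q φ w t) hs hM.le hM.le
      (measurable_heatReal hφ t) hDm.ennreal_toReal
      (hφM.heatReal hs hβ hβ2 ht.1 hφ) ((hD.mono hs0 (ENNReal.ofReal_le_ofReal hle)).of_le hs0
        (Eventually.of_forall fun x => by
          rw [Real.enorm_of_nonneg ENNReal.toReal_nonneg]; exact ENNReal.ofReal_toReal_le))
      (Eventually.of_forall fun x => rfl)
    rwa [← two_mul] at h
  have hdiff : ∀ w z : ℝ → EuclideanSpace ℝ (Fin n) → ℝ, Measurable (Function.uncurry w) →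
      Measurable (Function.uncurry z) →
      (∀ t ∈ Ioo 0 δ, NormBd s (ENNReal.ofReal (2 * M)) (fun x => ‖w t x‖ₑ)) →
      (∀ t ∈ Ioo 0 δ, NormBd s (ENNReal.ofReal (2 * M)) (fun x => ‖z t x‖ₑ)) →
      ∀ η > 0, (∀ t ∈ Ioo 0 δ, NormBd s (ENNReal.ofReal η) (fun x => ‖w t x - z t x‖ₑ)) →
      ∀ t ∈ Ioo 0 δ, NormBd s (ENNReal.ofReal (η / 2))
        (fun x => ‖picardMap n α β p q φ w t x - picardMap n α β p q φ z t x‖ₑ) := by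
    intro w z hw hz hwb hzb η hη hd t ht
    have h := normBd_duhamelFrom_sub_const hs hβ hβ2 hΛ h2M hw hz (a := 0) (t := t)
      (fun τ hτ => hwb τ ⟨hτ.1, hτ.2.trans ht.2⟩) (fun τ hτ => hzb τ ⟨hτ.1, hτ.2.trans ht.2⟩)
      hη (fun τ hτ => hd τ ⟨hτ.1, hτ.2.trans ht.2⟩)
    refine (h.mono hs0 (ENNReal.ofReal_le_ofReal ?_)).of_le hs0
      (Eventually.of_forall fun x => by simp only [picardMap, add_sub_add_left_eq_sub]; exact le_rfl)
    nlinarith [hLt t ht]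
  set U : ℕ → ℝ → EuclideanSpace ℝ (Fin n) → ℝ :=
    fun k => (picardMap n α β p q φ)^[k] (fun _ _ => 0) with hU
  have hU0 : U 0 = fun _ _ => 0 := rfl
  have hUs : ∀ k, U (k + 1) = picardMap n α β p q φ (U k) := fun k =>
    Function.iterate_succ_apply' _ _ _
  clear_value U
  have hUm : ∀ k, Measurable (Function.uncurry (U k)) := by
    intro k
    induction k with
    | zero => rw [hU0]; exact measurable_const
    | succ k ih => rw [hUs]; exact measurable_uncurry_picardMap hφ ih
  have hUmt : ∀ k t, Measurable (U k t) := fun k t =>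
    (hUm k).comp (measurable_const.prodMk measurable_id)
  have hUbd : ∀ k, ∀ t ∈ Ioo 0 δ, NormBd s (ENNReal.ofReal (2 * M)) (fun x => ‖U k t x‖ₑ) := by
    intro k
    induction k with
    | zero =>
      intro t ht
      refine ⟨Eventually.of_forall fun x => by simp [hU0], ?_⟩
      simp [hU0, ENNReal.zero_rpow_of_pos (by linarith : 0 < s)]
    | succ k ih => rw [hUs]; exact hstep _ (hUm k) ih
  have hUd : ∀ k, ∀ t ∈ Ioo 0 δ, NormBd s (ENNReal.ofReal (2 * M * (1 / 2) ^ k))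
      (fun x => ‖U (k + 1) t x - U k t x‖ₑ) := by
    intro k
    induction k with
    | zero => intro t ht; simpa [hU0] using hUbd 1 t ht
    | succ k ih =>
      intro t ht
      have h := hdiff _ _ (hUm (k + 1)) (hUm k) (hUbd _) (hUbd _) _ (by positivity) ih t ht
      rw [← hUs, ← hUs] at h
      convert h using 2
      rw [pow_succ]; ring
  -- The constant is the partial geometric sum of the bounds in `hUd` from `k` to `k + j - 1`.
  have hUdd : ∀ k j, ∀ t ∈ Ioo 0 δ,
      NormBd s (ENNReal.ofReal (4 * M * (1 / 2) ^ k * (1 - (1 / 2) ^ j)))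
        (fun x => ‖U (k + j) t x - U k t x‖ₑ) := by
    intro k j
    induction j with
    | zero =>
      intro t ht
      refine ⟨Eventually.of_forall fun x => by simp, ?_⟩
      simp [ENNReal.zero_rpow_of_pos (by linarith : 0 < s)]
    | succ j ih =>
      intro t ht
      have hj : (1 / 2 : ℝ) ^ j ≤ 1 := pow_le_one₀ (by norm_num) (by norm_num)
      have hj' : 0 ≤ 1 - (1 / 2 : ℝ) ^ j := sub_nonneg.2 hj
      have h := NormBd.enorm_add (h := fun x => U (k + (j + 1)) t x - U k t x) hs
        (by positivity) (by positivity)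
        ((hUmt (k + j + 1) t).sub (hUmt (k + j) t)) ((hUmt (k + j) t).sub (hUmt k t))
        (hUd (k + j) t ht) (ih t ht)
        (Eventually.of_forall fun x => by simp only [Pi.sub_apply, ← add_assoc]; ring)
      convert h using 2
      rw [pow_succ, pow_add]; ring
  -- The iterates converge only for almost every `x` at each time; the upper limit is defined
  -- everywhere and is jointly measurable.
  obtain ⟨u, hu, hum⟩ : ∃ u : ℝ → EuclideanSpace ℝ (Fin n) → ℝ,
      (∀ t x, u t x = limsup (fun k => U k t x) atTop) ∧ Measurable (Function.uncurry u) :=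
    ⟨fun t x => limsup (fun k => U k t x) atTop, fun _ _ => rfl, Measurable.limsup hUm⟩
  have humt : ∀ t, Measurable (u t) := fun t => hum.comp (measurable_const.prodMk measurable_id)
  have hlim : ∀ t ∈ Ioo 0 δ, ∀ᵐ x, Tendsto (fun k => U k t x) atTop (𝓝 (u t x)) := by
    intro t ht
    have h1 : ∀ᵐ x, ∀ k, ‖U (k + 1) t x - U k t x‖ₑ ≤ ENNReal.ofReal (2 * M * (1 / 2) ^ k) :=
      ae_all_iff.2 fun k => (hUd k t ht).ae_le
    filter_upwards [h1] with x hx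
    have hc : CauchySeq fun k => U k t x := by
      refine cauchySeq_of_le_geometric (1 / 2) (2 * M) (by norm_num) fun k => ?_
      rw [dist_comm, dist_eq_norm]
      have := hx k
      rwa [← ofReal_norm, ENNReal.ofReal_le_ofReal_iff (by positivity)] at this
    obtain ⟨l, hl⟩ := cauchySeq_tendsto_of_complete hc
    rwa [hu, hl.limsup_eq]
  have hubd : ∀ t ∈ Ioo 0 δ, NormBd s (ENNReal.ofReal (2 * M)) (fun x => ‖u t x‖ₑ) :=
    fun t ht => NormBd.of_tendsto (fun k => (hUmt k t).enorm) (fun k => hUbd k t ht)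
      ((hlim t ht).mono fun x hx => hx.enorm)
  have hud : ∀ k, ∀ t ∈ Ioo 0 δ, NormBd s (ENNReal.ofReal (4 * M * (1 / 2) ^ k))
      (fun x => ‖u t x - U k t x‖ₑ) := by
    intro k t ht
    refine NormBd.of_tendsto (f := fun j x => ‖U (k + j) t x - U k t x‖ₑ)
      (fun j => ((hUmt (k + j) t).sub (hUmt k t)).enorm)
      (fun j => (hUdd k j t ht).mono hs0 (ENNReal.ofReal_le_ofReal ?_)) ((hlim t ht).mono
        fun x hx => ?_)
    · have : 0 ≤ 4 * M * (1 / 2) ^ k * (1 / 2 : ℝ) ^ j := by positivity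
      linarith
    · have h2 : Tendsto (fun j => U (k + j) t x) atTop (𝓝 (u t x)) := by
        simpa [add_comm] using (tendsto_add_atTop_iff_nat k).2 hx
      exact (h2.sub_const _).enorm
  refine ⟨u, hum, hubd, fun t ht => ?_⟩
  have hlim0 : Tendsto (fun k : ℕ => 4 * M * (1 / 2) ^ (k + 1) + 4 * M * (1 / 2) ^ k / 2) atTop
      (𝓝 0) := by
    have h1 := tendsto_pow_atTop_nhds_zero_of_lt_one (r := (1 / 2 : ℝ)) (by norm_num) (by norm_num)
    have h2 := (((tendsto_add_atTop_iff_nat 1).2 h1).const_mul (4 * M)).add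
      ((h1.const_mul (4 * M)).div_const 2)
    simpa using h2
  -- The defect of `u` in the equation is split at the iterate `U (k + 1)`, the image of `U k` under
  -- the Picard map.
  have hk : ∀ k, NormBd s
      (ENNReal.ofReal (4 * M * (1 / 2) ^ (k + 1) + 4 * M * (1 / 2) ^ k / 2))
      (fun x => ‖u t x - picardMap n α β p q φ u t x‖ₑ) := by
    intro k
    have h2 := hdiff _ _ (hUm k) hum (hUbd k) hubd (4 * M * (1 / 2) ^ k) (by positivity)
      (fun τ hτ => (hud k τ hτ).of_le hs0 (Eventually.of_forall fun x => by
        rw [← enorm_neg, neg_sub])) t ht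
    rw [← hUs] at h2
    refine NormBd.enorm_add hs (by positivity) (by positivity) ((humt t).sub (hUmt (k + 1) t))
      ((hUmt (k + 1) t).sub ((measurable_uncurry_picardMap hφ hum).comp
        (measurable_const.prodMk measurable_id))) (hud (k + 1) t ht) h2
      (Eventually.of_forall fun x => ?_)
    simp [Function.uncurry]
  filter_upwards [NormBd.ae_eq_zero hk hlim0] with x hx
  exact sub_eq_zero.1 (enorm_eq_zero.1 hx)

end LocalExistence

/-! ### Gluing and patching of solutions. -/

section Continuation

variable {n : ℕ} {α β p q s Λ M a t T : ℝ} {u v : ℝ → EuclideanSpace ℝ (Fin n) → ℝ}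
  {φ : EuclideanSpace ℝ (Fin n) → ℝ}

lemma duhamelFrom_congr (h : ∀ τ ∈ Ioo a t, u τ =ᵐ[volume] v τ) :
    duhamelFrom n α β p q a t u = duhamelFrom n α β p q a t v :=
  funext fun x => heatInt_congr ((ae_restrict_mem measurableSet_Ioo).mono fun τ hτ =>
    hartree_congr (h τ hτ)) x

lemma BddSol.congr (hu : BddSol n α β p q s φ T M u) (hs : 0 ≤ s)
    (hv : Measurable (Function.uncurry v)) (h : ∀ t ∈ Ioo 0 T, v t =ᵐ[volume] u t) :
    BddSol n α β p q s φ T M v := by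
  refine ⟨hv, fun t ht => (hu.normBd t ht).of_le hs ((h t ht).mono fun x hx => by rw [hx]),
    fun t ht => ?_⟩
  rw [duhamelFrom_congr fun τ hτ => h τ ⟨hτ.1, hτ.2.trans ht.2⟩]
  filter_upwards [h t ht, hu.equation t ht] with x h1 h2
  rw [h1, h2]

/-- A solution started at time `a` continues a solution on `(0,a]`. -/
lemma BddSol.glue [NeZero n] (hs : 1 ≤ s) (hβ : 0 < β) (hβ2 : β ≤ 2)
    (hΛ : HartreeBounds n α p q s Λ) (hM : 0 < M) (hφ : Measurable φ)
    (hφM : NormBd s (ENNReal.ofReal M) (fun x => ‖φ x‖ₑ)) (hv : BddSol n α β p q s φ T M v)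
    (ha : a ∈ Ioo 0 T) {δ : ℝ} {w : ℝ → EuclideanSpace ℝ (Fin n) → ℝ}
    (hw : BddSol n α β p q s (v a) δ M w) :
    BddSol n α β p q s φ (a + δ) M (fun t => if t ≤ a then v t else w (t - a)) := by
  set z : ℝ → EuclideanSpace ℝ (Fin n) → ℝ := fun t => if t ≤ a then v t else w (t - a) with hz
  have hzl : ∀ t ≤ a, z t = v t := fun t ht => by simp [hz, ht]
  have hzr : ∀ t, a < t → z t = w (t - a) := fun t ht => by simp [hz, not_le.2 ht]
  have hzm : Measurable (Function.uncurry z) := by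
    have e : Function.uncurry z = fun y => if y.1 ≤ a then Function.uncurry v y
        else Function.uncurry w (y.1 - a, y.2) := by
      funext y
      by_cases hy : y.1 ≤ a <;> simp [hz, hy, Function.uncurry]
    rw [e]
    exact Measurable.ite (measurableSet_le measurable_fst measurable_const) hv.measurable
      (hw.measurable.comp ((measurable_fst.sub_const a).prodMk measurable_snd))
  have hzb : ∀ t ∈ Ioo 0 (a + δ), NormBd s (ENNReal.ofReal M) (fun x => ‖z t x‖ₑ) := by
    intro t ht
    rcases le_or_gt t a with h | h
    · rw [hzl t h]; exact hv.normBd t ⟨ht.1, h.trans_lt ha.2⟩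
    · rw [hzr t h]; exact hw.normBd _ ⟨by linarith, by linarith [ht.2]⟩
  have heql : ∀ t, 0 < t → t ≤ a → ∀ᵐ x,
      z t x = heatReal n β t φ x + (duhamelFrom n α β p q 0 t z x).toReal := by
    intro t ht hta
    rw [hzl t hta, duhamelFrom_congr fun τ hτ => by rw [hzl τ (hτ.2.le.trans hta)]]
    exact hv.equation t ⟨ht, hta.trans_lt ha.2⟩
  refine ⟨hzm, hzb, fun t ht => ?_⟩
  rcases le_or_gt t a with h | h
  · exact heql t ht.1 h
  -- After `a`, translating time identifies the Duhamel term of `z` started at `a` with that of `w`;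
  -- the restart identity adds the history before `a`.
  · have e : duhamelFrom n α β p q a t z = duhamelFrom n α β p q 0 (t - a) w := by
      funext x
      simp only [duhamelFrom]
      rw [heatInt_shift]
      refine heatInt_congr ((ae_restrict_mem measurableSet_Ioo).mono fun τ hτ => ?_) x
      rw [hzr (τ + a) (by linarith [hτ.1]), add_sub_cancel_right]
    filter_upwards [hw.equation (t - a) ⟨by linarith, by linarith [ht.2]⟩,
      heatReal_add_duhamelFrom hs hβ hβ2 hΛ hM hφ hφM hzm ha.1 h
        (fun τ hτ => hzb τ ⟨hτ.1, hτ.2.trans ht.2⟩) (heql a ha.1 le_rfl)] with x h1 h2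
    rw [h2, e, hzr t h, h1, hzl a le_rfl]

/-- A jointly measurable mild solution on `(0,T)` with datum `φ`, bounded in `L^s ∩ L^∞` on
compact subintervals of `[0,T)`. -/
def LocBddSol (n : ℕ) (α β p q s : ℝ) (φ : EuclideanSpace ℝ (Fin n) → ℝ) (T : ℝ)
    (u : ℝ → EuclideanSpace ℝ (Fin n) → ℝ) : Prop :=
  ∀ T' < T, ∃ M, 0 < M ∧ BddSol n α β p q s φ T' M u

lemma LocBddSol.mono (hu : LocBddSol n α β p q s φ T u) {T' : ℝ} (h : T' ≤ T) :
    LocBddSol n α β p q s φ T' u :=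
  fun T'' hT'' => hu T'' (hT''.trans_le h)

lemma BddSol.locBddSol (hu : BddSol n α β p q s φ T M u) (hs : 0 ≤ s) (hM : 0 < M) :
    LocBddSol n α β p q s φ T u :=
  fun _ hT' => ⟨M, hM, hu.mono hs hT'.le le_rfl⟩

lemma LocBddSol.measurable (hu : LocBddSol n α β p q s φ T u) : Measurable (Function.uncurry u) :=
  let ⟨_, _, h⟩ := hu (T - 1) (by linarith)
  h.measurable

lemma LocBddSol.ae_eq [NeZero n] (hs : 1 ≤ s) (hβ : 0 < β) (hβ2 : β ≤ 2)
    (hΛ : HartreeBounds n α p q s Λ) (hu : LocBddSol n α β p q s φ T u)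
    (hv : LocBddSol n α β p q s φ T v) : ∀ t ∈ Ioo 0 T, u t =ᵐ[volume] v t := by
  intro t ht
  have hs0 : 0 ≤ s := by linarith
  obtain ⟨T', h1, h2⟩ := exists_between ht.2
  obtain ⟨M₁, hM₁, hu'⟩ := hu T' h2
  obtain ⟨M₂, hM₂, hv'⟩ := hv T' h2
  exact BddSol.ae_eq hs hβ hβ2 hΛ (lt_max_of_lt_left hM₁)
    (hu'.mono hs0 le_rfl (le_max_left M₁ M₂)) (hv'.mono hs0 le_rfl (le_max_right M₁ M₂)) t ⟨ht.1, h1⟩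

/-- Solutions on an exhausting sequence of intervals patch together. -/
lemma exists_locBddSol_of_forall_lt [NeZero n] (hs : 1 ≤ s) (hβ : 0 < β) (hβ2 : β ≤ 2)
    (hΛ : HartreeBounds n α p q s Λ) (hφ : Measurable φ)
    (h : ∀ T' < T, ∃ u, LocBddSol n α β p q s φ T' u) :
    ∃ v, LocBddSol n α β p q s φ T v ∧ v 0 = φ := by
  have hs0 : 0 ≤ s := by linarith
  have hlt : ∀ k : ℕ, T - 1 / ((k : ℝ) + 1) < T := fun k =>
    sub_lt_self _ (by positivity)
  choose w hw using fun k : ℕ => h (T - 1 / ((k : ℝ) + 1)) (hlt k)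
  -- A measurable choice of an index whose interval contains `t`; the ceiling plus one gives the
  -- strict inequality `t < T - 1 / (κ t + 1)`. Uniqueness makes the choice immaterial almost
  -- everywhere.
  set κ : ℝ → ℕ := fun t => ⌈1 / (T - t)⌉₊ with hκ
  have hκm : Measurable κ :=
    Nat.measurable_ceil.comp (measurable_const.div (measurable_const.sub measurable_id))
  have hκt : ∀ t < T, t < T - 1 / ((κ t : ℝ) + 1) := by
    intro t ht
    have h1 : 0 < T - t := sub_pos.2 ht
    have h2 : 1 / (T - t) < (κ t : ℝ) + 1 := (Nat.le_ceil _).trans_lt (lt_add_one _)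
    have h3 : 1 / ((κ t : ℝ) + 1) < T - t := by
      rw [div_lt_iff₀ (by positivity)]
      rwa [div_lt_iff₀ h1, mul_comm] at h2
    linarith
  set v : ℝ → EuclideanSpace ℝ (Fin n) → ℝ := fun t => if t ≤ 0 then φ else w (κ t) t with hv
  have hvm : Measurable (Function.uncurry v) := by
    have e : Function.uncurry v = fun y => if y.1 ≤ 0 then φ y.2
        else (fun z : ℕ × (ℝ × EuclideanSpace ℝ (Fin n)) => Function.uncurry (w z.1) z.2)
          (κ y.1, y) := by
      funext y
      by_cases hy : y.1 ≤ 0 <;> simp [hv, hy, Function.uncurry]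
    rw [e]
    refine Measurable.ite (measurableSet_le measurable_fst measurable_const)
      (hφ.comp measurable_snd) (Measurable.comp (g := fun z : ℕ × (ℝ × EuclideanSpace ℝ (Fin n)) =>
        Function.uncurry (w z.1) z.2) (measurable_from_prod_countable_right fun k =>
          (hw k).measurable) ((hκm.comp measurable_fst).prodMk measurable_id))
  refine ⟨v, fun T' hT' => ?_, by simp [hv]⟩
  obtain ⟨M, hM, hsol⟩ := hw (κ T') T' (hκt T' hT')
  refine ⟨M, hM, hsol.congr hs0 hvm fun t ht => ?_⟩
  have htT : t < T := ht.2.trans hT'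
  have e : v t = w (κ t) t := by simp [hv, not_le.2 ht.1]
  rw [e]
  exact LocBddSol.ae_eq hs hβ hβ2 hΛ ((hw (κ t)).mono (min_le_left _ _))
    ((hw (κ T')).mono (min_le_right _ _)) t
    ⟨ht.1, lt_min (hκt t htT) (ht.2.trans (hκt T' hT'))⟩

end Continuation

/-! ### From mild solutions to bounded ones and back; the maximal solution. -/

section MildSolutions

variable {n : ℕ} {α β p q s Λ M T : ℝ} {u : ℝ → EuclideanSpace ℝ (Fin n) → ℝ}
  {u0 φ : EuclideanSpace ℝ (Fin n) → ℝ}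

lemma IsMildSolutionIn.exists_normBd_datum {T : EReal} (h : IsMildSolutionIn n α β p q s u0 T u)
    (hs : 1 ≤ s) : ∃ φ M, Measurable φ ∧ φ =ᵐ[volume] u0 ∧ 0 < M ∧
      NormBd s (ENNReal.ofReal M) (fun x => ‖φ x‖ₑ) := by
  have h0 : ((0 : ℝ) : EReal) < T := h.pos
  have hm := (h.memLp 0 le_rfl h0)
  obtain ⟨M, hM⟩ := h.bounded 0 h0
  set φ := hm.1.mk (u 0) with hφ
  have e : u 0 =ᵐ[volume] φ := hm.1.ae_eq_mk
  refine ⟨φ, max 1 (max M (eLpNorm (u 0) (ENNReal.ofReal s) volume).toReal),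
    hm.1.stronglyMeasurable_mk.measurable, e.symm.trans h.initial,
    lt_max_of_lt_left one_pos, (normBd_enorm_iff (by linarith)).2 ⟨?_, ?_⟩⟩
  · rw [← eLpNorm_congr_ae e]
    exact (hM 0 le_rfl le_rfl).trans (ENNReal.ofReal_le_ofReal
      ((le_max_left _ _).trans (le_max_right _ _)))
  · rw [← eLpNorm_congr_ae e, ← ENNReal.ofReal_toReal hm.2.ne]
    refine ENNReal.ofReal_le_ofReal ?_
    rw [ENNReal.toReal_ofReal ENNReal.toReal_nonneg]
    exact (le_max_right _ _).trans (le_max_right _ _)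

/-- The `L^∞` bound on `[0, T']` is part of the class. The `L^s` bound follows from continuity in
time and compactness, each `t₀` having a neighbourhood where the norm is at most that of `u t₀` plus
one. -/
lemma IsMildSolutionIn.exists_normBd {T : EReal} (h : IsMildSolutionIn n α β p q s u0 T u)
    (hs : 1 ≤ s) {T' : ℝ} (hT' : (T' : EReal) < T) :
    ∃ M, 0 < M ∧ ∀ t ∈ Icc 0 T', NormBd s (ENNReal.ofReal M) (fun x => ‖u t x‖ₑ) := by
  have hlt : ∀ t ∈ Icc 0 T', (t : EReal) < T := fun t ht =>
    (EReal.coe_le_coe_iff.2 ht.2).trans_lt hT'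
  obtain ⟨M, hM⟩ := h.bounded T' hT'
  obtain ⟨C, hC, hCb⟩ : ∃ C : ℝ≥0∞, C ≠ ∞ ∧ ∀ t ∈ Icc 0 T', t ∈ Icc 0 T' →
      eLpNorm (u t) (ENNReal.ofReal s) volume ≤ C := by
    refine isCompact_Icc.induction_on (p := fun A => ∃ C : ℝ≥0∞, C ≠ ∞ ∧ ∀ t ∈ A, t ∈ Icc 0 T' →
      eLpNorm (u t) (ENNReal.ofReal s) volume ≤ C) ⟨0, by simp, by simp⟩ ?_ ?_ ?_
    · rintro A B hAB ⟨C, hC, hB⟩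
      exact ⟨C, hC, fun t ht => hB t (hAB ht)⟩
    · rintro A B ⟨C, hC, hA⟩ ⟨D, hD, hB⟩
      refine ⟨max C D, max_ne_top hC hD, fun t ht htI => ?_⟩
      rcases ht with ht | ht
      · exact (hA t ht htI).trans (le_max_left _ _)
      · exact (hB t ht htI).trans (le_max_right _ _)
    · intro t₀ ht₀
      have hm := h.memLp t₀ ht₀.1 (hlt t₀ ht₀)
      have hc := (h.continuous t₀ ht₀.1 (hlt t₀ ht₀)).mono_left
        (nhdsWithin_mono t₀ fun t (ht : t ∈ Icc 0 T') => (⟨ht.1, hlt t ht⟩ : 0 ≤ t ∧ (t : EReal) < T))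
      refine ⟨_, ENNReal.tendsto_nhds_zero.1 hc 1 one_pos,
        eLpNorm (u t₀) (ENNReal.ofReal s) volume + 1, ?_, fun t ht htI => ?_⟩
      · exact ENNReal.add_ne_top.2 ⟨hm.2.ne, by simp⟩
      · have e : u t = u t₀ + (u t - u t₀) := by simp
        have ht : eLpNorm (u t - u t₀) (ENNReal.ofReal s) volume ≤ 1 := ht
        calc eLpNorm (u t) (ENNReal.ofReal s) volume
            = eLpNorm (u t₀ + (u t - u t₀)) (ENNReal.ofReal s) volume := by rw [← e]
          _ ≤ _ := (eLpNorm_add_le hm.1 ((h.memLp t htI.1 (hlt t htI)).1.sub hm.1)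
                (by simpa using hs)).trans (by gcongr)
  refine ⟨max 1 (max M C.toReal), lt_max_of_lt_left one_pos, fun t ht =>
    (normBd_enorm_iff (by linarith)).2 ⟨?_, ?_⟩⟩
  · exact (hM t ht.1 ht.2).trans (ENNReal.ofReal_le_ofReal
      ((le_max_left _ _).trans (le_max_right _ _)))
  · refine (hCb t ht ht).trans ?_
    rw [← ENNReal.ofReal_toReal hC]
    refine ENNReal.ofReal_le_ofReal ?_
    rw [ENNReal.toReal_ofReal ENNReal.toReal_nonneg]
    exact (le_max_right _ _).trans (le_max_right _ _)

/-- A mild solution has a jointly measurable version which satisfies the equation at every time. -/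
lemma IsMildSolutionIn.exists_locBddSol {T : EReal} (h : IsMildSolutionIn n α β p q s u0 T u)
    (hs : 1 ≤ s) (hφ : Measurable φ) (hφu : φ =ᵐ[volume] u0) {T₁ : ℝ} (hT₁ : (T₁ : EReal) ≤ T) :
    ∃ v, LocBddSol n α β p q s φ T₁ v ∧ ∀ t ∈ Ioo 0 T₁, v t =ᵐ[volume] u t := by
  have hs0 : 0 ≤ s := by linarith
  have hlt : ∀ t, t < T₁ → (t : EReal) < T := fun t ht =>
    (EReal.coe_lt_coe_iff.2 ht).trans_le hT₁
  set w : ℝ → EuclideanSpace ℝ (Fin n) → ℝ :=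
    fun t x => h.aemeasurable.mk (Function.uncurry u) (t, x) with hw
  have hwm : Measurable (Function.uncurry w) := h.aemeasurable.measurable_mk
  have hwu : ∀ t, t < T₁ → ∀ᵐ τ ∂volume.restrict (Ioo 0 t), u τ =ᵐ[volume] w τ := by
    intro t ht
    have h1 : ∀ᵐ τ ∂volume.restrict {t : ℝ | 0 < t ∧ (t : EReal) < T}, ∀ᵐ x,
        Function.uncurry u (τ, x) = h.aemeasurable.mk (Function.uncurry u) (τ, x) :=
      Measure.ae_ae_of_ae_prod h.aemeasurable.ae_eq_mk
    exact ae_mono (Measure.restrict_mono (fun τ (hτ : τ ∈ Ioo 0 t) =>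
      (⟨hτ.1, hlt τ (hτ.2.trans ht)⟩ : 0 < τ ∧ (τ : EReal) < T)) le_rfl) h1
  -- The measurable version `w` agrees with `u` only at almost every time. The Duhamel term does not
  -- see the exceptional times, and the equation holds at every `t`, so the Picard image of `w`
  -- agrees with `u t` at all times.
  have hvu : ∀ t ∈ Ioo 0 T₁, picardMap n α β p q φ w t =ᵐ[volume] u t := by
    intro t ht
    filter_upwards [h.equation t ht.1 (hlt t ht.2)] with x hx
    have e : duhamel n α β p q u t x = duhamelFrom n α β p q 0 t w x :=
      heatInt_congr ((hwu t ht.2).mono fun τ hτ => hartree_congr hτ) x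
    rw [hx, e]
    simp only [picardMap]
    rw [heatReal_congr hφu]
    rfl
  refine ⟨picardMap n α β p q φ w, fun T' hT' => ?_, hvu⟩
  obtain ⟨M, hM, hb⟩ := h.exists_normBd hs (hlt T' hT')
  refine ⟨M, hM, measurable_uncurry_picardMap hφ hwm, fun t ht => ?_, fun t ht => ?_⟩
  · exact (hb t ⟨ht.1.le, ht.2.le⟩).of_le hs0
      ((hvu t ⟨ht.1, ht.2.trans hT'⟩).mono fun x hx => by rw [hx])
  · have e : duhamelFrom n α β p q 0 t (picardMap n α β p q φ w) =
        duhamelFrom n α β p q 0 t w := by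
      funext x
      refine heatInt_congr ?_ x
      filter_upwards [hwu t (ht.2.trans hT'), ae_restrict_mem measurableSet_Ioo] with τ h1 h2
      exact hartree_congr ((hvu τ ⟨h2.1, h2.2.trans (ht.2.trans hT')⟩).trans h1)
    rw [e]
    exact Eventually.of_forall fun x => rfl

/-- Continuity in `L^s` is a consequence of the equation: by restarting, the solution differs from
the evolution of its value at an earlier time by an amount linear in the time gap. `LocBddSol` is
silent about time zero, hence the hypotheses on `u 0` and on the size of `φ`. -/
lemma LocBddSol.isMildSolutionIn [NeZero n] (hs : 1 ≤ s) (hβ : 0 < β) (hβ2 : β ≤ 2)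
    (hΛ : HartreeBounds n α p q s Λ) (hu : LocBddSol n α β p q s φ T u) (hT : 0 < T)
    (hφ : Measurable φ) (hφu : φ =ᵐ[volume] u0) (hu0 : u 0 = φ) (hM : 0 < M)
    (hφM : NormBd s (ENNReal.ofReal M) (fun x => ‖φ x‖ₑ)) :
    IsMildSolutionIn n α β p q s u0 (T : EReal) u := by
  have hs0 : 0 < s := by linarith
  have hφc := hφM.ae_abs_le hM.le
  have hmt : ∀ t, Measurable (u t) := fun t =>
    hu.measurable.comp (measurable_const.prodMk measurable_id)
  have hsol : ∀ t < T, ∃ T' M', t < T' ∧ T' < T ∧ 0 < M' ∧ BddSol n α β p q s φ T' M' u ∧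
      (∀ τ ∈ Ico 0 T', NormBd s (ENNReal.ofReal M') (fun x => ‖u τ x‖ₑ)) := by
    intro t ht
    obtain ⟨T', h1, h2⟩ := exists_between ht
    obtain ⟨M₁, hM₁, h3⟩ := hu T' h2
    refine ⟨T', max M M₁, h1, h2, lt_max_of_lt_left hM,
      h3.mono hs0.le le_rfl (le_max_right _ _), fun τ hτ => ?_⟩
    rcases hτ.1.eq_or_lt with h0 | h0
    · rw [← h0, hu0]
      exact hφM.mono hs0.le (ENNReal.ofReal_le_ofReal (le_max_left _ _))
    · exact (h3.normBd τ ⟨h0, hτ.2⟩).mono hs0.le (ENNReal.ofReal_le_ofReal (le_max_right _ _))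
  refine ⟨⟨by exact_mod_cast hT, hu.measurable.aemeasurable, fun t ht _ => ?_, fun t ht htT => ?_,
    fun t ht htT => ?_⟩, by rw [hu0]; exact hφu, fun t ht htT => ?_, fun t₀ ht htT => ?_,
    fun T' hT' => ?_⟩
  · refine Eventually.of_forall fun x => integrable_fracHeatKernel_mul hβ hβ2 ht
      (hφ.aestronglyMeasurable.congr hφu) (c := M) ?_ x
    filter_upwards [hφc, hφu] with y h1 h2
    rwa [← h2]
  · obtain ⟨T', M', h1, -, hM', h3, h4⟩ := hsol t (EReal.coe_lt_coe_iff.1 htT)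
    filter_upwards [(normBd_duhamelFrom hs hβ hβ2 hΛ hM' hu.measurable (a := 0) (t := t)
      (fun τ hτ => h3.normBd τ ⟨hτ.1, hτ.2.trans h1⟩)).ae_le] with x hx
    exact hx.trans_lt ENNReal.ofReal_lt_top
  · obtain ⟨T', M', h1, -, hM', h3, h4⟩ := hsol t (EReal.coe_lt_coe_iff.1 htT)
    filter_upwards [h3.equation t ⟨ht, h1⟩] with x hx
    rw [hx, heatReal_congr hφu]
    rfl
  · obtain ⟨T', M', h1, -, hM', h3, h4⟩ := hsol t (EReal.coe_lt_coe_iff.1 htT)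
    exact (h4 t ⟨ht, h1⟩).memLp hs0 ENNReal.ofReal_ne_top (hmt t).aestronglyMeasurable
  · obtain ⟨T', M', h1, -, hM', h3, h4⟩ := hsol t₀ (EReal.coe_lt_coe_iff.1 htT)
    have hle : 𝓝[{t : ℝ | 0 ≤ t ∧ (t : EReal) < T}] t₀ ≤ 𝓝[Ico 0 T'] t₀ := by
      refine nhdsWithin_le_iff.2 ?_
      filter_upwards [self_mem_nhdsWithin, mem_nhdsWithin_of_mem_nhds (Iio_mem_nhds h1)]
        with t h5 h6 using ⟨h5.1, h6⟩
    refine (tendsto_eLpNorm_sub_of_increment hs hβ hβ2 hM'.le (fun t _ => hmt t) h4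
      (C := Λ * M' ^ (p + q)) (fun a t ha hat htT' => ?_) ⟨ht, h1⟩).mono_left hle
    refine eLpNorm_sub_heatReal_le hs hβ hβ2 hΛ hM' hu.measurable
      (fun τ hτ => h3.normBd τ ⟨ha.trans_lt hτ.1, hτ.2.trans htT'⟩) ?_
    rcases ha.eq_or_lt with h0 | h0
    · rw [← h0, hu0, sub_zero]
      exact h3.equation t ⟨ha.trans_lt hat, htT'⟩
    · exact h3.restart hs hβ hβ2 hΛ hM' hφ (by simpa [hu0] using h4 0 ⟨le_rfl, ht.trans_lt h1⟩)
        h0 hat htT'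
  · obtain ⟨T'', M', h1, -, hM', h3, h4⟩ := hsol T' (EReal.coe_lt_coe_iff.1 hT')
    exact ⟨M', fun t ht htT' => ((normBd_enorm_iff hs0).1 (h4 t ⟨ht, htT'.trans_lt h1⟩)).1⟩

/-- If the existence times are bounded, then every mild solution in `L^s ∩ L^∞` extends to a
maximal one, whose norm tends to infinity. -/
theorem IsMildSolutionIn.exists_maximal [NeZero n] (hs : 1 ≤ s) (hβ : 0 < β) (hβ2 : β ≤ 2)
    (hΛ : HartreeBounds n α p q s Λ) {Tstar : ℝ}
    (hstar : ∀ (T : EReal) (u : ℝ → EuclideanSpace ℝ (Fin n) → ℝ),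
      IsMildSolution n α β p q u0 T u → T ≤ (Tstar : EReal))
    {T : EReal} (h : IsMildSolutionIn n α β p q s u0 T u) :
    ∃ (Tmax : ℝ) (v : ℝ → EuclideanSpace ℝ (Fin n) → ℝ), T ≤ (Tmax : EReal) ∧
      (∀ t : ℝ, 0 ≤ t → (t : EReal) < T → v t =ᵐ[volume] u t) ∧
      IsMaximalMildSolution n α β p q s u0 (Tmax : EReal) v ∧
      Tendsto (fun t : ℝ => eLpNorm (v t) ∞ volume + eLpNorm (v t) (ENNReal.ofReal s) volume)
        (𝓝[<] Tmax) (𝓝 ∞) := by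
  have hs0 : 0 < s := by linarith
  lift T to ℝ using ⟨((hstar T u h.toIsMildSolution).trans_lt (EReal.coe_lt_top _)).ne,
    (EReal.bot_lt_zero.trans h.pos).ne'⟩
  obtain ⟨φ, M₀, hφ, hφu, hM₀, hφM⟩ := h.exists_normBd_datum hs
  have hT : 0 < T := by exact_mod_cast h.pos
  -- Lifespans of measurable, locally bounded solutions with the given datum. Each of them yields a
  -- mild solution, so `Tstar` bounds the set, and solutions of lengths approaching the supremum
  -- patch together.
  set S : Set ℝ := {r | 0 < r ∧ ∃ v, LocBddSol n α β p q s φ r v} with hS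
  obtain ⟨u', hu', huu'⟩ := h.exists_locBddSol hs hφ hφu le_rfl
  have hTS : T ∈ S := ⟨hT, u', hu'⟩
  have hbdd : BddAbove S := by
    refine ⟨Tstar, fun r ⟨hr, v, hv⟩ => ?_⟩
    obtain ⟨w, hw, hw0⟩ := exists_locBddSol_of_forall_lt hs hβ hβ2 hΛ hφ
      (fun T' hT' => ⟨v, hv.mono hT'.le⟩)
    exact EReal.coe_le_coe_iff.1 (hstar _ _ (hw.isMildSolutionIn hs hβ hβ2 hΛ hr hφ hφu hw0 hM₀
      hφM).toIsMildSolution)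
  set Tmax := sSup S with hTmax
  have hTle : T ≤ Tmax := le_csSup hbdd hTS
  have hT0 : 0 < Tmax := hT.trans_le hTle
  obtain ⟨v, hv, hv0⟩ := exists_locBddSol_of_forall_lt (T := Tmax) hs hβ hβ2 hΛ hφ
    (fun T' hT' => by
      obtain ⟨r, ⟨_, w, hw⟩, hr⟩ := exists_lt_of_lt_csSup ⟨T, hTS⟩ hT'
      exact ⟨w, hw.mono hr.le⟩)
  refine ⟨Tmax, v, EReal.coe_le_coe_iff.2 hTle, fun t ht htT => ?_,
    ⟨hv.isMildSolutionIn hs hβ hβ2 hΛ hT0 hφ hφu hv0 hM₀ hφM, fun T' w hT' hw _ => ?_⟩, ?_⟩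
  · rcases ht.eq_or_lt with h0 | h0
    · rw [← h0, hv0]
      exact hφu.trans h.initial.symm
    · have htT := EReal.coe_lt_coe_iff.1 htT
      exact (LocBddSol.ae_eq hs hβ hβ2 hΛ (hv.mono hTle) hu' t ⟨h0, htT⟩).trans (huu' t ⟨h0, htT⟩)
  -- Any solution on a longer interval, whether or not it extends `v`, would place a number larger
  -- than the supremum in `S`.
  · obtain ⟨r, hr1, hr2⟩ := EReal.lt_iff_exists_real_btwn.1 hT'
    have hr1 := EReal.coe_lt_coe_iff.1 hr1
    obtain ⟨w', hw', -⟩ := hw.exists_locBddSol hs hφ hφu hr2.le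
    exact absurd (le_csSup hbdd (⟨hT0.trans hr1, w', hw'⟩ : r ∈ S)) (not_le.2 hr1)
  · refine ENNReal.tendsto_nhds_top_iff_nnreal.2 fun x => ?_
    by_contra hcon
    -- Failure of the limit gives times arbitrarily close to `Tmax` at which both norms are at most
    -- `x`. The local existence time `δ` for data of size `M = x + 1` is the same at all of them, so
    -- restarting at such an `a > Tmax - δ` gives a solution beyond `Tmax`. Adding one ensures `M >
    -- 0`.
    have hfreq : ∃ᶠ t in 𝓝[<] Tmax, eLpNorm (v t) ∞ volume +
        eLpNorm (v t) (ENNReal.ofReal s) volume ≤ x :=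
      (Filter.not_eventually.1 hcon).mono fun t ht => not_lt.1 ht
    set M : ℝ := x + 1 with hM
    have hMpos : 0 < M := by positivity
    obtain ⟨δ, hδ, hex⟩ := exists_bddSol (α := α) (p := p) (q := q) hs hβ hβ2 hΛ hMpos
    obtain ⟨a, hax, ha⟩ := (hfreq.and_eventually (Ioo_mem_nhdsLT
      (max_lt hT0 (sub_lt_self Tmax hδ)))).exists
    have ha0 : 0 < a := (le_max_left _ _).trans_lt ha.1
    have haδ : Tmax < a + δ := by linarith [(le_max_right 0 (Tmax - δ)).trans_lt ha.1]
    have hxM : (x : ℝ≥0∞) ≤ ENNReal.ofReal M := by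
      rw [← ENNReal.ofReal_coe_nnreal]
      exact ENNReal.ofReal_le_ofReal (by linarith)
    have hva : NormBd s (ENNReal.ofReal M) (fun x => ‖v a x‖ₑ) :=
      (normBd_enorm_iff hs0).2 ⟨(le_self_add.trans hax).trans hxM, (le_add_self.trans hax).trans hxM⟩
    have hvm : Measurable (v a) := hv.measurable.comp (measurable_const.prodMk measurable_id)
    obtain ⟨w, hw⟩ := hex (v a) hvm hva
    obtain ⟨T', haT', hT'⟩ := exists_between ha.2
    obtain ⟨M₁, hM₁, hv'⟩ := hv T' hT'
    set N := max M₀ (max M₁ (2 * M)) with hN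
    have hN0 : 0 < N := lt_max_of_lt_left hM₀
    have hg := BddSol.glue hs hβ hβ2 hΛ hN0 hφ
      (hφM.mono hs0.le (ENNReal.ofReal_le_ofReal (le_max_left _ _)))
      (hv'.mono hs0.le le_rfl ((le_max_left _ _).trans (le_max_right _ _))) ⟨ha0, haT'⟩
      (hw.mono hs0.le le_rfl ((le_max_right _ _).trans (le_max_right _ _)))
    exact absurd (le_csSup hbdd (⟨by linarith, _, hg.locBddSol hs0.le hN0⟩ : a + δ ∈ S))
      (not_le.2 haδ)

theorem mildSolutionsBlowUp_of_lifespan_bound [NeZero n] (hα : 0 < α) (hαn : α < n) (hβ : 0 < β)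
    (hβ2 : β ≤ 2) (hp : 1 ≤ p) (hq : 1 ≤ q)
    (h : ∃ Tstar : ℝ, ∀ (T : EReal) (u : ℝ → EuclideanSpace ℝ (Fin n) → ℝ),
      IsMildSolution n α β p q u0 T u → T ≤ (Tstar : EReal)) :
    MildSolutionsBlowUp n α β p q u0 := by
  refine ⟨h, fun s hs hsp T u hu => ?_⟩
  obtain ⟨Tstar, hstar⟩ := h
  obtain ⟨Λ, h0, h1, h2⟩ := exists_hartree_bounds (n := n) hα hαn hp hq hs hsp
  exact hu.exists_maximal hs hβ hβ2 ⟨h0, h1, h2⟩ hstar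

end MildSolutions
theorem theorem1p5 (n : ℕ) (hn : 1 ≤ n) (α β p q : ℝ) (hα : 0 < α) (hαn : α < n)
    (hβ : 0 < β) (hβ2 : β ≤ 2) (hp : 1 < p) (hq : 1 ≤ q)
    (u0 : EuclideanSpace ℝ (Fin n) → ℝ) :
    (n < α + β → Integrable u0 volume → 0 < ∫ x, u0 x →
      2 < p + q → p + q < 1 + (α + β) / n →
        MildSolutionsBlowUp n α β p q u0) ∧
    (∀ ε γ : ℝ, 0 < ε → 0 < γ → γ < α + β → LocallyIntegrable u0 volume →
      (∀ᵐ x, ε * (1 + ‖x‖ ^ 2) ^ (-γ / 2) ≤ u0 x) →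
      2 < p + q → p + q < 1 + (α + β) / γ →
        MildSolutionsBlowUp n α β p q u0) := by
  have : NeZero n := ⟨by omega⟩
  refine ⟨fun _ hu0 hpos hpq hcrit => ?_, fun ε γ hε hγ _ _ hdecay hpq hcrit => ?_⟩
  · exact mildSolutionsBlowUp_of_lifespan_bound hα hαn hβ hβ2 hp.le hq
      (exists_lifespan_bound_of_integral_pos hα hαn hβ (by linarith) (by linarith) (by linarith)
        hu0 hpos hcrit)
  · exact mildSolutionsBlowUp_of_lifespan_bound hα hαn hβ hβ2 hp.le hq
      (exists_lifespan_bound_of_slow_decay hα hαn hβ hβ2 (by linarith) (by linarith) (by linarith)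
        hε hγ hdecay hcrit)
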